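/- Let $n\ge 3$. Realize the Weyl group $W$ of type $D_n$ as the group of signed permutations $w$ of $\{\pm1,\dots,\pm n\}$ ($w(-k)=-w(k)$) generated by $s_1=(1,-2)(-1,2)$ and $s_i=(i-1,i)(-(i-1),-i)$, $2\le i\le n$, written in one-line notation $w=(w(1),\dots,w(n))$. It acts on $\mathbb R^n=\bigoplus_k\mathbb R\varepsilon_k$ by $w(\varepsilon_k)=\varepsilon_{w(k)}$, $\varepsilon_{-k}=-\varepsilon_k$. The simple roots are $\alpha_1=\varepsilon_1+\varepsilon_2$, $\alpha_i=\varepsilon_i-\varepsilon_{i-1}$ $(2\le i\le n)$, with fundamental weights $\omega_1,\dots,\omega_n$; the positive roots are $R^+=\{\varepsilon_j\pm\varepsilon_i: 1\le i<j\le n\}$. Let $W^{I_r}=\{w\in W: w(\alpha_i)\in R^+ \text{ for all } i\ne r\}$, ordered by the Bruhat order of $W$. For $x\in\mathbb R^n$ write $x\ge0$ if $x$ is a linear combination of simple roots with nonnegative real coefficients, and $x\le 0$ if $-x\ge 0$. Call $w\in W^{I_r}$ *minimal* if it is a minimal element of $\{w\in W^{I_r}:w(\omega_r)\le0\}$, and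 $v\in W^{I_r}$ *maximal* if it is a maximal element of $\{v\in W^{I_r}:v(\omega_r)\ge0\}$. Let $J_{p,[a,b]}$ be the set of integer tuples $\underline i=(i_1,\dots,i_p)$ with $a\le i_k\le b$ and $i_{k+1}-i_k\ge2$. Put $[\underline i]=\{i_1,\dots,i_p\}$, $\underline i'=(i_1-1,\dots,i_p-1)$, $-\underline i=(-i_p,\dots,-i_1)$ and $s_{\underline i}=s_{i_1}s_{i_2}\cdots s_{i_p}$. Let $A_a(\underline i)$ be the elements of $\{a,a+1,\dots,n\}\setminus([\underline i]\cup[\underline i'])$ in increasing order, and let $A_a^-(\underline i)$ be the same list with its smallest element $t$ (the first entry) replaced by $-t$. (i) For $r=1$ there is exactly one minimal $w$, namely $$w=\begin{cases}(-n,-(n-2),\dots,-4,-2,1,3,5,\dots,n-3,n-1)& n\equiv0\ (4)\\(-n,-(n-2),\dots,-4,-2,-1,3,5,\dots,n-3,n-1)& n\equiv2\ (4)\\(-n,-(n-2),\dots,-5,-3,-2,-1,4,6,\dots,n-3,n-1)& n\equiv1\ (4)\\(-n,-(n-2),\dots,-5,-3,-2,1,4,6,\dots,n-3,n-1)& n\equiv3\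 (4).\end{cases}$$ (ii) For $r=2$ there is exactly one minimal $w$, namely $$w=\begin{cases}(n,-(n-2),\dots,-4,-2,-1,3,5,\dots,n-3,n-1)& n\equiv0\ (4)\\(n,-(n-2),\dots,-4,-2,1,3,5,\dots,n-3,n-1)& n\equiv2\ (4)\\(n,-(n-2),\dots,-5,-3,-2,1,4,6,\dots,n-3,n-1)& n\equiv1\ (4)\\(n,-(n-2),\dots,-5,-3,-2,-1,4,6,\dots,n-3,n-1)& n\equiv3\ (4).\end{cases}$$ (In (i) and (ii), for $n=3$ the lists are $(-3,-2,1)$ and $(3,-2,-1)$.) (iii) Let $3\le r\le n-1$ and $n+1-r=2m$. The minimal $w$ are exactly the elements $w_{\underline i}$ $(\underline i\in J_{m,[3,n]})$ and $w_{1,\underline i},w_{2,\underline i}$ $(\underline i\in J_{m-1,[4,n]})$ below. Each of them is minimal, the corresponding $v$ is maximal with the indicated $v(\omega_r)$, $w$ is obtained from $v$ by the indicated product, and $w(\omega_r)=-v(\omega_r)$. * $v_{\underline i}(\omega_r)=\sum_k\alpha_{i_k}$ and $w_{\underline i}=s_{\underline i}v_{\underline i}$, where $v_{\underline i}=(\epsilon,A_2(\underline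 i),-\underline i',\underline i)$ and $w_{\underline i}=(\epsilon,A_2(\underline i),-\underline i,\underline i')$, with $\epsilon=-1$ for $m$ odd and $\epsilon=1$ for $m$ even. * $v_{1,\underline i}(\omega_r)=\alpha_1+\sum_k\alpha_{i_k}$ and $w_{1,\underline i}=s_1s_{\underline i}v_{1,\underline i}$, where $v_{1,\underline i}=(A,-\underline i',1,2,\underline i)$ and $w_{1,\underline i}=(A,-\underline i,-2,-1,\underline i')$, with $A=A_3(\underline i)$ for $m$ odd and $A=A_3^-(\underline i)$ for $m$ even. * $v_{2,\underline i}(\omega_r)=\alpha_2+\sum_k\alpha_{i_k}$ and $w_{2,\underline i}=s_2s_{\underline i}v_{2,\underline i}$, where $v_{2,\underline i}=(A,-\underline i',-1,2,\underline i)$ and $w_{2,\underline i}=(A,-\underline i,-2,1,\underline i')$, with $A=A_3^-(\underline i)$ for $m$ odd and $A=A_3(\underline i)$ for $m$ even. (iv) Let $3\le r\le n-1$ and $n+1-r=2m+1$. The minimal $w$ are exactly the elements $w_{\underline i}$ $(\underline i\in J_{m,[4,n]})$ and $w_{\underline i,1},w_{\underline i,2}$ $(\underline i\in J_{m-1,[5,n]})$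 below. Each of them is minimal, the corresponding $v$ is maximal with the indicated $v(\omega_r)$, $w$ is obtained from $v$ by the indicated product, and $w_{\underline i}(\omega_r)=-v_{\underline i}(\omega_r)$, $w_{\underline i,1}(\omega_r)=-v_{\underline i,1}(\omega_r)$, $w_{\underline i,2}(\omega_r)=-v_{\underline i,2}(\omega_r)$. (Note that $w_{\underline i,2}$ is obtained from $v_{\underline i,1}$ and $w_{\underline i,1}$ from $v_{\underline i,2}$.) * $v_{\underline i}(\omega_r)=\frac12\alpha_1+\frac12\alpha_2+\sum_k\alpha_{i_k}$ and $w_{\underline i}=s_1s_2s_{\underline i}v_{\underline i}$, where $v_{\underline i}=(\epsilon,A_3(\underline i),-\underline i',2,\underline i)$ and $w_{\underline i}=(-\epsilon,A_3(\underline i),-\underline i,-2,\underline i')$, with $\epsilon=-1$ for $m$ odd and $\epsilon=1$ for $m$ even. * $v_{\underline i,1}(\omega_r)=\frac32\alpha_1+\frac12\alpha_2+\alpha_3+\sum_k\alpha_{i_k}$ and $w_{\underline i,2}=s_2s_3s_1s_{\underline i}v_{\underline i,1}$, where $v_{\underline i,1}=(A,-\underline i',1,2,3,\underline i)$ and $w_{\underline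 i,2}=(A,-\underline i,-3,-2,1,\underline i')$, with $A=A_4(\underline i)$ for $m$ odd and $A=A_4^-(\underline i)$ for $m$ even. * $v_{\underline i,2}(\omega_r)=\frac12\alpha_1+\frac32\alpha_2+\alpha_3+\sum_k\alpha_{i_k}$ and $w_{\underline i,1}=s_1s_3s_2s_{\underline i}v_{\underline i,2}$, where $v_{\underline i,2}=(A,-\underline i',-1,2,3,\underline i)$ and $w_{\underline i,1}=(A,-\underline i,-3,-2,-1,\underline i')$, with $A=A_4^-(\underline i)$ for $m$ odd and $A=A_4(\underline i)$ for $m$ even. (v) For $r=n$ there is exactly one minimal $w$, namely $w=s_1s_2v=(-1,3,4,\dots,n,-2)$, where $v=(1,3,4,\dots,n,2)$ is maximal with $v(\omega_n)=\frac12\alpha_1+\frac12\alpha_2$; and $w(\omega_n)=-v(\omega_n)$. -/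

import Mathlib

/-!
The Weyl group of type `D_n` as a group of signed permutations of `{±1, …, ±n}`, acting on
`E = ℝ^n`; the simple root `α_1 = ε_1 + ε_2` is the special node and `α_i = ε_i - ε_{i-1}` for
`2 ≤ i ≤ n`.
-/

namespace TypeD

noncomputable section

/-- The real span of the character lattice, with its orthonormal coordinates. The coordinate with
number `k ∈ {1, …, n}` is the one at `k - 1 : Fin n`. -/
abbrev E (n : ℕ) : Type := Fin n → ℝ

/-- The vector `ε_k` for `1 ≤ k ≤ n`, and `ε_{-k} = -ε_k`. -/
def e (n : ℕ) (k : ℤ) : E n := fun j =>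
  if (j : ℤ) + 1 = k then 1 else if (j : ℤ) + 1 = -k then -1 else 0

/-- The simple roots `α_1 = ε_1 + ε_2`, `α_i = ε_i - ε_{i-1}` (`2 ≤ i ≤ n`). -/
def simpleRoot (n : ℕ) (i : ℤ) : E n :=
  if i = 1 then e n 1 + e n 2 else e n i - e n (i - 1)

/-- The positive roots `ε_j ± ε_i`, `1 ≤ i < j ≤ n`. -/
def posRoots (n : ℕ) : Set (E n) :=
  {x | ∃ i j : ℤ, 1 ≤ i ∧ i < j ∧ j ≤ n ∧ (x = e n j - e n i ∨ x = e n j + e n i)}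

/-- The fundamental weights: `ω_1 = (ε_1 + ⋯ + ε_n) / 2`, `ω_2 = (-ε_1 + ε_2 + ⋯ + ε_n) / 2`,
`ω_r = ε_r + ⋯ + ε_n` for `3 ≤ r ≤ n`. -/
def fundWeight (n : ℕ) (r : ℕ) : E n := fun j =>
  if r = 1 then 1 / 2
  else if r = 2 then (if (j : ℕ) = 0 then -1 / 2 else 1 / 2)
  else if r ≤ (j : ℕ) + 1 then 1 else 0

/-- The pairing `⟨x, β^∨⟩ = 2 (x, β) / (β, β)` of a weight with a coroot. -/
def corootPairing {n : ℕ} (x β : E n) : ℝ := 2 * (x ⬝ᵥ β) / (β ⬝ᵥ β)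

/-- `x ≥ 0` in the root order: `x` is a nonnegative combination of the simple roots. -/
def RootNonneg (n : ℕ) (x : E n) : Prop :=
  ∃ c : ℤ → ℝ, (∀ i ∈ Finset.Icc (1 : ℤ) n, 0 ≤ c i) ∧
    x = ∑ i ∈ Finset.Icc (1 : ℤ) n, c i • simpleRoot n i

/-- The simple reflections, as permutations of the integers: `s_1 = (1, -2)(-1, 2)` and
`s_i = (i - 1, i)(-(i - 1), -i)` for `2 ≤ i ≤ n`. -/
def s (i : ℤ) : Equiv.Perm ℤ :=
  if i = 1 then Equiv.swap 1 (-2) * Equiv.swap (-1) 2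
  else Equiv.swap (i - 1) i * Equiv.swap (-(i - 1)) (-i)

/-- The Weyl group of type `D_n`. -/
def weylGroup (n : ℕ) : Subgroup (Equiv.Perm ℤ) :=
  Subgroup.closure {t | ∃ i : ℤ, 1 ≤ i ∧ i ≤ n ∧ t = s i}

/-- The linear action on `E`, determined by `w(ε_k) = ε_{w(k)}`. -/
def act (n : ℕ) (w : Equiv.Perm ℤ) (x : E n) : E n :=
  ∑ j : Fin n, x j • e n (w ((j : ℤ) + 1))

/-- The one-line notation `(w(1), …, w(n))`. -/
def oneLine (n : ℕ) (w : Equiv.Perm ℤ) : List ℤ :=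
  (List.range n).map fun j => w ((j : ℤ) + 1)

/-- The Coxeter length with respect to the simple reflections `s_1, …, s_n`. -/
def length (n : ℕ) (w : Equiv.Perm ℤ) : ℕ :=
  sInf {k | ∃ l : List ℤ, (∀ i ∈ l, 1 ≤ i ∧ i ≤ n) ∧ (l.map s).prod = w ∧ l.length = k}

/-- The reflections of the Weyl group: the conjugates of the simple reflections. -/
def reflections (n : ℕ) : Set (Equiv.Perm ℤ) :=
  {t | ∃ g ∈ weylGroup n, ∃ i : ℤ, 1 ≤ i ∧ i ≤ n ∧ t = g * s i * g⁻¹}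

/-- The Bruhat order: `u ≤ v` if `v` is reached from `u` by left multiplications by reflections,
each of which increases the length. -/
def BruhatLE (n : ℕ) : Equiv.Perm ℤ → Equiv.Perm ℤ → Prop :=
  Relation.ReflTransGen fun u v =>
    length n u < length n v ∧ ∃ t ∈ reflections n, v = t * u

/-- `W^{I_r}`, `I_r = {α_r}`: the `w` in the Weyl group with `w(α_i) > 0` for all simple roots
`α_i ≠ α_r`. -/
def minReps (n r : ℕ) : Set (Equiv.Perm ℤ) :=
  {w | w ∈ weylGroup n ∧ ∀ i : ℤ, 1 ≤ i → i ≤ n → i ≠ r → act n w (simpleRoot n i) ∈ posRoots n}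

/-- `v` is a maximal element of `{v ∈ W^{I_r} : v(ω_r) ≥ 0}` in the Bruhat order. -/
def IsMaximalNonneg (n r : ℕ) (v : Equiv.Perm ℤ) : Prop :=
  (v ∈ minReps n r ∧ RootNonneg n (act n v (fundWeight n r))) ∧
    ∀ u ∈ minReps n r, RootNonneg n (act n u (fundWeight n r)) → BruhatLE n v u → u = v

/-- `w` is a minimal element of `{w ∈ W^{I_r} : w(ω_r) ≤ 0}` in the Bruhat order. -/
def IsMinimalNonpos (n r : ℕ) (w : Equiv.Perm ℤ) : Prop :=
  (w ∈ minReps n r ∧ RootNonneg n (-act n w (fundWeight n r))) ∧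
    ∀ u ∈ minReps n r, RootNonneg n (-act n u (fundWeight n r)) → BruhatLE n u w → u = w

/-- `J_{p,[a,b]}`: the tuples `(i_1, …, i_p)` of integers in `[a, b]` with
`i_{k+1} - i_k ≥ 2` for all `k`. -/
def J (p : ℕ) (a b : ℤ) : Set (List ℤ) :=
  {l | l.length = p ∧ (∀ x ∈ l, a ≤ x ∧ x ≤ b) ∧ l.IsChain fun x y => x + 2 ≤ y}

/-- The sum `∑_k α_{i_k}`. -/
def rootSum (n : ℕ) (i : List ℤ) : E n := (i.map (simpleRoot n)).sum

/-- The product `s_{i_1} s_{i_2} ⋯ s_{i_p}`. -/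
def word (i : List ℤ) : Equiv.Perm ℤ := (i.map s).prod

end

/-- `i' = (i_1 - 1, …, i_p - 1)`. -/
def pred (i : List ℤ) : List ℤ := i.map fun x => x - 1

/-- `-i = (-i_p, …, -i_1)`. -/
def neg (i : List ℤ) : List ℤ := (i.map fun x => -x).reverse

/-- `(a, a + 1, …, n)`, empty if `n < a`. -/
def interval (a n : ℕ) : List ℤ := (List.range (n + 1 - a)).map fun j => (a : ℤ) + j

/-- `[a, n] ∖ {[i], [i']}` in increasing order. -/
def rest (a n : ℕ) (i : List ℤ) : List ℤ :=
  (interval a n).filter fun x => x ∉ i ∧ x ∉ pred i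

/-- Changes the sign of the first entry of a list. On a list in increasing order
this replaces the minimum `t` by `-t`. -/
def negHead : List ℤ → List ℤ
  | [] => []
  | t :: l => -t :: l

/-- `(-n, -(n-2), …, -4, -2)` for even `n` and `(-n, -(n-2), …, -5, -3)` for odd `n`. -/
def down (n : ℕ) : List ℤ := (List.range (n / 2)).map fun j => -((n : ℤ) - 2 * j)

/-- `(3, 5, …, n-3, n-1)` for even `n` and `(4, 6, …, n-3, n-1)` for odd `n`. -/
def up (n : ℕ) : List ℤ :=
  (List.range (n / 2 - 1)).map fun j => (if Even n then 3 else 4) + 2 * (j : ℤ)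

/-- The minimal element for `r = 1`. -/
def wOne (n : ℕ) : List ℤ :=
  if n % 4 = 0 then down n ++ [1] ++ up n
  else if n % 4 = 2 then down n ++ [-1] ++ up n
  else if n % 4 = 1 then down n ++ [-2, -1] ++ up n
  else down n ++ [-2, 1] ++ up n

/-- The minimal element for `r = 2`; here `negHead (down n)` is `(n, -(n-2), …)`. -/
def wTwo (n : ℕ) : List ℤ :=
  if n % 4 = 0 then negHead (down n) ++ [-1] ++ up n
  else if n % 4 = 2 then negHead (down n) ++ [1] ++ up n
  else if n % 4 = 1 then negHead (down n) ++ [-2, 1] ++ up n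
  else negHead (down n) ++ [-2, -1] ++ up n

/-! `n + 1 - r = 2 m`: the elements `v_i, w_i` (`i ∈ J_{m,[3,n]}`) and
`v_{1,i}, w_{1,i}, v_{2,i}, w_{2,i}` (`i ∈ J_{m-1,[4,n]}`). -/

def vE (n m : ℕ) (i : List ℤ) : List ℤ :=
  (if Odd m then [-1] else [1]) ++ rest 2 n i ++ neg (pred i) ++ i

def wE (n m : ℕ) (i : List ℤ) : List ℤ :=
  (if Odd m then [-1] else [1]) ++ rest 2 n i ++ neg i ++ pred i

def vE1 (n m : ℕ) (i : List ℤ) : List ℤ :=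
  (if Odd m then rest 3 n i else negHead (rest 3 n i)) ++ neg (pred i) ++ [1, 2] ++ i

def wE1 (n m : ℕ) (i : List ℤ) : List ℤ :=
  (if Odd m then rest 3 n i else negHead (rest 3 n i)) ++ neg i ++ [-2, -1] ++ pred i

def vE2 (n m : ℕ) (i : List ℤ) : List ℤ :=
  (if Odd m then negHead (rest 3 n i) else rest 3 n i) ++ neg (pred i) ++ [-1, 2] ++ i

def wE2 (n m : ℕ) (i : List ℤ) : List ℤ :=
  (if Odd m then negHead (rest 3 n i) else rest 3 n i) ++ neg i ++ [-2, 1] ++ pred i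

/-! `n + 1 - r = 2 m + 1`: the elements `v_i, w_i` (`i ∈ J_{m,[4,n]}`) and
`v_{i,1}, w_{i,1}, v_{i,2}, w_{i,2}` (`i ∈ J_{m-1,[5,n]}`). -/

def vO (n m : ℕ) (i : List ℤ) : List ℤ :=
  (if Odd m then [-1] else [1]) ++ rest 3 n i ++ neg (pred i) ++ [2] ++ i

def wO (n m : ℕ) (i : List ℤ) : List ℤ :=
  (if Odd m then [1] else [-1]) ++ rest 3 n i ++ neg i ++ [-2] ++ pred i

def vO1 (n m : ℕ) (i : List ℤ) : List ℤ :=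
  (if Odd m then rest 4 n i else negHead (rest 4 n i)) ++ neg (pred i) ++ [1, 2, 3] ++ i

def wO2 (n m : ℕ) (i : List ℤ) : List ℤ :=
  (if Odd m then rest 4 n i else negHead (rest 4 n i)) ++ neg i ++ [-3, -2, 1] ++ pred i

def vO2 (n m : ℕ) (i : List ℤ) : List ℤ :=
  (if Odd m then negHead (rest 4 n i) else rest 4 n i) ++ neg (pred i) ++ [-1, 2, 3] ++ i

def wO1 (n m : ℕ) (i : List ℤ) : List ℤ :=
  (if Odd m then negHead (rest 4 n i) else rest 4 n i) ++ neg i ++ [-3, -2, -1] ++ pred i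

/-- `(1, 3, 4, …, n - 1, n, 2)`. -/
def vLast (n : ℕ) : List ℤ := [1] ++ interval 3 n ++ [2]

/-- `(-1, 3, 4, …, n - 1, n, -2)`. -/
def wLast (n : ℕ) : List ℤ := [-1] ++ interval 3 n ++ [-2]

noncomputable section

/-- `v` has the one-line notation `vLine`, is maximal with `v(ω_r) ≥ 0`, and `v(ω_r) = χ`. -/
def ListedMax (n r : ℕ) (vLine : List ℤ) (χ : E n) (v : Equiv.Perm ℤ) : Prop :=
  oneLine n v = vLine ∧ IsMaximalNonneg n r v ∧ act n v (fundWeight n r) = χ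

/-- `w` has the one-line notation `wLine` and is minimal with `w(ω_r) ≤ 0`. -/
def ListedMin (n r : ℕ) (wLine : List ℤ) (w : Equiv.Perm ℤ) : Prop :=
  oneLine n w = wLine ∧ IsMinimalNonpos n r w

/-- There is a matched pair `(v, w)`: `v` is maximal, given by `vLine`, with `v(ω_r) = χ`;
`w = x v` is minimal, given by `wLine`, and `w(ω_r) = -v(ω_r)`. -/
def Matched (n r : ℕ) (vLine : List ℤ) (χ : E n) (x : Equiv.Perm ℤ) (wLine : List ℤ) : Prop :=
  ∃ v w : Equiv.Perm ℤ, ListedMax n r vLine χ v ∧ ListedMin n r wLine w ∧ w = x * v ∧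
    act n w (fundWeight n r) = -act n v (fundWeight n r)

end

theorem dot_e (n : ℕ) (x : E n) (k : ℕ) (hk : k < n) : x ⬝ᵥ e n ((k : ℤ) + 1) = x ⟨k, hk⟩ := by
  have h : e n ((k : ℤ) + 1) = Pi.single (⟨k, hk⟩ : Fin n) (1 : ℝ) := by
    funext j
    by_cases hj : j = ⟨k, hk⟩
    · subst hj
      simp [e]
    · have h1 : (j : ℕ) ≠ k := fun h => hj (Fin.ext h)
      rw [Pi.single_eq_of_ne hj]
      unfold e
      rw [if_neg (by omega), if_neg (by omega)]
  rw [h, dotProduct_single_one]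

/-- `⟨ω_r, α_i^∨⟩ = δ_{ri}`: the vectors `ω_1, …, ω_n` are the fundamental weights. -/
theorem fundWeight_pairing (n : ℕ) (hn : 2 ≤ n) (r i : ℕ) (hr : 1 ≤ r) (hi : 1 ≤ i)
    (hi' : i ≤ n) :
    corootPairing (fundWeight n r) (simpleRoot n i) = if r = i then 1 else 0 := by
  rcases Nat.lt_or_ge 1 i with h | h
  · obtain ⟨k, rfl⟩ : ∃ k, i = k + 2 := ⟨i - 2, by omega⟩
    have hs : simpleRoot n ((k + 2 : ℕ) : ℤ)
        = e n (((k + 1 : ℕ) : ℤ) + 1) - e n ((k : ℤ) + 1) := by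
      unfold simpleRoot
      rw [if_neg (by omega)]
      push_cast
      congr 2 <;> ring
    have hd : ∀ x : E n, x ⬝ᵥ simpleRoot n ((k + 2 : ℕ) : ℤ)
        = x ⟨k + 1, by omega⟩ - x ⟨k, by omega⟩ := by
      intro x
      rw [hs, dotProduct_sub, dot_e n x (k + 1) (by omega), dot_e n x k (by omega)]
    have hq : simpleRoot n ((k + 2 : ℕ) : ℤ) ⬝ᵥ simpleRoot n ((k + 2 : ℕ) : ℤ) = 2 := by
      rw [hd, hs]
      simp only [Pi.sub_apply, e]
      push_cast
      split_ifs <;> first | omega | norm_num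
    rw [corootPairing, hq, hd]
    simp only [fundWeight]
    split_ifs <;> first | omega | (norm_num; done) | (exfalso; simp_all)
  · obtain rfl : i = 1 := by omega
    have hs : simpleRoot n ((1 : ℕ) : ℤ) = e n (((0 : ℕ) : ℤ) + 1) + e n (((1 : ℕ) : ℤ) + 1) := by
      unfold simpleRoot
      norm_num
    have hd : ∀ x : E n, x ⬝ᵥ simpleRoot n ((1 : ℕ) : ℤ)
        = x ⟨0, by omega⟩ + x ⟨1, by omega⟩ := by
      intro x
      rw [hs, dotProduct_add, dot_e n x 0 (by omega), dot_e n x 1 (by omega)]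
    have hq : simpleRoot n ((1 : ℕ) : ℤ) ⬝ᵥ simpleRoot n ((1 : ℕ) : ℤ) = 2 := by
      rw [hd, hs]
      simp only [Pi.add_apply, e]
      norm_num
    rw [corootPairing, hq, hd]
    simp only [fundWeight]
    split_ifs <;> first | omega | (norm_num; done) | (exfalso; simp_all)

end TypeD

open TypeD

/-! Everything is translated from Bruhat order to the dominance order on weights. An element of
$W^{I_r}$ is determined by its weight $w(\omega_r)$ (`eq_of_act_eq`). If $u\le v$ in Bruhat order,
then $u(\omega_r)-v(\omega_r)\ge0$ (`BruhatLE.rootNonneg`): by the exchange condition, a left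
multiplication by $s_\beta$ ($\beta>0$) that increases length starts from $u$ with $u^{-1}\beta>0$,
and so subtracts a nonnegative multiple of $\beta$ from the weight. Conversely, a simple reflection
that raises $w(\omega_r)$ stays in $W^{I_r}$ and goes down in Bruhat order (`s_mul_mem_minReps`).

Call a vector with coordinates $-1,0,1$ top if it is $\le0$ and no simple reflection raises it to
another vector $\le0$. The weight of a minimal $w$ (doubled for $r\le2$) is top. In the other
direction every vector $\le0$ of a stable set climbs to a top vector by simple reflections
(`exists_isTop`), so $w$ is minimal as soon as its weight is not strictly below any top vector.
Maximal $v$ are treated in the same way through $-v(\omega_r)$.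

Top vectors can be listed. For $k\ge3$ the coefficient of $\alpha_k$ is the tail sum
$x_k+\dots+x_n$, and the top condition forces these coefficients to be $0$ or $-1$, with no two
neighbours both $-1$ (`IsTop.coef_of_three_le`). Near the fork of the diagram six endings remain
(`IsTop.end_cases`). The squared length, invariant under $W$, then selects one family, by its parity
and its size (`IsTop.classify`). Comparing sums of coefficients shows that each family is an
antichain (`EvenWeight.antichain`, `OddWeight.antichain`), so every member of it gives a minimal and
a maximal element. For $r\ge3$ it remains to exhibit elements of $W^{I_r}$ with these weights by
their one-line notation (`hasPair`).

For $r=1,2$ the vectors of the orbit of $2\omega_r$ have coordinates $\pm1$. No coordinate vanishes,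
so the tail sums of a top vector must alternate between $-1$ and $0$; the sign of the first
coordinate follows from the product of all signs. The top vector is therefore unique. -/

namespace TypeD

/-! ### Simple reflections and signed permutations. -/

/-- The other end of the simple root: `α_i = ε_i - ε_{lo i}`. -/
def lo (i : ℤ) : ℤ := if i = 1 then -2 else i - 1

theorem s_apply {i : ℤ} (hi : 1 ≤ i) (x : ℤ) : s i x =
    if x = i then lo i else if x = lo i then i else if x = -i then -lo i
      else if x = -lo i then -i else x := by
  unfold s lo
  rcases eq_or_lt_of_le hi with rfl | h
  · simp only [if_true, Equiv.Perm.mul_apply]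
    generalize hy : Equiv.swap (-1) 2 x = y
    rw [Equiv.swap_apply_def] at hy ⊢
    split_ifs at hy ⊢ <;> omega
  · simp only [if_neg h.ne', Equiv.Perm.mul_apply]
    generalize hy : Equiv.swap (-(i - 1)) (-i) x = y
    rw [Equiv.swap_apply_def] at hy ⊢
    split_ifs at hy ⊢ <;> omega

theorem lo_cases {i : ℤ} (hi : 1 ≤ i) : (i = 1 ∧ lo i = -2) ∨ (2 ≤ i ∧ lo i = i - 1) := by
  unfold lo
  split_ifs <;> omega

theorem s_neg {i : ℤ} (hi : 1 ≤ i) (x : ℤ) : s i (-x) = -s i x := by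
  rw [s_apply hi, s_apply hi]
  rcases lo_cases hi with ⟨h1, h2⟩ | ⟨h1, h2⟩ <;> rw [h2] <;> split_ifs <;> omega

theorem s_self_apply {i : ℤ} (hi : 1 ≤ i) : s i i = lo i := by
  rw [s_apply hi, if_pos rfl]

theorem s_lo_apply {i : ℤ} (hi : 1 ≤ i) : s i (lo i) = i := by
  rw [s_apply hi]
  rcases lo_cases hi with ⟨h1, h2⟩ | ⟨h1, h2⟩ <;> rw [h2] <;> split_ifs <;> omega

theorem s_s_apply {i : ℤ} (hi : 1 ≤ i) (x : ℤ) : s i (s i x) = x := by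
  rw [s_apply hi, s_apply hi]
  rcases lo_cases hi with ⟨h1, h2⟩ | ⟨h1, h2⟩ <;> rw [h2] <;> split_ifs <;> omega

theorem s_mul_s {i : ℤ} (hi : 1 ≤ i) : s i * s i = 1 :=
  Equiv.ext fun x => s_s_apply hi x

theorem s_inv {i : ℤ} (hi : 1 ≤ i) : (s i)⁻¹ = s i :=
  inv_eq_of_mul_eq_one_left (s_mul_s hi)

/-- The root $\varepsilon_a-\varepsilon_b$ is positive exactly when $b<a$, and $\alpha_i$ is the
only positive root that $s_i$ makes negative. The two excluded pairs are the two ways of writing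
$\alpha_i$. -/
theorem s_lt_s {i : ℤ} (hi : 1 ≤ i) {a b : ℤ} (ha : a ≠ 0) (hb : b ≠ 0) (hab : a ≠ -b)
    (h : b < a) (h1 : ¬ (b = lo i ∧ a = i)) (h2 : ¬ (b = -i ∧ a = -lo i)) : s i b < s i a := by
  rw [s_apply hi, s_apply hi]
  rcases lo_cases hi with ⟨h3, h4⟩ | ⟨h3, h4⟩ <;> rw [h4] at h1 h2 ⊢ <;> split_ifs <;>
    omega

/-- Permutations of `ℤ` that commute with negation and move only `±1, …, ±n`. -/
def IsSigned (n : ℕ) (w : Equiv.Perm ℤ) : Prop :=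
  (∀ k, w (-k) = -w k) ∧ ∀ k : ℤ, k < -n ∨ (n : ℤ) < k → w k = k

/-- `k` is one of `±1, …, ±n`. -/
def InRange (n : ℕ) (k : ℤ) : Prop := k ≠ 0 ∧ -(n : ℤ) ≤ k ∧ k ≤ n

theorem inRange_of_pos {n : ℕ} {k : ℤ} (h : 1 ≤ k) (h' : k ≤ n) : InRange n k :=
  ⟨by omega, by omega, by omega⟩

theorem inRange_lo {n : ℕ} (hn : 2 ≤ n) {i : ℤ} (h : 1 ≤ i) (h' : i ≤ n) : InRange n (lo i) := by
  rcases lo_cases h with ⟨h1, h2⟩ | ⟨h1, h2⟩ <;> rw [h2] <;> exact ⟨by omega, by omega, by omega⟩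

theorem IsSigned.one (n : ℕ) : IsSigned n 1 := ⟨fun _ => rfl, fun _ _ => rfl⟩

theorem IsSigned.zero {n : ℕ} {w : Equiv.Perm ℤ} (hw : IsSigned n w) : w 0 = 0 := by
  have := hw.1 0
  rw [neg_zero] at this
  omega

theorem IsSigned.inRange {n : ℕ} {w : Equiv.Perm ℤ} (hw : IsSigned n w) {k : ℤ}
    (hk : InRange n k) : InRange n (w k) := by
  obtain ⟨h1, h2, h3⟩ := hk
  refine ⟨fun h => h1 (w.injective (h.trans hw.zero.symm)), ?_, ?_⟩
  · by_contra h
    have := w.injective (hw.2 (w k) (by omega))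
    omega
  · by_contra h
    have := w.injective (hw.2 (w k) (by omega))
    omega

theorem IsSigned.mul {n : ℕ} {g w : Equiv.Perm ℤ} (hg : IsSigned n g) (hw : IsSigned n w) :
    IsSigned n (g * w) :=
  ⟨fun k => by simp only [Equiv.Perm.mul_apply, hw.1, hg.1],
    fun k hk => by simp only [Equiv.Perm.mul_apply, hw.2 k hk, hg.2 k hk]⟩

theorem IsSigned.inv {n : ℕ} {w : Equiv.Perm ℤ} (hw : IsSigned n w) : IsSigned n w⁻¹ := by
  refine ⟨fun k => w.injective ?_, fun k hk => w.injective ?_⟩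
  · rw [hw.1]
    simp
  · rw [hw.2 k hk]
    simp

theorem isSigned_s {n : ℕ} (hn : 2 ≤ n) {i : ℤ} (h : 1 ≤ i) (h' : i ≤ n) : IsSigned n (s i) := by
  refine ⟨s_neg h, fun k hk => ?_⟩
  rw [s_apply h]
  rcases lo_cases h with ⟨h3, h4⟩ | ⟨h3, h4⟩ <;> rw [h4] <;> split_ifs <;> omega

theorem s_mem {n : ℕ} {i : ℤ} (h : 1 ≤ i) (h' : i ≤ n) : s i ∈ weylGroup n :=
  Subgroup.subset_closure ⟨i, h, h', rfl⟩

theorem isSigned_of_mem {n : ℕ} (hn : 2 ≤ n) {w : Equiv.Perm ℤ} (hw : w ∈ weylGroup n) :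
    IsSigned n w := by
  induction hw using Subgroup.closure_induction with
  | mem x hx =>
    obtain ⟨i, h1, h2, rfl⟩ := hx
    exact isSigned_s hn h1 h2
  | one => exact IsSigned.one n
  | mul x y _ _ hx hy => exact hx.mul hy
  | inv x _ hx => exact hx.inv

/-! ### The Weyl group as the group of evenly signed permutations. -/

/-- Up to sign $s_i$ permutes $1,\dots,n$, and it changes either no sign or two, so the product of
an odd function is preserved. The values lie in a general ring because both integer signs and real
coordinates of weights are needed. -/
theorem prod_s_apply {R : Type*} [CommRing R] {n : ℕ} (hn : 2 ≤ n) (f : ℤ → R)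
    (hf : ∀ k, f (-k) = -f k) {i : ℤ} (h : 1 ≤ i) (h' : i ≤ n) :
    ∏ k ∈ Finset.Icc (1 : ℤ) n, f (s i k) = ∏ k ∈ Finset.Icc (1 : ℤ) n, f k := by
  obtain ⟨a, ha1, ha2, ha⟩ : ∃ a : ℤ, (1 ≤ a ∧ a ≤ n) ∧ a ≠ i ∧ ((lo i = a) ∨ (lo i = -a)) := by
    rcases lo_cases h with ⟨h3, h4⟩ | ⟨h3, h4⟩
    · exact ⟨2, by omega, by omega, by omega⟩
    · exact ⟨i - 1, by omega, by omega, by omega⟩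
  have hi : i ∈ Finset.Icc (1 : ℤ) n := Finset.mem_Icc.2 ⟨h, h'⟩
  have hA : a ∈ (Finset.Icc (1 : ℤ) n).erase i :=
    Finset.mem_erase.2 ⟨ha2, Finset.mem_Icc.2 ha1⟩
  have hrest : ∏ k ∈ ((Finset.Icc (1 : ℤ) n).erase i).erase a, f (s i k)
      = ∏ k ∈ ((Finset.Icc (1 : ℤ) n).erase i).erase a, f k := by
    refine Finset.prod_congr rfl fun k hk => ?_
    simp only [Finset.mem_erase, Finset.mem_Icc] at hk
    congr 1
    rw [s_apply h, if_neg (by omega), if_neg (by omega), if_neg (by omega), if_neg (by omega)]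
  rw [← Finset.mul_prod_erase _ _ hi, ← Finset.mul_prod_erase _ _ hA, hrest,
    ← Finset.mul_prod_erase _ f hi, ← Finset.mul_prod_erase _ f hA, s_self_apply h]
  rcases ha with ha | ha
  · rw [← ha, s_lo_apply h]
    ring
  · have : s i a = -i := by rw [show a = -lo i by omega, s_neg h, s_lo_apply h]
    rw [this, ha, hf, hf]
    ring

theorem prod_apply {R : Type*} [CommRing R] {n : ℕ} (hn : 2 ≤ n) {w : Equiv.Perm ℤ}
    (hw : w ∈ weylGroup n) : ∀ f : ℤ → R, (∀ k, f (-k) = -f k) →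
    ∏ k ∈ Finset.Icc (1 : ℤ) n, f (w k) = ∏ k ∈ Finset.Icc (1 : ℤ) n, f k := by
  induction hw using Subgroup.closure_induction with
  | mem x hx =>
    obtain ⟨i, h1, h2, rfl⟩ := hx
    exact fun f hf => prod_s_apply hn f hf h1 h2
  | one => exact fun f hf => rfl
  | mul x y hx' hy' hx hy =>
    intro f hf
    rw [← hx f hf, ← hy (fun k => f (x k))]
    · rfl
    · intro k
      simp only [(isSigned_of_mem hn hx').1, hf]
  | inv x hx' hx =>
    intro f hf
    have := hx (fun k => f (x⁻¹ k)) (by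
      intro k
      simp only [(isSigned_of_mem hn hx').inv.1, hf])
    rw [← this]
    simp

/-- An order-preserving signed permutation with positive sign product is trivial. -/
theorem eq_one_of_lo_lt {n : ℕ} (hn : 2 ≤ n) {w : Equiv.Perm ℤ} (hw : IsSigned n w)
    (hs : ∏ k ∈ Finset.Icc (1 : ℤ) n, (w k).sign = 1)
    (hpos : ∀ i : ℤ, 1 ≤ i → i ≤ n → w (lo i) < w i) : w = 1 := by
  have h1 : ∀ i : ℤ, 2 ≤ i → i ≤ n → w (i - 1) < w i := by
    intro i hi hi'
    have := hpos i (by omega) hi'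
    rcases lo_cases (show (1 : ℤ) ≤ i by omega) with ⟨h3, h4⟩ | ⟨h3, h4⟩
    · omega
    · rwa [h4] at this
  have h2 : -w 2 < w 1 := by
    have := hpos 1 le_rfl (by omega)
    rwa [lo, if_pos rfl, hw.1] at this
  -- The nodes 1 and 2 give $|w(1)|<w(2)$, and $w(1)\ne0$, so $w(2)\ge2$. The values from there to
  -- $w(n)\le n$ increase strictly and have no room to move.
  have hlow : ∀ k : ℕ, 2 ≤ k → k ≤ n → (k : ℤ) ≤ w k := by
    intro k hk
    induction k, hk using Nat.le_induction with
    | base =>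
      intro _
      have h3 := h1 2 le_rfl (by omega)
      norm_num at h3
      have h4 := (hw.inRange (inRange_of_pos (n := n) (k := 1) (by omega) (by omega))).1
      push_cast
      omega
    | succ k hk ih =>
      intro hk'
      have h3 := h1 (k + 1) (by omega) (by omega)
      rw [add_sub_cancel_right] at h3
      have := ih (by omega)
      push_cast
      omega
  have hup : ∀ d : ℕ, d + 2 ≤ n → w ((n : ℤ) - d) ≤ (n : ℤ) - d := by
    intro d
    induction d with
    | zero =>
      intro _
      have := (hw.inRange (inRange_of_pos (n := n) (k := n) (by omega) (by omega))).2.2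
      simpa using this
    | succ d ih =>
      intro hd
      have h3 := h1 ((n : ℤ) - d) (by omega) (by omega)
      have := ih (by omega)
      push_cast
      rw [show (n : ℤ) - (d + 1) = n - d - 1 by ring]
      omega
  have heq : ∀ k : ℤ, 2 ≤ k → k ≤ n → w k = k := by
    intro k hk hk'
    have h3 := hlow k.toNat (by omega) (by omega)
    have h4 := hup (n - k.toNat) (by omega)
    rw [show ((n : ℤ) - ((n - k.toNat : ℕ) : ℤ)) = k by omega] at h4
    rw [show ((k.toNat : ℕ) : ℤ) = k by omega] at h3
    omega
  have hone : w 1 = 1 := by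
    have h3 := h1 2 le_rfl (by omega)
    have h4 := (hw.inRange (inRange_of_pos (n := n) (k := 1) (by omega) (by omega))).1
    have h5 := heq 2 le_rfl (by omega)
    norm_num at h3
    have h6 : w 1 = 1 ∨ w 1 = -1 := by omega
    rcases h6 with h6 | h6
    · exact h6
    -- All entries except the first are positive here, so the sign product excludes $w(1)=-1$.
    · exfalso
      rw [← Finset.mul_prod_erase _ _ (Finset.mem_Icc.2 ⟨le_refl (1 : ℤ), by omega⟩),
        Finset.prod_eq_one, h6] at hs
      · norm_num at hs
      · intro k hk
        simp only [Finset.mem_erase, Finset.mem_Icc] at hk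
        rw [heq k (by omega) (by omega)]
        exact Int.sign_eq_one_of_pos (by omega)
  have hpos' : ∀ k : ℤ, 0 ≤ k → w k = k := by
    intro k hk
    rcases lt_or_ge (n : ℤ) k with h | h
    · exact hw.2 k (Or.inr h)
    · obtain rfl | rfl | h' : k = 0 ∨ k = 1 ∨ 2 ≤ k := by omega
      · exact hw.zero
      · exact hone
      · exact heq k h' h
  refine Equiv.ext fun k => ?_
  rcases le_or_gt 0 k with h | h
  · exact hpos' k h
  · have := hpos' (-k) (by omega)
    rw [hw.1] at this
    simp only [Equiv.Perm.coe_one, id_eq]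
    omega

/-- A rearrangement inequality: undoing a descent increases the pairing with $(1,2,\dots,n)$. It is
the termination measure for sorting a signed permutation. -/
theorem sum_mul_apply_s {n : ℕ} (hn : 2 ≤ n) {w : Equiv.Perm ℤ} (hw : IsSigned n w)
    {i : ℤ} (h : 1 ≤ i) (h' : i ≤ n) (hlt : w i < w (lo i)) :
    ∑ k ∈ Finset.Icc (1 : ℤ) n, k * w k < ∑ k ∈ Finset.Icc (1 : ℤ) n, k * w (s i k) := by
  obtain ⟨a, ha1, ha2, ha⟩ : ∃ a : ℤ, (1 ≤ a ∧ a ≤ n) ∧ a ≠ i ∧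
      ((lo i = a ∧ a < i) ∨ (lo i = -a)) := by
    rcases lo_cases h with ⟨h3, h4⟩ | ⟨h3, h4⟩
    · exact ⟨2, by omega, by omega, by omega⟩
    · exact ⟨i - 1, by omega, by omega, by omega⟩
  have hi : i ∈ Finset.Icc (1 : ℤ) n := Finset.mem_Icc.2 ⟨h, h'⟩
  have hA : a ∈ (Finset.Icc (1 : ℤ) n).erase i :=
    Finset.mem_erase.2 ⟨ha2, Finset.mem_Icc.2 ha1⟩
  have hrest : ∑ k ∈ ((Finset.Icc (1 : ℤ) n).erase i).erase a, k * w (s i k)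
      = ∑ k ∈ ((Finset.Icc (1 : ℤ) n).erase i).erase a, k * w k := by
    refine Finset.sum_congr rfl fun k hk => ?_
    simp only [Finset.mem_erase, Finset.mem_Icc] at hk
    congr 2
    rw [s_apply h, if_neg (by omega), if_neg (by omega), if_neg (by omega), if_neg (by omega)]
  rw [← Finset.add_sum_erase _ _ hi, ← Finset.add_sum_erase _ _ hA, 
    ← Finset.add_sum_erase _ (fun k => k * w (s i k)) hi,
    ← Finset.add_sum_erase _ (fun k => k * w (s i k)) hA, hrest, s_self_apply h]
  rcases ha with ⟨ha, hai⟩ | ha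
  · rw [← ha, s_lo_apply h]
    rw [← ha] at hai
    nlinarith
  · have : s i a = -i := by rw [show a = -lo i by omega, s_neg h, s_lo_apply h]
    rw [this, ha, hw.1, hw.1]
    rw [ha, hw.1] at hlt
    nlinarith

/-- Sort $w$ by simple reflections on the right. Each one preserves the sign product and increases
$\sum_k k\,w(k)$, which is bounded; without descents only the identity is left. -/
theorem mem_weylGroup {n : ℕ} (hn : 2 ≤ n) {w : Equiv.Perm ℤ} (hw : IsSigned n w)
    (hs : ∏ k ∈ Finset.Icc (1 : ℤ) n, (w k).sign = 1) : w ∈ weylGroup n := by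
  obtain ⟨N, hN⟩ : ∃ N : ℕ, (∑ k ∈ Finset.Icc (1 : ℤ) n, (n : ℤ) * n)
      - ∑ k ∈ Finset.Icc (1 : ℤ) n, k * w k < N := ⟨Int.toNat _ + 1, by
        push_cast
        exact Int.lt_add_one_of_le (Int.self_le_toNat _)⟩
  induction N generalizing w with
  | zero =>
    exfalso
    have : ∑ k ∈ Finset.Icc (1 : ℤ) n, k * w k ≤ ∑ k ∈ Finset.Icc (1 : ℤ) n, (n : ℤ) * n := by
      refine Finset.sum_le_sum fun k hk => ?_
      rw [Finset.mem_Icc] at hk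
      have := (hw.inRange (inRange_of_pos hk.1 hk.2)).2.2
      nlinarith
    push_cast at hN
    omega
  | succ N ih =>
    by_cases hpos : ∀ i : ℤ, 1 ≤ i → i ≤ n → w (lo i) < w i
    · rw [eq_one_of_lo_lt hn hw hs hpos]
      exact one_mem _
    · push Not at hpos
      obtain ⟨i, h1, h2, h3⟩ := hpos
      have h4 : w i < w (lo i) := by
        refine lt_of_le_of_ne h3 fun h => ?_
        have := w.injective h
        rcases lo_cases h1 with ⟨h5, h6⟩ | ⟨h5, h6⟩ <;> omega
      have h5 := sum_mul_apply_s hn hw h1 h2 h4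
      have h6 : w * s i ∈ weylGroup n := by
        refine ih (hw.mul (isSigned_s hn h1 h2)) ?_ ?_
        · exact (prod_s_apply hn (fun k => (w k).sign)
            (fun k => by simp only [hw.1, Int.sign_neg]) h1 h2).trans hs
        · simp only [Equiv.Perm.mul_apply]
          push_cast at hN
          omega
      have h7 := mul_mem h6 (s_mem h1 h2)
      rwa [mul_assoc, s_mul_s h1, mul_one] at h7

theorem prod_sign {n : ℕ} (hn : 2 ≤ n) {w : Equiv.Perm ℤ} (hw : w ∈ weylGroup n) :
    ∏ k ∈ Finset.Icc (1 : ℤ) n, (w k).sign = 1 := by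
  rw [prod_apply hn hw (fun k => k.sign) (fun k => Int.sign_neg k)]
  refine Finset.prod_eq_one fun k hk => ?_
  rw [Finset.mem_Icc] at hk
  exact Int.sign_eq_one_of_pos (by omega)

theorem eq_one_of_mem {n : ℕ} (hn : 2 ≤ n) {w : Equiv.Perm ℤ} (hw : w ∈ weylGroup n)
    (hpos : ∀ i : ℤ, 1 ≤ i → i ≤ n → w (lo i) < w i) : w = 1 :=
  eq_one_of_lo_lt hn (isSigned_of_mem hn hw) (prod_sign hn hw) hpos

/-! ### Coordinates with signed indices and the linear action. -/

theorem e_neg (n : ℕ) (a : ℤ) : e n (-a) = -e n a := by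
  funext j
  simp only [e, Pi.neg_apply, neg_neg]
  split_ifs <;> first | omega | simp

theorem simpleRoot_eq (n : ℕ) {i : ℤ} (hi : 1 ≤ i) : simpleRoot n i = e n i - e n (lo i) := by
  unfold simpleRoot
  rcases lo_cases hi with ⟨h1, h2⟩ | ⟨h1, h2⟩
  · rw [if_pos h1, h2, h1, e_neg, sub_neg_eq_add]
  · rw [if_neg (by omega), h2]

/-- The coordinate of `x` with the signed number `a`; `coord x (-a) = -coord x a`. -/
noncomputable def coord {n : ℕ} (x : E n) (a : ℤ) : ℝ := x ⬝ᵥ e n a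

theorem coord_neg_right {n : ℕ} (x : E n) (a : ℤ) : coord x (-a) = -coord x a := by
  rw [coord, e_neg, dotProduct_neg, coord]

theorem coord_add {n : ℕ} (x y : E n) (a : ℤ) : coord (x + y) a = coord x a + coord y a :=
  add_dotProduct _ _ _

theorem coord_sub {n : ℕ} (x y : E n) (a : ℤ) : coord (x - y) a = coord x a - coord y a :=
  sub_dotProduct _ _ _

theorem coord_neg {n : ℕ} (x : E n) (a : ℤ) : coord (-x) a = -coord x a :=
  neg_dotProduct _ _

theorem coord_smul {n : ℕ} (t : ℝ) (x : E n) (a : ℤ) : coord (t • x) a = t * coord x a :=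
  smul_dotProduct _ _ _

theorem coord_fin {n : ℕ} (x : E n) (j : Fin n) : coord x ((j : ℤ) + 1) = x j :=
  dot_e n x j j.2

theorem coord_nat {n : ℕ} (x : E n) {k : ℕ} (hk : k < n) : coord x ((k : ℤ) + 1) = x ⟨k, hk⟩ :=
  dot_e n x k hk

theorem ext_coord {n : ℕ} {x y : E n} (h : ∀ k : ℤ, 1 ≤ k → k ≤ n → coord x k = coord y k) :
    x = y := by
  funext j
  rw [← coord_fin x, ← coord_fin y]
  exact h _ (by omega) (by omega)

theorem coord_e {n : ℕ} {a b : ℤ} (hb : InRange n b) :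
    coord (e n a) b = if a = b then 1 else if a = -b then -1 else 0 := by
  obtain ⟨h1, h2, h3⟩ := hb
  rcases lt_or_gt_of_ne h1 with h | h
  · obtain ⟨k, hk, rfl⟩ : ∃ k : ℕ, k < n ∧ b = -((k : ℤ) + 1) :=
      ⟨(-b - 1).toNat, by omega, by omega⟩
    rw [coord_neg_right, coord_nat _ hk]
    simp only [e]
    split_ifs <;> first | omega | simp
  · obtain ⟨k, hk, rfl⟩ : ∃ k : ℕ, k < n ∧ b = (k : ℤ) + 1 :=
      ⟨(b - 1).toNat, by omega, by omega⟩
    rw [coord_nat _ hk]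
    simp only [e]
    split_ifs <;> first | omega | simp

theorem coord_e_self {n : ℕ} {a : ℤ} (ha : InRange n a) : coord (e n a) a = 1 := by
  rw [coord_e ha, if_pos rfl]

theorem coord_e_of_ne {n : ℕ} {a b : ℤ} (hb : InRange n b) (h : a ≠ b) (h' : a ≠ -b) :
    coord (e n a) b = 0 := by
  rw [coord_e hb, if_neg h, if_neg h']

theorem coord_act {n : ℕ} {w : Equiv.Perm ℤ} (hw : IsSigned n w) (x : E n) {a : ℤ}
    (ha : InRange n a) : coord (act n w x) (w a) = coord x a := by
  have key : ∀ k : ℤ, 1 ≤ k → k ≤ n → coord (act n w x) (w k) = coord x k := by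
    intro k h1 h2
    obtain ⟨j, rfl⟩ : ∃ j : Fin n, k = (j : ℤ) + 1 := ⟨⟨(k - 1).toNat, by omega⟩, by
      simp only []
      omega⟩
    have hr := hw.inRange (inRange_of_pos h1 h2)
    unfold coord act
    rw [sum_dotProduct, Finset.sum_eq_single j]
    · rw [smul_dotProduct]
      change _ • coord _ _ = coord _ _
      rw [coord_e_self hr, coord_fin]
      simp
    · intro i _ hij
      rw [smul_dotProduct]
      change _ • coord _ _ = _
      rw [coord_e_of_ne hr, smul_zero]
      · intro h
        have := w.injective h
        exact hij (Fin.ext (by omega))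
      · intro h
        rw [← hw.1] at h
        have := w.injective h
        omega
    · simp
  obtain ⟨h1, h2, h3⟩ := ha
  rcases lt_or_gt_of_ne h1 with h | h
  · have := key (-a) (by omega) (by omega)
    rw [hw.1, coord_neg_right, coord_neg_right] at this
    linarith
  · exact key a (by omega) h3

theorem coord_act' {n : ℕ} {w : Equiv.Perm ℤ} (hw : IsSigned n w) (x : E n) {a : ℤ}
    (ha : InRange n a) : coord (act n w x) a = coord x (w⁻¹ a) := by
  have := coord_act hw x (hw.inv.inRange ha)
  rwa [show w (w⁻¹ a) = a from w.apply_symm_apply a] at this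

theorem act_add {n : ℕ} (w : Equiv.Perm ℤ) (x y : E n) :
    act n w (x + y) = act n w x + act n w y := by
  simp only [act, Pi.add_apply, add_smul, Finset.sum_add_distrib]

theorem act_smul {n : ℕ} (w : Equiv.Perm ℤ) (t : ℝ) (x : E n) :
    act n w (t • x) = t • act n w x := by
  simp only [act, Pi.smul_apply, Finset.smul_sum, smul_assoc]

theorem act_neg {n : ℕ} (w : Equiv.Perm ℤ) (x : E n) : act n w (-x) = -act n w x := by
  rw [← neg_one_smul ℝ x, act_smul, neg_one_smul]

theorem act_sub {n : ℕ} (w : Equiv.Perm ℤ) (x y : E n) :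
    act n w (x - y) = act n w x - act n w y := by
  rw [sub_eq_add_neg, act_add, act_neg, sub_eq_add_neg]

theorem act_e {n : ℕ} {w : Equiv.Perm ℤ} (hw : IsSigned n w) (a : ℤ) :
    act n w (e n a) = e n (w a) := by
  refine ext_coord fun k h1 h2 => ?_
  have hk := inRange_of_pos h1 h2
  rw [coord_act' hw _ hk, coord_e (hw.inv.inRange hk), coord_e hk]
  simp only [Equiv.Perm.eq_inv_iff_eq, ← hw.inv.1]

theorem act_mul {n : ℕ} {g w : Equiv.Perm ℤ} (hg : IsSigned n g) (hw : IsSigned n w) (x : E n) :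
    act n (g * w) x = act n g (act n w x) := by
  refine ext_coord fun k h1 h2 => ?_
  have hk := inRange_of_pos h1 h2
  rw [coord_act' (hg.mul hw) _ hk, coord_act' hg _ hk, coord_act' hw _ (hg.inv.inRange hk),
    mul_inv_rev, Equiv.Perm.mul_apply]

theorem act_one {n : ℕ} (x : E n) : act n 1 x = x := by
  refine ext_coord fun k h1 h2 => ?_
  rw [coord_act' (IsSigned.one n) _ (inRange_of_pos h1 h2), inv_one, Equiv.Perm.one_apply]

/-- `s_i x = x - ⟨x, α_i⟩ α_i`. -/
theorem act_s {n : ℕ} (hn : 2 ≤ n) {i : ℤ} (h : 1 ≤ i) (h' : i ≤ n) (x : E n) :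
    act n (s i) x = x - (coord x i - coord x (lo i)) • simpleRoot n i := by
  refine ext_coord fun k h1 h2 => ?_
  have hk := inRange_of_pos h1 h2
  rw [coord_act' (isSigned_s hn h h') _ hk, s_inv h, coord_sub, coord_smul, simpleRoot_eq n h,
    coord_sub, coord_e hk, coord_e hk, s_apply h]
  rcases lo_cases h with ⟨h3, h4⟩ | ⟨h3, h4⟩ <;> rw [h4]
  · subst h3
    by_cases hk1 : k = 1
    · subst hk1
      norm_num
    · by_cases hk2 : k = 2
      · subst hk2
        norm_num [coord_neg_right]
      · repeat rw [if_neg (by omega)]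
        ring
  · by_cases hk1 : k = i
    · subst hk1
      repeat rw [if_pos rfl]
      repeat rw [if_neg (by omega)]
      ring
    · by_cases hk2 : k = i - 1
      · subst hk2
        rw [if_neg (by omega), if_pos rfl, if_neg (by omega), if_neg (by omega), if_pos rfl]
        ring
      · repeat rw [if_neg (by omega)]
        ring

/-- Reflections act by `x ↦ x - (x_a - x_b)(ε_a - ε_b)`. -/
theorem act_conj_s {n : ℕ} (hn : 2 ≤ n) {g : Equiv.Perm ℤ} (hg : IsSigned n g) {i : ℤ}
    (h : 1 ≤ i) (h' : i ≤ n) (x : E n) :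
    act n (g * s i * g⁻¹) x
      = x - (coord x (g i) - coord x (g (lo i))) • (e n (g i) - e n (g (lo i))) := by
  have hs := isSigned_s hn h h'
  have hi := inRange_of_pos h h'
  have hl := inRange_lo hn h h'
  have hc : ∀ {a}, InRange n a → coord (act n g⁻¹ x) a = coord x (g a) := by
    intro a ha
    rw [coord_act' hg.inv x ha, inv_inv]
  rw [act_mul (hg.mul hs) hg.inv, act_mul hg hs, act_s hn h h', act_sub, act_smul,
    ← act_mul hg hg.inv, mul_inv_cancel, act_one, simpleRoot_eq n h, act_sub, act_e hg,
    act_e hg, hc hi, hc hl]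

/-- The action is orthogonal. For $r\ge3$ the squared length is the only orbit invariant needed to
tell the families of top vectors apart. -/
theorem dotProduct_act {n : ℕ} (hn : 2 ≤ n) {w : Equiv.Perm ℤ} (hw : w ∈ weylGroup n) :
    ∀ x : E n, act n w x ⬝ᵥ act n w x = x ⬝ᵥ x := by
  have hs : ∀ i : ℤ, 1 ≤ i → i ≤ n → ∀ x : E n, act n (s i) x ⬝ᵥ act n (s i) x = x ⬝ᵥ x := by
    intro i h h' x
    have hi := inRange_of_pos h h'
    have hl := inRange_lo hn h h'
    have h1 : ∀ y : E n, y ⬝ᵥ simpleRoot n i = coord y i - coord y (lo i) := by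
      intro y
      rw [simpleRoot_eq n h, dotProduct_sub, coord, coord]
    have h2 : simpleRoot n i ⬝ᵥ simpleRoot n i = 2 := by
      rw [h1, simpleRoot_eq n h, coord_sub, coord_sub, coord_e_self hi, coord_e_self hl]
      rcases lo_cases h with ⟨h3, h4⟩ | ⟨h3, h4⟩ <;>
      · rw [coord_e_of_ne hl (by omega) (by omega), coord_e_of_ne hi (by omega) (by omega)]
        norm_num
    rw [act_s hn h h', sub_dotProduct, dotProduct_sub, dotProduct_sub, smul_dotProduct,
      smul_dotProduct, dotProduct_smul, dotProduct_smul, h2, dotProduct_comm (simpleRoot n i) x, h1]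
    simp only [smul_eq_mul]
    ring
  induction hw using Subgroup.closure_induction with
  | mem x hx =>
    obtain ⟨i, h1, h2, rfl⟩ := hx
    exact hs i h1 h2
  | one => simp [act_one]
  | mul x y hx' hy' hx hy =>
    intro z
    rw [act_mul (isSigned_of_mem hn hx') (isSigned_of_mem hn hy'), hx, hy]
  | inv x hx' hx =>
    intro z
    have h1 := isSigned_of_mem hn hx'
    rw [← hx, ← act_mul h1 h1.inv, mul_inv_cancel, act_one]

/-! ### Simple-root coefficients and the dominance order. -/

/-- The coefficient of `α_k` in `x`. -/
noncomputable def coef {n : ℕ} (x : E n) (k : ℕ) : ℝ := x ⬝ᵥ fundWeight n k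

theorem coef_add {n : ℕ} (x y : E n) (k : ℕ) : coef (x + y) k = coef x k + coef y k :=
  add_dotProduct _ _ _

theorem coef_sub {n : ℕ} (x y : E n) (k : ℕ) : coef (x - y) k = coef x k - coef y k :=
  sub_dotProduct _ _ _

theorem coef_neg {n : ℕ} (x : E n) (k : ℕ) : coef (-x) k = -coef x k :=
  neg_dotProduct _ _

theorem coef_smul {n : ℕ} (t : ℝ) (x : E n) (k : ℕ) : coef (t • x) k = t * coef x k :=
  smul_dotProduct _ _ _

theorem coef_zero {n : ℕ} (k : ℕ) : coef (0 : E n) k = 0 := zero_dotProduct _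

/-- The start of the downward recursion `coef_succ`: for $k\ge3$ the coefficient is the tail sum
$x_k+\dots+x_n$, which is empty beyond $n$. -/
theorem coef_of_gt {n : ℕ} (x : E n) {k : ℕ} (hk : 3 ≤ k) (hk' : n < k) : coef x k = 0 := by
  have : fundWeight n k = 0 := by
    funext j
    simp only [fundWeight, Pi.zero_apply]
    split_ifs <;> first | omega | rfl
  rw [coef, this, dotProduct_zero]

theorem coef_succ {n : ℕ} (x : E n) {k : ℕ} (hk : 3 ≤ k) :
    coef x k = coord x k + coef x (k + 1) := by
  have : fundWeight n k = e n k + fundWeight n (k + 1) := by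
    funext j
    simp only [fundWeight, e, Pi.add_apply]
    split_ifs <;> first | omega | norm_num
  rw [coef, this, dotProduct_add, coord, coef]

theorem coef_one_sub {n : ℕ} (x : E n) : coef x 1 - coef x 2 = coord x 1 := by
  have : fundWeight n 1 - fundWeight n 2 = e n 1 := by
    funext j
    simp only [fundWeight, e, Pi.sub_apply]
    split_ifs <;> first | omega | norm_num
  rw [coef, coef, ← dotProduct_sub, this, coord]

theorem coef_one_add {n : ℕ} (x : E n) :
    coef x 1 + coef x 2 = coord x 2 + coef x 3 := by
  have : fundWeight n 1 + fundWeight n 2 = e n 2 + fundWeight n 3 := by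
    funext j
    simp only [fundWeight, e, Pi.add_apply]
    split_ifs <;> first | omega | norm_num
  rw [coef, coef, ← dotProduct_add, this, dotProduct_add, coord, coef]

/-- All simple roots have squared length 2 and equal their coroots, so the fundamental weights form
the dual basis for the dot product itself. -/
theorem coef_simpleRoot {n : ℕ} (hn : 2 ≤ n) {k i : ℕ} (hk : 1 ≤ k) (hi : 1 ≤ i) (hi' : i ≤ n) :
    coef (simpleRoot n i) k = if k = i then 1 else 0 := by
  rw [← fundWeight_pairing n hn k i hk hi hi', corootPairing]
  have hl := inRange_lo hn (i := i) (by omega) (by omega)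
  have hI : InRange n (i : ℤ) := inRange_of_pos (by omega) (by omega)
  have h2 : simpleRoot n i ⬝ᵥ simpleRoot n i = 2 := by
    rw [simpleRoot_eq n (by omega), dotProduct_sub]
    change coord _ _ - coord _ _ = 2
    rw [coord_sub, coord_sub, coord_e_self hI, coord_e_self hl]
    rcases lo_cases (i := i) (by omega) with ⟨h3, h4⟩ | ⟨h3, h4⟩ <;>
    · rw [coord_e_of_ne hl (by omega) (by omega), coord_e_of_ne hI (by omega) (by omega)]
      norm_num
  rw [h2, coef, dotProduct_comm]
  ring

theorem coef_simpleRoot_int {n : ℕ} (hn : 2 ≤ n) {k : ℕ} {i : ℤ} (hk : 1 ≤ k) (hi : 1 ≤ i)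
    (hi' : i ≤ n) : coef (simpleRoot n i) k = if (k : ℤ) = i then 1 else 0 := by
  lift i to ℕ using by omega
  rw [coef_simpleRoot hn hk (by omega) (by omega)]
  simp

theorem coef_sum {n : ℕ} {ι : Type*} (t : Finset ι) (f : ι → E n) (k : ℕ) :
    coef (∑ i ∈ t, f i) k = ∑ i ∈ t, coef (f i) k := sum_dotProduct _ _ _

/-- The coordinates are recovered from the coefficients: differences of neighbouring tail sums from
3 on, and two linear relations at the fork. -/
theorem eq_of_coef {n : ℕ} (hn : 2 ≤ n) {x y : E n}
    (h : ∀ k : ℕ, 1 ≤ k → k ≤ n → coef x k = coef y k) : x = y := by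
  have h' : ∀ k : ℕ, 1 ≤ k → coef x k = coef y k := by
    intro k hk
    rcases le_or_gt k n with hk' | hk'
    · exact h k hk hk'
    · rw [coef_of_gt x (by omega) hk', coef_of_gt y (by omega) hk']
  refine ext_coord fun k h1 h2 => ?_
  lift k to ℕ using by omega
  obtain rfl | rfl | hk : k = 1 ∨ k = 2 ∨ 3 ≤ k := by omega
  · have h3 := coef_one_sub x
    have h4 := coef_one_sub y
    have h5 := h' 1 le_rfl
    have h6 := h' 2 (by omega)
    push_cast
    linarith
  · have h3 := coef_one_add x
    have h4 := coef_one_add y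
    have h5 := h' 1 le_rfl
    have h6 := h' 2 (by omega)
    have h7 := h' 3 (by omega)
    push_cast
    linarith
  · have h3 := coef_succ x hk
    have h4 := coef_succ y hk
    have h5 := h' k (by omega)
    have h6 := h' (k + 1) (by omega)
    linarith

theorem coef_linearCombination {n : ℕ} (hn : 2 ≤ n) (c : ℤ → ℝ) {k : ℕ} (hk : 1 ≤ k)
    (hk' : k ≤ n) : coef (∑ i ∈ Finset.Icc (1 : ℤ) n, c i • simpleRoot n i) k = c k := by
  rw [coef_sum, Finset.sum_eq_single (k : ℤ)]
  · rw [coef_smul, coef_simpleRoot_int hn hk (by omega) (by omega), if_pos rfl, mul_one]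
  · intro i hi hik
    rw [Finset.mem_Icc] at hi
    rw [coef_smul, coef_simpleRoot_int hn hk hi.1 hi.2, if_neg (Ne.symm hik), mul_zero]
  · intro h
    exact absurd (Finset.mem_Icc.2 ⟨by omega, by omega⟩) h

theorem rootNonneg_iff {n : ℕ} (hn : 2 ≤ n) (x : E n) :
    RootNonneg n x ↔ ∀ k : ℕ, 1 ≤ k → k ≤ n → 0 ≤ coef x k := by
  constructor
  · rintro ⟨c, hc, rfl⟩ k h1 h2
    rw [coef_linearCombination hn c h1 h2]
    exact hc _ (Finset.mem_Icc.2 ⟨by omega, by omega⟩)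
  · intro h
    refine ⟨fun i => coef x i.toNat, fun i hi => ?_, ?_⟩
    · rw [Finset.mem_Icc] at hi
      exact h _ (by omega) (by omega)
    · refine eq_of_coef hn fun k h1 h2 => ?_
      rw [coef_linearCombination hn _ h1 h2]
      simp

theorem RootNonneg.add {n : ℕ} (hn : 2 ≤ n) {x y : E n} (hx : RootNonneg n x)
    (hy : RootNonneg n y) : RootNonneg n (x + y) := by
  rw [rootNonneg_iff hn] at *
  intro k h1 h2
  rw [coef_add]
  exact add_nonneg (hx k h1 h2) (hy k h1 h2)

theorem RootNonneg.smul {n : ℕ} (hn : 2 ≤ n) {x : E n} {t : ℝ} (ht : 0 ≤ t)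
    (hx : RootNonneg n x) : RootNonneg n (t • x) := by
  rw [rootNonneg_iff hn] at *
  intro k h1 h2
  rw [coef_smul]
  exact mul_nonneg ht (hx k h1 h2)

theorem rootNonneg_simpleRoot {n : ℕ} (hn : 2 ≤ n) {i : ℤ} (hi : 1 ≤ i) (hi' : i ≤ n) :
    RootNonneg n (simpleRoot n i) := by
  rw [rootNonneg_iff hn]
  intro k h1 h2
  rw [coef_simpleRoot_int hn h1 hi hi']
  split_ifs <;> norm_num

/-! ### Positive roots as ordered pairs of signed indices, and minimal coset representatives. -/

/-- `lam n r a` is the pairing of `ω_r` with `ε_a`, for a signed index `a`. -/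
noncomputable def lam (n r : ℕ) (a : ℤ) : ℝ := coord (fundWeight n r) a

theorem lam_sub_lam_lo {n : ℕ} (hn : 2 ≤ n) {r : ℕ} {i : ℤ} (hr : 1 ≤ r) (hi : 1 ≤ i)
    (hi' : i ≤ n) : lam n r i - lam n r (lo i) = if (r : ℤ) = i then 1 else 0 := by
  rw [← coef_simpleRoot_int hn hr hi hi', coef, dotProduct_comm, simpleRoot_eq n hi,
    dotProduct_sub]
  rfl

/-- If `f` does not decrease along the simple roots, it does not decrease along all positive
roots; and where `f` takes equal values, `w` increases if it does along the simple roots with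
equal values of `f`. -/
theorem chain_induction {n : ℕ} (P : ℤ → ℤ → Prop)
    (hsimple : ∀ i : ℤ, 1 ≤ i → i ≤ n → P (lo i) i)
    (hneg : ∀ a b, P b a → P (-a) (-b))
    (htrans : ∀ a b c, a ≠ -b → b ≠ -c → a ≠ -c → a < b → b < c → P a b → P b c → P a c)
    {a b : ℤ} (ha : InRange n a) (hb : InRange n b) (hab : a ≠ -b) (h : b < a) : P b a := by
  have hstep : ∀ i : ℤ, 2 ≤ i → i ≤ n → P (i - 1) i := by
    intro i h1 h2
    have := hsimple i (by omega) h2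
    rcases lo_cases (show (1 : ℤ) ≤ i by omega) with ⟨h3, h4⟩ | ⟨h3, h4⟩
    · omega
    · rwa [h4] at this
  have hup : ∀ d : ℕ, ∀ b : ℤ, 1 ≤ b → b + d + 1 ≤ n → P b (b + d + 1) := by
    intro d b hb1
    induction d with
    | zero =>
      intro hb2
      have := hstep (b + 1) (by omega) (by omega)
      simpa using this
    | succ d ih =>
      intro hb2
      have h1 := ih (by omega)
      have h2 := hstep (b + (d + 1 : ℕ) + 1) (by omega) (by omega)
      rw [show b + (d + 1 : ℕ) + 1 - 1 = b + d + 1 by push_cast; ring] at h2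
      exact htrans _ _ _ (by omega) (by omega) (by omega) (by omega) (by omega) h1 h2
  have hupper : ∀ b a : ℤ, 1 ≤ b → b < a → a ≤ n → P b a := by
    intro b a h1 h2 h3
    have := hup (a - b - 1).toNat b h1 (by omega)
    rwa [show b + ((a - b - 1).toNat : ℤ) + 1 = a by omega] at this
  -- The special node compares $-2$ with $1$; negated, it compares $-1$ with $2$. This is the only
  -- passage from negative to positive indices, and it never compares $-1$ with $1$, which is not a
  -- root.
  have hone : 2 ≤ n → P (-1) 2 := by
    intro hn
    have := hneg _ _ (hsimple 1 le_rfl (by omega))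
    simpa [lo] using this
  have hm1 : ∀ a : ℤ, 2 ≤ a → a ≤ n → P (-1) a := by
    intro a h1 h2
    rcases eq_or_lt_of_le h1 with rfl | h1
    · exact hone (by omega)
    · exact htrans (-1) 2 a (by omega) (by omega) (by omega) (by omega) (by omega)
        (hone (by omega)) (hupper 2 a (by omega) h1 h2)
  have key : ∀ b a : ℤ, b < a → -b < a → b ≠ 0 → a ≤ n → P b a := by
    intro b a h1 h2 h3 h4
    rcases lt_or_gt_of_ne h3 with hb | hb
    · rcases eq_or_ne b (-1) with rfl | hb'
      · exact hm1 a (by omega) h4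
      · refine htrans b (-1) a (by omega) (by omega) (by omega) (by omega) (by omega) ?_
          (hm1 a (by omega) h4)
        have := hneg _ _ (hupper 1 (-b) le_rfl (by omega) (by omega))
        rwa [neg_neg] at this
    · exact hupper b a (by omega) h1 h4
  obtain ⟨ha1, ha2, ha3⟩ := ha
  obtain ⟨hb1, hb2, hb3⟩ := hb
  rcases lt_or_ge (-b) a with h' | h'
  · exact key b a h h' hb1 ha3
  · have := hneg _ _ (key (-a) (-b) (by omega) (by omega) (by omega) (by omega))
    rwa [neg_neg, neg_neg] at this

theorem lam_neg {n r : ℕ} (a : ℤ) : lam n r (-a) = -lam n r a := coord_neg_right _ _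

theorem lam_mono {n : ℕ} (hn : 2 ≤ n) {r : ℕ} (hr : 1 ≤ r) {a b : ℤ} (ha : InRange n a)
    (hb : InRange n b) (hab : a ≠ -b) (h : b < a) : lam n r b ≤ lam n r a := by
  refine chain_induction (n := n) (fun b a => lam n r b ≤ lam n r a) ?_ ?_ ?_ ha hb hab h
  · intro i h1 h2
    have := lam_sub_lam_lo hn hr h1 h2
    split_ifs at this <;> linarith
  · intro a b h
    simp only [lam_neg]
    linarith
  · intro a b c _ _ _ _ _ h1 h2
    exact h1.trans h2

/-- The coefficient of $\alpha_k$ in $\varepsilon_a-\varepsilon_b$ is `lam n k a - lam n k b`, so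
this is the monotonicity of `lam` for all $k$ at once. -/
theorem rootNonneg_e_sub_e {n : ℕ} (hn : 2 ≤ n) {a b : ℤ} (ha : InRange n a)
    (hb : InRange n b) (hab : a ≠ -b) (h : b < a) : RootNonneg n (e n a - e n b) := by
  rw [rootNonneg_iff hn]
  intro k h1 _
  have := lam_mono hn h1 ha hb hab h
  rw [coef, dotProduct_comm, dotProduct_sub]
  change 0 ≤ lam n k a - lam n k b
  linarith

/-- A signed permutation that preserves the positivity of the simple roots orthogonal to `ω_r`
preserves the positivity of all roots orthogonal to `ω_r`. -/
theorem lt_of_lam_eq {n : ℕ} (hn : 2 ≤ n) {r : ℕ} (hr : 1 ≤ r) {w : Equiv.Perm ℤ}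
    (hw : IsSigned n w) (hpos : ∀ i : ℤ, 1 ≤ i → i ≤ n → i ≠ r → w (lo i) < w i) {a b : ℤ}
    (ha : InRange n a) (hb : InRange n b) (hab : a ≠ -b) (h : b < a)
    (hl : lam n r b = lam n r a) : w b < w a := by
  refine (chain_induction (n := n) (fun b a => lam n r b ≤ lam n r a ∧
    (lam n r b = lam n r a → w b < w a)) ?_ ?_ ?_ ha hb hab h).2 hl
  · intro i h1 h2
    have h3 := lam_sub_lam_lo hn hr h1 h2
    split_ifs at h3 with h4
    · exact ⟨by linarith, fun h => by linarith⟩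
    · exact ⟨by linarith, fun _ => hpos i h1 h2 (Ne.symm h4)⟩
  · intro a b h
    simp only [lam_neg, hw.1]
    exact ⟨by linarith [h.1], fun h' => by
      have := h.2 (by linarith)
      omega⟩
  · intro a b c _ _ _ _ _ h1 h2
    refine ⟨h1.1.trans h2.1, fun h => ?_⟩
    exact (h1.2 (by linarith [h1.1, h2.1])).trans (h2.2 (by linarith [h1.1, h2.1]))

theorem mem_posRoots_iff {n : ℕ} {a b : ℤ} (ha : InRange n a) (hb : InRange n b)
    (hab : a ≠ -b) (hab' : a ≠ b) : e n a - e n b ∈ posRoots n ↔ b < a := by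
  have key : ∀ a b : ℤ, InRange n a → InRange n b → a ≠ -b → b < a →
      e n a - e n b ∈ posRoots n := by
    intro a b ha hb hab h
    obtain ⟨ha1, ha2, ha3⟩ := ha
    obtain ⟨hb1, hb2, hb3⟩ := hb
    rcases lt_or_gt_of_ne ha1 with h1 | h1 <;> rcases lt_or_gt_of_ne hb1 with h2 | h2
    · refine ⟨-a, -b, by omega, by omega, by omega, Or.inl ?_⟩
      rw [e_neg, e_neg]
      abel
    · omega
    · rcases lt_or_ge a (-b) with h3 | h3
      · refine ⟨a, -b, by omega, by omega, by omega, Or.inr ?_⟩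
        rw [e_neg]
        abel
      · refine ⟨-b, a, by omega, by omega, by omega, Or.inr ?_⟩
        rw [e_neg]
        abel
    · exact ⟨b, a, by omega, by omega, by omega, Or.inl rfl⟩
  refine ⟨fun h => ?_, key a b ha hb hab⟩
  by_contra hlt
  have h' := key b a hb ha (by omega) (by omega)
  -- The vector $(0,1,\dots,n-1)$ is half the sum of the positive roots. It is positive on every
  -- positive root, so a root and its negative cannot both be positive.
  let rho : E n := fun j => (j : ℝ)
  have hrho : ∀ k : ℤ, 1 ≤ k → k ≤ n → rho ⬝ᵥ e n k = (k : ℝ) - 1 := by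
    intro k h1 h2
    have := coord_nat rho (k := (k - 1).toNat) (by omega)
    rw [show (((k - 1).toNat : ℕ) : ℤ) + 1 = k by omega] at this
    rw [coord] at this
    rw [this]
    change (((k - 1).toNat : ℕ) : ℝ) = (k : ℝ) - 1
    have h3 : (((k - 1).toNat : ℕ) : ℤ) = k - 1 := by omega
    exact_mod_cast congrArg (Int.cast : ℤ → ℝ) h3
  have hposr : ∀ x ∈ posRoots n, 0 < rho ⬝ᵥ x := by
    rintro x ⟨i, j, h1, h2, h3, rfl | rfl⟩
    · rw [dotProduct_sub, hrho j (by omega) h3, hrho i h1 (by omega)]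
      have : (i : ℝ) < j := by exact_mod_cast h2
      linarith
    · rw [dotProduct_add, hrho j (by omega) h3, hrho i h1 (by omega)]
      have : (i : ℝ) < j := by exact_mod_cast h2
      have : (1 : ℝ) ≤ i := by exact_mod_cast h1
      linarith
  have h3 := hposr _ h
  have h4 := hposr _ h'
  rw [dotProduct_sub] at h3 h4
  linarith

theorem act_simpleRoot_mem_posRoots {n : ℕ} (hn : 2 ≤ n) {w : Equiv.Perm ℤ} (hw : IsSigned n w)
    {i : ℤ} (h1 : 1 ≤ i) (h2 : i ≤ n) :
    act n w (simpleRoot n i) ∈ posRoots n ↔ w (lo i) < w i := by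
  have hi := inRange_of_pos h1 h2
  have hl := inRange_lo hn h1 h2
  rw [simpleRoot_eq n h1, act_sub, act_e hw, act_e hw]
  refine mem_posRoots_iff (hw.inRange hi) (hw.inRange hl) ?_ ?_
  · rw [← hw.1]
    intro h
    have := w.injective h
    rcases lo_cases h1 with ⟨h3, h4⟩ | ⟨h3, h4⟩ <;> omega
  · intro h
    have := w.injective h
    rcases lo_cases h1 with ⟨h3, h4⟩ | ⟨h3, h4⟩ <;> omega

theorem mem_minReps_iff {n : ℕ} (hn : 2 ≤ n) {r : ℕ} {w : Equiv.Perm ℤ} :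
    w ∈ minReps n r ↔ w ∈ weylGroup n ∧ ∀ i : ℤ, 1 ≤ i → i ≤ n → i ≠ r → w (lo i) < w i := by
  constructor
  · rintro ⟨h1, h2⟩
    exact ⟨h1, fun i hi hi' hr =>
      (act_simpleRoot_mem_posRoots hn (isSigned_of_mem hn h1) hi hi').1 (h2 i hi hi' hr)⟩
  · rintro ⟨h1, h2⟩
    exact ⟨h1, fun i hi hi' hr =>
      (act_simpleRoot_mem_posRoots hn (isSigned_of_mem hn h1) hi hi').2 (h2 i hi hi' hr)⟩

/-! ### The exchange condition, and the Bruhat order against the dominance order. -/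

/-- `t_{a,b}` exchanges `a` with `b` and `-a` with `-b`. -/
theorem conj_s_eq_of_pair {n : ℕ} {g : Equiv.Perm ℤ} (hg : IsSigned n g) {i j : ℤ}
    (hi : 1 ≤ i) (hj : 1 ≤ j)
    (h : (g i = j ∧ g (lo i) = lo j) ∨ (g i = -lo j ∧ g (lo i) = -j)) :
    g * s i * g⁻¹ = s j := by
  rw [mul_inv_eq_iff_eq_mul]
  refine Equiv.ext fun x => ?_
  simp only [Equiv.Perm.mul_apply]
  have hinj : ∀ y, g x = g y ↔ x = y := fun y => g.injective.eq_iff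
  rw [s_apply hi, s_apply hj]
  rcases h with ⟨h1, h2⟩ | ⟨h1, h2⟩
  · rw [← h2, ← h1, ← hg.1, ← hg.1]
    simp only [hinj]
    split_ifs <;> rfl
  · have h1' : lo j = g (-i) := by rw [hg.1, h1, neg_neg]
    have h2' : j = g (-lo i) := by rw [hg.1, h2, neg_neg]
    rw [h1', h2', ← hg.1, ← hg.1, neg_neg, neg_neg]
    simp only [hinj]
    rcases lo_cases hi with ⟨h3, h4⟩ | ⟨h3, h4⟩ <;> rw [h4] <;> split_ifs <;>
      first | rfl | omega

theorem apply_ne_of_simple {n : ℕ} {g : Equiv.Perm ℤ} (hg : IsSigned n g) {i : ℤ} (hi : 1 ≤ i) :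
    g i ≠ g (lo i) ∧ g i ≠ -g (lo i) := by
  rw [← hg.1]
  constructor <;> intro h <;> have := g.injective h <;>
    rcases lo_cases hi with ⟨h3, h4⟩ | ⟨h3, h4⟩ <;> omega

/-- The exchange condition. -/
theorem exchange {n : ℕ} (hn : 2 ≤ n) (l : List ℤ) (hl : ∀ j ∈ l, 1 ≤ j ∧ j ≤ n) :
    ∀ (g : Equiv.Perm ℤ) (i : ℤ), IsSigned n g → 1 ≤ i → i ≤ n → g (lo i) < g i →
      ((l.map s).prod)⁻¹ (g i) < ((l.map s).prod)⁻¹ (g (lo i)) →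
      ∃ l' : List ℤ, (∀ j ∈ l', 1 ≤ j ∧ j ≤ n) ∧ l'.length + 1 = l.length ∧
        (l'.map s).prod = g * s i * g⁻¹ * (l.map s).prod := by
  induction l with
  | nil =>
    intro g i _ _ _ h1 h2
    simp at h2
    omega
  | cons j l ih =>
    intro g i hg hi hi' h1 h2
    have hj := hl j List.mem_cons_self
    have hl' : ∀ j ∈ l, 1 ≤ j ∧ j ≤ n := fun k hk => hl k (List.mem_cons_of_mem _ hk)
    have hne := apply_ne_of_simple hg hi
    have ha := (hg.inRange (inRange_of_pos hi hi')).1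
    have hb := (hg.inRange (inRange_lo hn hi hi')).1
    -- The positive root $g\alpha_i$ is carried through the word until it becomes negative. That can
    -- happen at the letter $j$ only if the root is then $\alpha_j$; in this case the letter is
    -- deleted, otherwise the root stays positive and the induction continues with $s_jg$.
    by_cases hc : (g (lo i) = lo j ∧ g i = j) ∨ (g (lo i) = -j ∧ g i = -lo j)
    · refine ⟨l, hl', by simp, ?_⟩
      rw [conj_s_eq_of_pair hg hi hj.1 (by tauto), List.map_cons, List.prod_cons, ← mul_assoc,
        s_mul_s hj.1, one_mul]
    · have h3 : s j (g (lo i)) < s j (g i) := s_lt_s hj.1 ha hb hne.2 h1 (by tauto) (by tauto)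
      rw [List.map_cons, List.prod_cons, mul_inv_rev, s_inv hj.1] at h2
      obtain ⟨l', h4, h5, h6⟩ := ih hl' (s j * g) i ((isSigned_s hn hj.1 hj.2).mul hg) hi hi' h3 h2
      refine ⟨j :: l', ?_, by simp [h5], ?_⟩
      · intro k hk
        rcases List.mem_cons.1 hk with rfl | hk
        · exact hj
        · exact h4 k hk
      · rw [List.map_cons, List.prod_cons, h6, List.map_cons, List.prod_cons, mul_inv_rev,
          s_inv hj.1]
        simp only [← mul_assoc, s_mul_s hj.1, one_mul]

theorem exists_word {n : ℕ} {w : Equiv.Perm ℤ} (hw : w ∈ weylGroup n) :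
    ∃ l : List ℤ, (∀ i ∈ l, 1 ≤ i ∧ i ≤ n) ∧ (l.map s).prod = w := by
  induction hw using Subgroup.closure_induction with
  | mem x hx =>
    obtain ⟨i, h1, h2, rfl⟩ := hx
    exact ⟨[i], by simpa using ⟨h1, h2⟩, by simp⟩
  | one => exact ⟨[], by simp, rfl⟩
  | mul x y _ _ hx hy =>
    obtain ⟨l, h1, rfl⟩ := hx
    obtain ⟨l', h2, rfl⟩ := hy
    refine ⟨l ++ l', fun i hi => ?_, by simp⟩
    rcases List.mem_append.1 hi with h | h
    · exact h1 i h
    · exact h2 i h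
  | inv x _ hx =>
    obtain ⟨l, h1, rfl⟩ := hx
    refine ⟨l.reverse, fun i hi => h1 i (List.mem_reverse.1 hi), ?_⟩
    rw [List.prod_inv_reverse, List.map_reverse, List.map_map]
    congr 2
    refine List.map_congr_left fun i hi => ?_
    exact (s_inv (h1 i hi).1).symm

theorem length_mul_lt {n : ℕ} (hn : 2 ≤ n) {u g : Equiv.Perm ℤ} {i : ℤ} (hu : u ∈ weylGroup n)
    (hg : IsSigned n g) (hi : 1 ≤ i) (hi' : i ≤ n) (h1 : g (lo i) < g i)
    (h2 : u⁻¹ (g i) < u⁻¹ (g (lo i))) : length n (g * s i * g⁻¹ * u) < length n u := by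
  obtain ⟨l, hl, hlu⟩ := exists_word hu
  -- A reduced word: the infimum is attained because some word exists.
  obtain ⟨l, hl, hlu, hlen⟩ : length n u ∈ {k | ∃ l : List ℤ, (∀ i ∈ l, 1 ≤ i ∧ i ≤ n) ∧
      (l.map s).prod = u ∧ l.length = k} := Nat.sInf_mem ⟨l.length, l, hl, hlu, rfl⟩
  subst hlu
  obtain ⟨l', h3, h4, h5⟩ := exchange hn l hl g i hg hi hi' h1 h2
  have : length n (g * s i * g⁻¹ * (l.map s).prod) ≤ l'.length :=
    Nat.sInf_le ⟨l', h3, h5, rfl⟩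
  omega

/-- Write $t=s_\beta$ with $\beta>0$. If $u^{-1}\beta$ were negative, $tu$ would be shorter than
$u$. So $u^{-1}\beta>0$, hence $\langle u(\omega_r),\beta\rangle\ge0$, and $t$ subtracts this
multiple of $\beta$ from $u(\omega_r)$. -/
theorem bruhat_step {n : ℕ} (hn : 2 ≤ n) {r : ℕ} (hr : 1 ≤ r) {u t : Equiv.Perm ℤ}
    (hu : u ∈ weylGroup n) (ht : t ∈ reflections n) (hlen : length n u < length n (t * u)) :
    t * u ∈ weylGroup n ∧
      RootNonneg n (act n u (fundWeight n r) - act n (t * u) (fundWeight n r)) := by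
  obtain ⟨g, hg, i, hi, hi', rfl⟩ := ht
  have hmem : g * s i * g⁻¹ * u ∈ weylGroup n :=
    mul_mem (mul_mem (mul_mem hg (s_mem hi hi')) (inv_mem hg)) hu
  refine ⟨hmem, ?_⟩
  have hsu := isSigned_of_mem hn hu
  have hsi := isSigned_s hn hi hi'
  -- The roots $g\alpha_i$ and $gs_i\alpha_i=-g\alpha_i$ define the same reflection; the positive
  -- one is chosen.
  obtain ⟨g', hg', hlt, hgg⟩ : ∃ g', IsSigned n g' ∧ g' (lo i) < g' i ∧
      g' * s i * g'⁻¹ = g * s i * g⁻¹ := by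
    have hg' := isSigned_of_mem hn hg
    rcases lt_or_gt_of_ne (apply_ne_of_simple hg' hi).1 with h | h
    · refine ⟨g * s i, hg'.mul hsi, ?_, ?_⟩
      · simpa [s_self_apply hi, s_lo_apply hi] using h
      · rw [mul_inv_rev, s_inv hi]
        simp only [mul_assoc, s_mul_s hi, mul_one]
        try rw [← mul_assoc (s i) (s i), s_mul_s hi, one_mul]
    · exact ⟨g, hg', h, rfl⟩
  rw [← hgg] at hlen ⊢
  clear hgg hmem hg
  have ha := hg'.inRange (inRange_of_pos hi hi')
  have hb := hg'.inRange (inRange_lo hn hi hi')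
  have hne := apply_ne_of_simple hg' hi
  have hlt' : u⁻¹ (g' (lo i)) < u⁻¹ (g' i) := by
    by_contra h
    rcases lt_or_eq_of_le (not_lt.1 h) with h | h
    · exact absurd hlen (not_lt.2 (length_mul_lt hn hu hg' hi hi' hlt h).le)
    · exact hne.1 (u⁻¹.injective h)
  have hne' : u⁻¹ (g' i) ≠ -u⁻¹ (g' (lo i)) := by
    rw [← hsu.inv.1]
    exact fun h => hne.2 (u⁻¹.injective h)
  rw [act_mul ((hg'.mul hsi).mul hg'.inv) hsu, act_conj_s hn hg' hi hi', sub_sub_cancel]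
  refine RootNonneg.smul hn ?_ (rootNonneg_e_sub_e hn ha hb hne.2 hlt)
  rw [coord_act' hsu _ ha, coord_act' hsu _ hb]
  have := lam_mono hn hr (hsu.inv.inRange ha) (hsu.inv.inRange hb) hne' hlt'
  simp only [lam] at this
  linarith

theorem rootNonneg_zero (n : ℕ) : RootNonneg n 0 :=
  ⟨0, fun _ _ => le_rfl, by simp⟩

theorem BruhatLE.rootNonneg {n : ℕ} (hn : 2 ≤ n) {r : ℕ} (hr : 1 ≤ r) {u v : Equiv.Perm ℤ}
    (hu : u ∈ weylGroup n) (h : BruhatLE n u v) :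
    RootNonneg n (act n u (fundWeight n r) - act n v (fundWeight n r)) := by
  suffices h' : v ∈ weylGroup n ∧
      RootNonneg n (act n u (fundWeight n r) - act n v (fundWeight n r)) from h'.2
  unfold BruhatLE at h
  induction h with
  | refl => exact ⟨hu, by simpa using rootNonneg_zero n⟩
  | tail _ hstep ih =>
    obtain ⟨hlen, t, ht, rfl⟩ := hstep
    obtain ⟨h1, h2⟩ := bruhat_step hn hr ih.1 ht hlen
    refine ⟨h1, ?_⟩
    have := ih.2.add hn h2
    rwa [sub_add_sub_cancel] at this

/-- An element of `W^{I_r}` is determined by the image of `ω_r`. -/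
theorem eq_of_act_eq {n : ℕ} (hn : 2 ≤ n) {r : ℕ} (hr : 1 ≤ r) {u w : Equiv.Perm ℤ}
    (hu : u ∈ minReps n r) (hw : w ∈ minReps n r)
    (h : act n u (fundWeight n r) = act n w (fundWeight n r)) : u = w := by
  rw [mem_minReps_iff hn] at hu hw
  have hsu := isSigned_of_mem hn hu.1
  have hsw := isSigned_of_mem hn hw.1
  have hg : w⁻¹ * u ∈ weylGroup n := mul_mem (inv_mem hw.1) hu.1
  have hsg := isSigned_of_mem hn hg
  have hlam : ∀ {a : ℤ}, InRange n a → lam n r ((w⁻¹ * u) a) = lam n r a := by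
    intro a ha
    rw [lam, lam, Equiv.Perm.mul_apply, ← coord_act hsu _ ha, h,
      coord_act' hsw _ (hsu.inRange ha)]
  -- The element $g=w^{-1}u$ fixes $\omega_r$. It cannot make $\alpha_r$ negative, since it keeps
  -- the pairing $1$ with $\omega_r$. If it made $\alpha_i$ negative for some $i\ne r$, then
  -- $g\alpha_i$ would be orthogonal to $\omega_r$, so $w$ would keep it negative, against
  -- $u\alpha_i>0$.
  have hone : w⁻¹ * u = 1 := by
    refine eq_one_of_mem hn hg fun i hi hi' => ?_
    have ha := inRange_of_pos hi hi'
    have hb := inRange_lo hn hi hi'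
    have hne := apply_ne_of_simple hsg hi
    have hne' : (w⁻¹ * u) (lo i) ≠ -(w⁻¹ * u) i := by
      intro h
      exact hne.2 (by omega)
    have hsimple := lam_sub_lam_lo hn hr hi hi'
    rw [← hlam ha, ← hlam hb] at hsimple
    by_contra hcon
    have hlt := lt_of_le_of_ne (not_lt.1 hcon) hne.1
    have hga := hsg.inRange ha
    have hgb := hsg.inRange hb
    have hle := lam_mono hn hr hgb hga hne' hlt
    split_ifs at hsimple with hri
    · linarith
    · have h1 := lt_of_lam_eq hn hr hsw hw.2 hgb hga hne' hlt (by linarith)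
      have h2 := hu.2 i hi hi' (Ne.symm hri)
      simp only [Equiv.Perm.mul_apply, show ∀ x, w (w⁻¹ x) = x from w.apply_symm_apply] at h1
      omega
  rw [inv_mul_eq_one] at hone
  exact hone.symm

/-- A simple reflection that raises `w(ω_r)` lowers `w`. -/
theorem s_mul_mem_minReps {n : ℕ} (hn : 2 ≤ n) {r : ℕ} (hr : 1 ≤ r) {w : Equiv.Perm ℤ}
    (hw : w ∈ minReps n r) {i : ℤ} (hi : 1 ≤ i) (hi' : i ≤ n)
    (hlt : coord (act n w (fundWeight n r)) i < coord (act n w (fundWeight n r)) (lo i)) :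
    s i * w ∈ minReps n r ∧ BruhatLE n (s i * w) w := by
  rw [mem_minReps_iff hn] at hw
  have hsw := isSigned_of_mem hn hw.1
  have hsi := isSigned_s hn hi hi'
  have ha := inRange_of_pos hi hi'
  have hb := inRange_lo hn hi hi'
  have hne := apply_ne_of_simple (hsw.inv) hi
  -- A negative pairing of $w(\omega_r)$ with $\alpha_i$ means that $w^{-1}\alpha_i$ is negative.
  have hinv : w⁻¹ i < w⁻¹ (lo i) := by
    by_contra hcon
    have h1 := lam_mono hn hr (hsw.inv.inRange ha) (hsw.inv.inRange hb) hne.2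
      (lt_of_le_of_ne (not_lt.1 hcon) hne.1.symm)
    rw [coord_act' hsw _ ha, coord_act' hsw _ hb] at hlt
    simp only [lam] at h1
    linarith
  constructor
  · rw [mem_minReps_iff hn]
    refine ⟨mul_mem (s_mem hi hi') hw.1, fun j hj hj' hjr => ?_⟩
    have hja := inRange_of_pos hj hj'
    have hjb := inRange_lo hn hj hj'
    have hlo : lo j < j := by
      rcases lo_cases hj with ⟨h3, h4⟩ | ⟨h3, h4⟩ <;> omega
    -- The positive root $w\alpha_j$ stays positive under $s_i$ unless it equals $\alpha_i$, and
    -- then $w^{-1}\alpha_i=\alpha_j$ would be positive.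
    refine s_lt_s hi (hsw.inRange hja).1 (hsw.inRange hjb).1 (apply_ne_of_simple hsw hj).2
      (hw.2 j hj hj' hjr) ?_ ?_
    · rintro ⟨h1, h2⟩
      rw [← h1, ← h2] at hinv
      simp only [show ∀ x, w⁻¹ (w x) = x from w.symm_apply_apply] at hinv
      omega
    · rintro ⟨h1, h2⟩
      have h3 : i = w (-lo j) := by rw [hsw.1, h1, neg_neg]
      have h4 : lo i = w (-j) := by rw [hsw.1, h2, neg_neg]
      rw [h4] at hinv
      nth_rewrite 1 [h3] at hinv
      simp only [show ∀ x, w⁻¹ (w x) = x from w.symm_apply_apply] at hinv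
      omega
  · refine Relation.ReflTransGen.single ⟨?_, s i, ⟨1, one_mem _, i, hi, hi', by simp⟩, ?_⟩
    · have hlo : lo i < i := by
        rcases lo_cases hi with ⟨h3, h4⟩ | ⟨h3, h4⟩ <;> omega
      simpa using length_mul_lt hn hw.1 (IsSigned.one n) hi hi' hlo hinv
    · rw [← mul_assoc, s_mul_s hi, one_mul]

/-! ### Top vectors and their coefficients. -/

/-- All coordinates are `-1`, `0` or `1`. -/
def IsSmall {n : ℕ} (x : E n) : Prop :=
  ∀ k : ℕ, 1 ≤ k → k ≤ n → coord x k = -1 ∨ coord x k = 0 ∨ coord x k = 1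

/-- `x ≤ 0` in the root order. -/
def IsNonpos {n : ℕ} (x : E n) : Prop := ∀ k : ℕ, 1 ≤ k → k ≤ n → coef x k ≤ 0

theorem isNonpos_iff {n : ℕ} (hn : 2 ≤ n) (x : E n) : IsNonpos x ↔ RootNonneg n (-x) := by
  rw [rootNonneg_iff hn]
  simp only [coef_neg, IsNonpos, Left.nonneg_neg_iff]

/-- `x ≤ 0`, and no simple reflection raises `x` to another such vector. -/
structure IsTop {n : ℕ} (x : E n) : Prop where
  small : IsSmall x
  nonpos : IsNonpos x
  no_lift : ∀ i : ℕ, 1 ≤ i → i ≤ n → coord x i < coord x (lo i) →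
    0 < coef x i - (coord x i - coord x (lo i))

theorem IsTop.no_lift_one {n : ℕ} (hn : 1 ≤ n) {x : E n} (hx : IsTop x)
    (h : coord x 1 < -coord x 2) : 0 < coef x 1 - (coord x 1 + coord x 2) := by
  have := hx.no_lift 1 le_rfl hn
  rw [show lo (1 : ℕ) = -2 from rfl, coord_neg_right] at this
  push_cast at this
  linarith [this h]

theorem IsTop.no_lift_succ {n : ℕ} {x : E n} (hx : IsTop x) {k : ℕ} (hk : 1 ≤ k) (hk' : k + 1 ≤ n)
    (h : coord x (k + 1 : ℕ) < coord x k) :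
    0 < coef x (k + 1) - (coord x (k + 1 : ℕ) - coord x k) := by
  have := hx.no_lift (k + 1) (by omega) hk'
  rw [show lo (k + 1 : ℕ) = k by unfold lo; split_ifs <;> omega] at this
  exact this h

/-- Going down from $n$, the tail sums start at $0$ and change by at most one. A positive sum is
excluded by $x\le0$, a repeated $-1$ because an exchange of neighbouring coordinates would lift it,
and a descent to $-2$ because it could never stop before the fork, where it is impossible too. -/
theorem IsTop.coef_of_three_le {n : ℕ} (hn : 3 ≤ n) {x : E n} (hx : IsTop x) {k : ℕ}
    (hk : 3 ≤ k) : coef x k = 0 ∨ (coef x k = -1 ∧ coef x (k + 1) = 0) := by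
  have hrun3 : ¬ (coord x 3 = -1 ∧ coef x 3 ≤ -2) := by
    rintro ⟨h1, h2⟩
    have h3 := hx.small 1 le_rfl (by omega)
    have h4 := hx.small 2 (by omega) (by omega)
    have h5 := coef_one_add x
    have h6 := coef_one_sub x
    have h7 := hx.no_lift_one (by omega)
    have h8 := hx.no_lift_succ (k := 1) le_rfl (by omega)
    have h9 := hx.no_lift_succ (k := 2) (by omega) (by omega)
    norm_num at h3 h4 h8 h9
    rcases h4 with h4 | h4 | h4 <;> rw [h4] at h5 h7 h8 h9
    · rcases h3 with h3 | h3 | h3 <;> rw [h3] at h6 h7 h8 <;> norm_num at * <;> linarith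
    · rw [h1] at h9
      norm_num at h9
      linarith
    · rw [h1] at h9
      norm_num at h9
      linarith
  -- If the coordinate before such a $-1$ were $0$ or $1$, exchanging the two would raise the
  -- coefficient by at most 2, leaving it $\le0$. So that coordinate is $-1$ as well, and the
  -- situation moves down to `hrun3`.
  have hrun : ∀ d : ℕ, d + 3 ≤ n → ¬ (coord x (d + 3 : ℕ) = -1 ∧ coef x (d + 3) ≤ -2) := by
    intro d
    induction d with
    | zero =>
      intro _
      simpa using hrun3
    | succ d ih =>
      rintro hd ⟨h1, h2⟩
      have h3 := hx.small (d + 3) (by omega) (by omega)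
      have h4 := hx.no_lift_succ (k := d + 3) (by omega) (by omega)
      have h5 := coef_succ x (k := d + 3) (by omega)
      rw [show d + 1 + 3 = d + 3 + 1 by omega] at h1 h2
      rw [h1] at h4
      rcases h3 with h3 | h3 | h3
      · exact ih (by omega) ⟨h3, by linarith⟩
      · rw [h3] at h4
        norm_num at h4
        linarith
      · rw [h3] at h4
        norm_num at h4
        linarith
  have key : ∀ d k : ℕ, 3 ≤ k → k + d = n + 1 →
      coef x k = 0 ∨ (coef x k = -1 ∧ coef x (k + 1) = 0) := by
    intro d
    induction d with
    | zero =>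
      intro k hk hd
      exact Or.inl (coef_of_gt x hk (by omega))
    | succ d ih =>
      intro k hk hd
      have h1 := hx.small k (by omega) (by omega)
      have h2 := coef_succ x hk
      have h3 := hx.nonpos k (by omega) (by omega)
      rcases ih (k + 1) (by omega) (by omega) with h | ⟨h, h'⟩
      · rw [h] at h2
        rcases h1 with h1 | h1 | h1
        · exact Or.inr ⟨by linarith, h⟩
        · exact Or.inl (by linarith)
        · linarith
      · rcases h1 with h1 | h1 | h1
        · exfalso
          have := hrun (k - 3) (by omega)
          rw [show k - 3 + 3 = k by omega] at this
          exact this ⟨h1, by linarith⟩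
        -- A second coefficient $-1$ comes from $x_k=0$, $x_{k+1}=-1$; exchanging these raises the
        -- upper coefficient to $0$, a permitted lift.
        · exfalso
          have hkn : k + 1 ≤ n := by
            by_contra hc
            rw [coef_of_gt x (by omega) (by omega)] at h
            linarith
          have h4 := coef_succ x (k := k + 1) (by omega)
          have h5 := hx.no_lift_succ (by omega) hkn
          have h6 : coord x (k + 1 : ℕ) = -1 := by linarith
          rw [h6, h1] at h5
          norm_num at h5
          linarith
        · exact Or.inl (by linarith)
  rcases le_or_gt k (n + 1) with h | h
  · exact key (n + 1 - k) k hk (by omega)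
  · exact Or.inl (coef_of_gt x hk (by omega))

/-- The possible ends of a top vector. -/
theorem IsTop.end_cases {n : ℕ} (hn : 3 ≤ n) {x : E n} (hx : IsTop x) :
    (coef x 1 = 0 ∧ coef x 2 = 0) ∨
    (coef x 1 = -1 ∧ coef x 2 = 0 ∧ coef x 3 = 0) ∨
    (coef x 1 = 0 ∧ coef x 2 = -1 ∧ coef x 3 = 0) ∨
    (coef x 1 = -1 / 2 ∧ coef x 2 = -1 / 2 ∧ coef x 3 = 0) ∨
    (coef x 1 = -3 / 2 ∧ coef x 2 = -1 / 2 ∧ coef x 3 = -1 ∧ coef x 4 = 0) ∨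
    (coef x 1 = -1 / 2 ∧ coef x 2 = -3 / 2 ∧ coef x 3 = -1 ∧ coef x 4 = 0) := by
  have h1 := hx.small 1 le_rfl (by omega)
  have h2 := hx.small 2 (by omega) (by omega)
  have h3 := hx.coef_of_three_le hn (k := 3) le_rfl
  have h5 := coef_one_add x
  have h6 := coef_one_sub x
  have h7 := hx.nonpos 1 le_rfl (by omega)
  have h8 := hx.nonpos 2 (by omega) (by omega)
  have h9 := hx.no_lift_succ (k := 1) le_rfl (by omega)
  have h10 := hx.no_lift_succ (k := 2) (by omega) (by omega)
  have h11 := coef_succ x (k := 3) le_rfl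
  norm_num at h1 h2 h3 h9 h10 h11
  -- The first two coefficients are $\frac12(x_2+c_3\pm x_1)$, with $c_3\in\{0,-1\}$ the third. This
  -- leaves finitely many cases.
  rcases h3 with h3 | ⟨h3, h4⟩
  · rcases h2 with h2 | h2 | h2
    · rcases h1 with h1 | h1 | h1
      · exact Or.inr (Or.inl ⟨by linarith, by linarith, h3⟩)
      · exact Or.inr (Or.inr (Or.inr (Or.inl ⟨by linarith, by linarith, h3⟩)))
      · exact Or.inr (Or.inr (Or.inl ⟨by linarith, by linarith, h3⟩))
    · rcases h1 with h1 | h1 | h1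
      · exfalso; linarith
      · exact Or.inl ⟨by linarith, by linarith⟩
      · exfalso; linarith
    · exfalso
      rcases h1 with h1 | h1 | h1 <;> linarith
  · have h12 : coord x 3 = -1 := by linarith
    rw [h12] at h10
    rcases h2 with h2 | h2 | h2
    · rcases h1 with h1 | h1 | h1
      · exact Or.inr (Or.inr (Or.inr (Or.inr (Or.inl ⟨by linarith, by linarith, h3, h4⟩))))
      · exfalso
        rw [h1, h2] at h9
        norm_num at h9
        linarith
      · exact Or.inr (Or.inr (Or.inr (Or.inr (Or.inr ⟨by linarith, by linarith, h3, h4⟩))))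
    · exfalso
      rw [h2] at h10
      norm_num at h10
      linarith
    · rcases h1 with h1 | h1 | h1
      · exfalso; linarith
      · exact Or.inl ⟨by linarith, by linarith⟩
      · exfalso; linarith

/-! ### Climbing to top vectors; minimality and maximality in terms of weights. -/

/-- A set of vectors with coordinates `-1`, `0`, `1`, stable under the simple reflections. -/
structure IsStable {n : ℕ} (X : Set (E n)) : Prop where
  small : ∀ x ∈ X, IsSmall x
  act_mem : ∀ x ∈ X, ∀ i : ℤ, 1 ≤ i → i ≤ n → act n (s i) x ∈ X

theorem IsSmall.lt_lo {n : ℕ} (hn : 2 ≤ n) {x : E n} (hx : IsSmall x) {i : ℕ} (hi : 1 ≤ i)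
    (hi' : i ≤ n) (h : coord x i < coord x (lo i)) : coord x i - coord x (lo i) ≤ -1 := by
  have h1 := hx i hi hi'
  have h2 : coord x (lo i) = -1 ∨ coord x (lo i) = 0 ∨ coord x (lo i) = 1 := by
    rcases lo_cases (i := i) (by omega) with ⟨h3, h4⟩ | ⟨h3, h4⟩
    · rw [h4, coord_neg_right]
      have := hx 2 (by omega) hn
      push_cast at this
      rcases this with h | h | h <;> rw [h] <;> norm_num
    · rw [h4]
      have := hx (i - 1) (by omega) (by omega)
      rwa [show ((i - 1 : ℕ) : ℤ) = (i : ℤ) - 1 by omega] at this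
  rcases h1 with h1 | h1 | h1 <;> rcases h2 with h2 | h2 | h2 <;> rw [h1, h2] at h ⊢ <;>
    linarith

/-- Apply permitted lifts as long as there are any. The coordinates are integers, so each lift
lowers the nonnegative sum of the $-c_k$ by at least 1, and the process stops. -/
theorem exists_isTop {n : ℕ} (hn : 2 ≤ n) {X : Set (E n)} (hX : IsStable X) {x : E n}
    (hx : x ∈ X) (hneg : IsNonpos x) : ∃ y ∈ X, IsTop y ∧ RootNonneg n (y - x) := by
  obtain ⟨N, hN⟩ := exists_nat_gt (∑ k ∈ Finset.Icc 1 n, -coef x k)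
  induction N generalizing x with
  | zero =>
    exfalso
    have : 0 ≤ ∑ k ∈ Finset.Icc 1 n, -coef x k := by
      refine Finset.sum_nonneg fun k hk => ?_
      rw [Finset.mem_Icc] at hk
      linarith [hneg k hk.1 hk.2]
    push_cast at hN
    linarith
  | succ N ih =>
    by_cases hl : ∀ i : ℕ, 1 ≤ i → i ≤ n → coord x i < coord x (lo i) →
        0 < coef x i - (coord x i - coord x (lo i))
    · exact ⟨x, hx, ⟨hX.small x hx, hneg, hl⟩, by simpa using rootNonneg_zero n⟩
    · push Not at hl
      obtain ⟨i, hi, hi', h1, h2⟩ := hl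
      have h3 := (hX.small x hx).lt_lo hn hi hi' h1
      set t := coord x i - coord x (lo i) with ht
      have hact := act_s hn (i := i) (by omega) (by omega) x
      rw [← ht] at hact
      have hcoef : ∀ k : ℕ, 1 ≤ k → coef (act n (s i) x) k
          = coef x k - (if k = i then t else 0) := by
        intro k hk
        rw [hact, coef_sub, coef_smul, coef_simpleRoot hn hk hi hi']
        split_ifs <;> ring
      obtain ⟨y, hy, hy1, hy2⟩ := ih (hX.act_mem x hx i (by omega) (by omega)) (by
        intro k hk hk'
        rw [hcoef k hk]
        split_ifs with h
        · rw [h]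
          exact h2
        · linarith [hneg k hk hk']) (by
        have : ∑ k ∈ Finset.Icc 1 n, -coef (act n (s i) x) k
            = (∑ k ∈ Finset.Icc 1 n, -coef x k) + t := by
          have h5 : ∑ k ∈ Finset.Icc 1 n, (if k = i then t else 0) = t := by
            rw [Finset.sum_ite_eq', if_pos (Finset.mem_Icc.2 ⟨hi, hi'⟩)]
          have h6 : ∑ k ∈ Finset.Icc 1 n, -coef (act n (s i) x) k
              = ∑ k ∈ Finset.Icc 1 n, (-coef x k + if k = i then t else 0) := by
            refine Finset.sum_congr rfl fun k hk => ?_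
            rw [hcoef k (Finset.mem_Icc.1 hk).1]
            ring
          rw [h6, Finset.sum_add_distrib, h5]
        rw [this]
        push_cast at hN
        linarith)
      refine ⟨y, hy, hy1, ?_⟩
      have h4 : RootNonneg n (act n (s i) x - x) := by
        rw [hact, sub_sub_cancel_left, ← neg_smul]
        exact (rootNonneg_simpleRoot hn (by omega) (by omega)).smul hn (by linarith)
      have := hy2.add hn h4
      rwa [sub_add_sub_cancel] at this

theorem RootNonneg.antisymm {n : ℕ} (hn : 2 ≤ n) {x y : E n} (h : RootNonneg n (x - y))
    (h' : RootNonneg n (y - x)) : x = y := by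
  rw [rootNonneg_iff hn] at h h'
  refine eq_of_coef hn fun k h1 h2 => ?_
  have h3 := h k h1 h2
  have h4 := h' k h1 h2
  rw [coef_sub] at h3 h4
  linarith

/-- Lift $x$ to a top vector $z\ge x\ge y$; the hypothesis gives $z=y$, and $x$ is caught in
between. Thus $y$ need only be compared with top vectors. -/
theorem eq_of_maximal_among_tops {n : ℕ} (hn : 2 ≤ n) {X : Set (E n)} (hX : IsStable X) {y : E n}
    (hy : ∀ z ∈ X, IsTop z → RootNonneg n (z - y) → z = y) {x : E n} (hx : x ∈ X)
    (hneg : IsNonpos x) (hle : RootNonneg n (x - y)) : x = y := by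
  obtain ⟨z, hz, hz1, hz2⟩ := exists_isTop hn hX hx hneg
  have h1 := hz2.add hn hle
  rw [sub_add_sub_cancel] at h1
  have := hy z hz hz1 h1
  subst this
  exact hle.antisymm hn hz2

theorem act_mem_of_isStable {n : ℕ} (hn : 2 ≤ n) {X : Set (E n)} (hX : IsStable X)
    {w : Equiv.Perm ℤ} (hw : w ∈ weylGroup n) {x : E n} (hx : x ∈ X) : act n w x ∈ X := by
  obtain ⟨l, hl, rfl⟩ := exists_word hw
  induction l with
  | nil => simpa [act_one] using hx
  | cons i l ih =>
    have h1 := hl i List.mem_cons_self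
    have h2 : ∀ j ∈ l, 1 ≤ j ∧ j ≤ n := fun j hj => hl j (List.mem_cons_of_mem _ hj)
    have h3 : (l.map s).prod ∈ weylGroup n := by
      refine Subgroup.list_prod_mem _ fun t ht => ?_
      obtain ⟨j, hj, rfl⟩ := List.mem_map.1 ht
      exact s_mem (h2 j hj).1 (h2 j hj).2
    rw [List.map_cons, List.prod_cons, act_mul (isSigned_s hn h1.1 h1.2) (isSigned_of_mem hn h3)]
    exact hX.act_mem _ (ih h2 h3) i h1.1 h1.2

/-- `w` is minimal if the weight `κ w(ω_r)` is a maximal one among the top vectors. -/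
theorem isMinimalNonpos_of_weight {n : ℕ} (hn : 2 ≤ n) {r : ℕ} (hr : 1 ≤ r) {X : Set (E n)}
    (hX : IsStable X) {κ : ℝ} (hκ : 0 < κ) (hmem : κ • fundWeight n r ∈ X)
    {w : Equiv.Perm ℤ} (hw : w ∈ minReps n r) (hneg : IsNonpos (κ • act n w (fundWeight n r)))
    (hy : ∀ z ∈ X, IsTop z → RootNonneg n (z - κ • act n w (fundWeight n r)) →
      z = κ • act n w (fundWeight n r)) : IsMinimalNonpos n r w := by
  have hscale : ∀ x : E n, IsNonpos (κ • x) ↔ RootNonneg n (-x) := by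
    intro x
    rw [← isNonpos_iff hn]
    simp only [IsNonpos, coef_smul]
    refine forall_congr' fun k => forall_congr' fun _ => forall_congr' fun _ => ?_
    constructor <;> intro h <;> nlinarith
  refine ⟨⟨hw, (hscale _).1 hneg⟩, fun u hu hu' hle => eq_of_act_eq hn hr hu hw ?_⟩
  have h1 := (hle.rootNonneg hn hr hu.1).smul hn hκ.le
  rw [smul_sub] at h1
  have h2 := eq_of_maximal_among_tops hn hX hy
    (by rw [← act_smul]; exact act_mem_of_isStable hn hX hu.1 hmem) ((hscale _).2 hu') h1
  exact smul_right_injective (E n) hκ.ne' h2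

/-- If $v\le u$ in Bruhat order then $-u(\omega_r)\ge-v(\omega_r)$, so the argument for minimal
elements applies to the orbit of $-\omega_r$. -/
theorem isMaximalNonneg_of_weight {n : ℕ} (hn : 2 ≤ n) {r : ℕ} (hr : 1 ≤ r) {X : Set (E n)}
    (hX : IsStable X) (hmem : -fundWeight n r ∈ X) {v : Equiv.Perm ℤ} (hv : v ∈ minReps n r)
    (hneg : IsNonpos (-act n v (fundWeight n r)))
    (hy : ∀ z ∈ X, IsTop z → RootNonneg n (z - -act n v (fundWeight n r)) →
      z = -act n v (fundWeight n r)) : IsMaximalNonneg n r v := by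
  refine ⟨⟨hv, by simpa [isNonpos_iff hn] using hneg⟩, fun u hu hu' hle =>
    eq_of_act_eq hn hr hu hv ?_⟩
  have h1 := hle.rootNonneg hn hr hv.1
  have h2 := eq_of_maximal_among_tops hn hX hy (x := -act n u (fundWeight n r))
    (by rw [← act_neg]; exact act_mem_of_isStable hn hX hu.1 hmem)
    (by rw [isNonpos_iff hn, neg_neg]; exact hu') (by rwa [neg_sub_neg])
  exact neg_injective h2

/-- The weight of a minimal element is a top vector. -/
theorem IsMinimalNonpos.isTop {n : ℕ} (hn : 2 ≤ n) {r : ℕ} (hr : 1 ≤ r) {κ : ℝ} (hκ : 0 < κ)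
    {w : Equiv.Perm ℤ} (hw : IsMinimalNonpos n r w)
    (hsmall : IsSmall (κ • act n w (fundWeight n r))) :
    IsTop (κ • act n w (fundWeight n r)) := by
  obtain ⟨⟨hmem, hneg⟩, hmin⟩ := hw
  have hneg' := (isNonpos_iff hn _).2 hneg
  refine ⟨hsmall, fun k h1 h2 => ?_, fun i hi hi' hlt => ?_⟩
  · rw [coef_smul]
    have := hneg' k h1 h2
    nlinarith
  · simp only [coord_smul] at hlt ⊢
    have hlt' := lt_of_mul_lt_mul_left hlt hκ.le
    obtain ⟨h1, h2⟩ := s_mul_mem_minReps hn hr hmem (i := i) (by omega) (by omega) hlt'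
    by_contra hcon
    rw [coef_smul, ← mul_sub, ← mul_sub] at hcon
    have hcon' : coef (act n w (fundWeight n r)) i - (coord (act n w (fundWeight n r)) i
        - coord (act n w (fundWeight n r)) (lo i)) ≤ 0 := by
      by_contra hc
      exact hcon (mul_pos hκ (not_le.1 hc))
    -- A lift that stays $\le0$ would make $s_iw$ a competitor below $w$, whence $s_i=1$, which is
    -- absurd.
    have h3 := hmin _ h1 (by
      rw [← isNonpos_iff hn, act_mul (isSigned_s hn (by omega) (by omega))
        (isSigned_of_mem hn hmem.1), act_s hn (by omega) (by omega)]
      intro k hk hk'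
      rw [coef_sub, coef_smul, coef_simpleRoot hn hk hi hi']
      split_ifs with h
      · rw [h, mul_one]
        exact hcon'
      · rw [mul_zero, sub_zero]
        exact hneg' k hk hk') h2
    have h4 : s i = 1 := by simpa using h3
    have h5 := s_self_apply (i := i) (by omega)
    rw [h4] at h5
    rcases lo_cases (i := i) (by omega) with ⟨h6, h7⟩ | ⟨h6, h7⟩ <;> simp at h5 <;> omega

/-! ### Lists, tuples with gaps, and sums of orthogonal simple roots. -/

/-- In `interval`, `oneLine`, `down` and `up` the bound variable is elaborated as an integer, and
the list of naturals is cast inside the list monad. This brings such lists back to a plain `map`. -/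
theorem bind_cast (l : List ℕ) : (do let a ← l; pure (a : ℤ)) = l.map fun a : ℕ => (a : ℤ) :=
  List.map_eq_flatMap.symm

theorem interval_eq (a n : ℕ) :
    interval a n = (List.range (n + 1 - a)).map fun j : ℕ => (a : ℤ) + (j : ℤ) := by
  rw [interval, bind_cast, List.map_map]
  rfl

theorem mem_interval {a n : ℕ} {x : ℤ} : x ∈ interval a n ↔ (a : ℤ) ≤ x ∧ x ≤ n := by
  simp only [interval_eq, List.mem_map, List.mem_range]
  constructor
  · rintro ⟨j, hj, rfl⟩
    omega
  · intro h
    exact ⟨(x - a).toNat, by omega, by omega⟩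

theorem interval_pairwise (a n : ℕ) : (interval a n).Pairwise (· < ·) := by
  rw [interval_eq, List.pairwise_map]
  exact List.pairwise_lt_range.imp fun h => by omega

theorem length_interval (a n : ℕ) : (interval a n).length = n + 1 - a := by
  simp [interval_eq]

theorem J_pairwise {p : ℕ} {a b : ℤ} {l : List ℤ} (hl : l ∈ J p a b) :
    l.Pairwise fun x y => x + 2 ≤ y := by
  have h := hl.2.2
  have : IsTrans ℤ fun x y => x + 2 ≤ y := ⟨fun x y z h1 h2 => by omega⟩
  exact List.isChain_iff_pairwise.1 h

theorem mem_J {p : ℕ} {a b : ℤ} {l : List ℤ} (h1 : l.length = p) (h2 : ∀ x ∈ l, a ≤ x ∧ x ≤ b)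
    (h3 : l.Pairwise fun x y => x + 2 ≤ y) : l ∈ J p a b :=
  ⟨h1, h2, h3.isChain⟩

theorem rootSum_nil (n : ℕ) : rootSum n [] = 0 := rfl

theorem rootSum_cons (n : ℕ) (i : ℤ) (l : List ℤ) :
    rootSum n (i :: l) = simpleRoot n i + rootSum n l := rfl

theorem coef_rootSum {n : ℕ} (hn : 2 ≤ n) {k : ℕ} (hk : 1 ≤ k) {l : List ℤ}
    (hl : ∀ x ∈ l, 1 ≤ x ∧ x ≤ n) : coef (rootSum n l) k = l.count (k : ℤ) := by
  induction l with
  | nil => simp [rootSum_nil, coef_zero]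
  | cons i l ih =>
    have h1 := hl i List.mem_cons_self
    rw [rootSum_cons, coef_add, coef_simpleRoot_int hn hk h1.1 h1.2,
      ih fun x hx => hl x (List.mem_cons_of_mem _ hx), List.count_cons]
    simp only [beq_iff_eq, eq_comm (a := i)]
    split_ifs <;> push_cast <;> ring

/-- The tuple consists of the positions from $a$ on with coefficient $-1$. Since neighbours are
never both $-1$, its gaps are at least 2. -/
theorem exists_list_of_coef {n : ℕ} (hn : 2 ≤ n) {a : ℕ} (ha : 1 ≤ a) {x : E n}
    (hx : ∀ k : ℕ, a ≤ k → coef x k = 0 ∨ (coef x k = -1 ∧ coef x (k + 1) = 0)) :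
    ∃ p, ∃ l ∈ J p a n, ∀ k : ℕ, 1 ≤ k → k ≤ n →
      coef (rootSum n l) k = if a ≤ k then -coef x k else 0 := by
  classical
  let l := (interval a n).filter fun k => coef x k.toNat = -1
  have hmem : ∀ k : ℤ, k ∈ l ↔ ((a : ℤ) ≤ k ∧ k ≤ n) ∧ coef x k.toNat = -1 := by
    intro k
    simp only [l, List.mem_filter, mem_interval, decide_eq_true_eq]
  have hp : l.Pairwise (· < ·) := (interval_pairwise a n).filter _
  have hJ : l ∈ J l.length a n := by
    refine mem_J rfl (fun y hy => ((hmem y).1 hy).1) (hp.imp_of_mem ?_)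
    intro y z hy hz hyz
    rw [hmem] at hy hz
    by_contra hc
    have h1 : z = y + 1 := by omega
    rcases hx y.toNat (by omega) with h | ⟨_, h⟩
    · rw [hy.2] at h
      norm_num at h
    · rw [show y.toNat + 1 = z.toNat by omega, hz.2] at h
      norm_num at h
  refine ⟨l.length, l, hJ, fun k h1 h2 => ?_⟩
  have hnd : l.Nodup := hp.imp fun h => h.ne
  rw [coef_rootSum hn h1 fun y hy => ⟨by have := (hJ.2.1 y hy).1; omega, (hJ.2.1 y hy).2⟩,
    hnd.count]
  simp only [hmem, Int.toNat_natCast]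
  split_ifs with h3 h4 h4
  · rw [h3.2]
    norm_num
  · omega
  · rcases hx k h4 with h | ⟨h, _⟩
    · simp [h]
    · exact absurd ⟨by omega, h⟩ h3
  · simp

theorem dotProduct_simpleRoot {n : ℕ} (y : E n) {i : ℤ} (hi : 1 ≤ i) :
    y ⬝ᵥ simpleRoot n i = coord y i - coord y (lo i) := by
  rw [simpleRoot_eq n hi, dotProduct_sub, coord, coord]

theorem dotProduct_rootSum_eq_zero {n : ℕ} (y : E n) {l : List ℤ}
    (hl : ∀ i ∈ l, 1 ≤ i ∧ coord y i = coord y (lo i)) : y ⬝ᵥ rootSum n l = 0 := by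
  induction l with
  | nil => rw [rootSum_nil, dotProduct_zero]
  | cons i l ih =>
    have h1 := hl i List.mem_cons_self
    rw [rootSum_cons, dotProduct_add, dotProduct_simpleRoot y h1.1, h1.2, sub_self, zero_add,
      ih fun x hx => hl x (List.mem_cons_of_mem _ hx)]

theorem simpleRoot_dotProduct_self {n : ℕ} (hn : 2 ≤ n) {i : ℤ} (hi : 1 ≤ i) (hi' : i ≤ n) :
    simpleRoot n i ⬝ᵥ simpleRoot n i = 2 := by
  have hl := inRange_lo hn hi hi'
  have hI := inRange_of_pos hi hi'
  rw [dotProduct_simpleRoot _ hi, simpleRoot_eq n hi, coord_sub, coord_sub, coord_e_self hI,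
    coord_e_self hl]
  rcases lo_cases hi with ⟨h3, h4⟩ | ⟨h3, h4⟩ <;>
  · rw [coord_e_of_ne hl (by omega) (by omega), coord_e_of_ne hI (by omega) (by omega)]
    norm_num

theorem coord_e_eq_zero {n : ℕ} {a b : ℤ} (hb : 1 ≤ b) (hb' : b ≤ n) (h : a ≠ b) (h' : a ≠ -b) :
    coord (e n a) b = 0 := coord_e_of_ne (inRange_of_pos hb hb') h h'

/-- The gaps make the coordinate pairs $\{i_k-1,i_k\}$ disjoint, so the roots are orthogonal, each
of squared length 2. -/
theorem rootSum_dotProduct_self {n : ℕ} (hn : 2 ≤ n) {p : ℕ} {a : ℕ} (ha : 2 ≤ a) {l : List ℤ}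
    (hl : l ∈ J p a n) : rootSum n l ⬝ᵥ rootSum n l = 2 * p := by
  have h2 := J_pairwise hl
  obtain ⟨h1, h3, -⟩ := hl
  subst h1
  induction l with
  | nil => simp [rootSum_nil]
  | cons i l ih =>
    rw [List.pairwise_cons] at h2
    have hi := h3 i List.mem_cons_self
    have h4 : ∀ x ∈ l, (a : ℤ) ≤ x ∧ x ≤ n := fun x hx => h3 x (List.mem_cons_of_mem _ hx)
    have h5 : simpleRoot n i ⬝ᵥ rootSum n l = 0 := by
      refine dotProduct_rootSum_eq_zero _ fun j hj => ⟨by have := h4 j hj; omega, ?_⟩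
      have h6 := h2.1 j hj
      have h7 := h4 j hj
      rcases lo_cases (show 1 ≤ j by omega) with ⟨h8, h9⟩ | ⟨h8, h9⟩
      · omega
      rcases lo_cases (show 1 ≤ i by omega) with ⟨h10, h11⟩ | ⟨h10, h11⟩
      · omega
      rw [simpleRoot_eq n (by omega), coord_sub, coord_sub, h9, h11]
      rw [coord_e_eq_zero, coord_e_eq_zero, coord_e_eq_zero, coord_e_eq_zero] <;> omega
    rw [rootSum_cons, add_dotProduct, dotProduct_add, dotProduct_add,
      simpleRoot_dotProduct_self hn (by omega) hi.2, h5, dotProduct_comm (rootSum n l), h5,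
      ih h2.2 h4, List.length_cons]
    push_cast
    ring

/-- The norm of `y + Σ α_{i_k}` if `y` is constant on the pairs `i_k, i_k - 1`. -/
theorem add_rootSum_dotProduct_self {n : ℕ} (hn : 2 ≤ n) {p : ℕ} {a : ℕ} (ha : 2 ≤ a) {l : List ℤ}
    (hl : l ∈ J p a n) {y : E n} (hy : ∀ k : ℤ, (a : ℤ) - 1 ≤ k → k ≤ n → coord y k = 0) :
    (y + rootSum n l) ⬝ᵥ (y + rootSum n l) = y ⬝ᵥ y + 2 * p := by
  have h5 : y ⬝ᵥ rootSum n l = 0 := by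
    refine dotProduct_rootSum_eq_zero _ fun j hj => ?_
    have h4 := hl.2.1 j hj
    refine ⟨by omega, ?_⟩
    rcases lo_cases (show 1 ≤ j by omega) with ⟨h8, h9⟩ | ⟨h8, h9⟩
    · omega
    rw [h9, hy _ (by omega) (by omega), hy _ (by omega) (by omega)]
  rw [add_dotProduct, dotProduct_add, dotProduct_add, rootSum_dotProduct_self hn ha hl,
    dotProduct_comm (rootSum n l), h5]
  ring

/-! ### Classification of the top vectors. -/

/-- The parts of a top vector at the nodes `1, 2, 3`. -/
noncomputable def endC (n : ℕ) : E n :=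
  (1 / 2 : ℝ) • simpleRoot n 1 + (1 / 2 : ℝ) • simpleRoot n 2

noncomputable def endD1 (n : ℕ) : E n :=
  (3 / 2 : ℝ) • simpleRoot n 1 + (1 / 2 : ℝ) • simpleRoot n 2 + simpleRoot n 3

noncomputable def endD2 (n : ℕ) : E n :=
  (1 / 2 : ℝ) • simpleRoot n 1 + (3 / 2 : ℝ) • simpleRoot n 2 + simpleRoot n 3

theorem simpleRoot_one (n : ℕ) : simpleRoot n 1 = e n 1 + e n 2 := by
  rw [simpleRoot, if_pos rfl]

theorem simpleRoot_two (n : ℕ) : simpleRoot n 2 = e n 2 - e n 1 := by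
  rw [simpleRoot, if_neg (by norm_num)]
  norm_num

theorem simpleRoot_three (n : ℕ) : simpleRoot n 3 = e n 3 - e n 2 := by
  rw [simpleRoot, if_neg (by norm_num)]
  norm_num

theorem endC_eq (n : ℕ) : endC n = e n 2 := by
  rw [endC, simpleRoot_one, simpleRoot_two]
  module

theorem endD1_eq (n : ℕ) : endD1 n = e n 1 + e n 2 + e n 3 := by
  rw [endD1, simpleRoot_one, simpleRoot_two, simpleRoot_three]
  module

theorem endD2_eq (n : ℕ) : endD2 n = -e n 1 + e n 2 + e n 3 := by
  rw [endD2, simpleRoot_one, simpleRoot_two, simpleRoot_three]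
  module

theorem e_dotProduct {n : ℕ} {a b : ℤ} (ha : 1 ≤ a) (hb : 1 ≤ b) (hb' : b ≤ n) :
    e n a ⬝ᵥ e n b = if a = b then 1 else 0 := by
  have := coord_e (a := a) (inRange_of_pos hb hb')
  rw [coord] at this
  rw [this]
  split_ifs <;> first | rfl | omega

theorem endC_self {n : ℕ} (hn : 3 ≤ n) : endC n ⬝ᵥ endC n = 1 := by
  rw [endC_eq, e_dotProduct] <;> norm_num
  omega

theorem endD1_self {n : ℕ} (hn : 3 ≤ n) : endD1 n ⬝ᵥ endD1 n = 3 := by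
  have h1 : (1 : ℤ) ≤ n := by omega
  have h2 : (2 : ℤ) ≤ n := by omega
  have h3 : (3 : ℤ) ≤ n := by omega
  simp only [endD1_eq, add_dotProduct, dotProduct_add, e_dotProduct (n := n) le_rfl le_rfl h1,
    e_dotProduct (n := n) (show (1 : ℤ) ≤ 2 by norm_num) le_rfl h1,
    e_dotProduct (n := n) (show (1 : ℤ) ≤ 3 by norm_num) le_rfl h1,
    e_dotProduct (n := n) (b := 2) le_rfl (by norm_num) h2,
    e_dotProduct (n := n) (b := 2) (show (1 : ℤ) ≤ 2 by norm_num) (by norm_num) h2,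
    e_dotProduct (n := n) (b := 2) (show (1 : ℤ) ≤ 3 by norm_num) (by norm_num) h2,
    e_dotProduct (n := n) (b := 3) le_rfl (by norm_num) h3,
    e_dotProduct (n := n) (b := 3) (show (1 : ℤ) ≤ 2 by norm_num) (by norm_num) h3,
    e_dotProduct (n := n) (b := 3) (show (1 : ℤ) ≤ 3 by norm_num) (by norm_num) h3]
  norm_num

theorem endD2_self {n : ℕ} (hn : 3 ≤ n) : endD2 n ⬝ᵥ endD2 n = 3 := by
  have h1 : (1 : ℤ) ≤ n := by omega
  have h2 : (2 : ℤ) ≤ n := by omega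
  have h3 : (3 : ℤ) ≤ n := by omega
  simp only [endD2_eq, add_dotProduct, dotProduct_add, neg_dotProduct, dotProduct_neg,
    e_dotProduct (n := n) le_rfl le_rfl h1,
    e_dotProduct (n := n) (show (1 : ℤ) ≤ 2 by norm_num) le_rfl h1,
    e_dotProduct (n := n) (show (1 : ℤ) ≤ 3 by norm_num) le_rfl h1,
    e_dotProduct (n := n) (b := 2) le_rfl (by norm_num) h2,
    e_dotProduct (n := n) (b := 2) (show (1 : ℤ) ≤ 2 by norm_num) (by norm_num) h2,
    e_dotProduct (n := n) (b := 2) (show (1 : ℤ) ≤ 3 by norm_num) (by norm_num) h2,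
    e_dotProduct (n := n) (b := 3) le_rfl (by norm_num) h3,
    e_dotProduct (n := n) (b := 3) (show (1 : ℤ) ≤ 2 by norm_num) (by norm_num) h3,
    e_dotProduct (n := n) (b := 3) (show (1 : ℤ) ≤ 3 by norm_num) (by norm_num) h3]
  norm_num

/-- The weights `Σ α_{i_k}`, `α_1 + Σ α_{i_k}`, `α_2 + Σ α_{i_k}`. -/
def EvenWeight (n m : ℕ) (y : E n) : Prop :=
  (∃ l ∈ J m 3 n, y = rootSum n l) ∨
    ∃ q, q + 1 = m ∧ ∃ l ∈ J q 4 n,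
      y = simpleRoot n 1 + rootSum n l ∨ y = simpleRoot n 2 + rootSum n l

/-- The weights `(α_1 + α_2) / 2 + Σ α_{i_k}` and those with the two larger ends. -/
def OddWeight (n m : ℕ) (y : E n) : Prop :=
  (∃ l ∈ J m 4 n, y = endC n + rootSum n l) ∨
    ∃ q, q + 1 = m ∧ ∃ l ∈ J q 5 n, y = endD1 n + rootSum n l ∨ y = endD2 n + rootSum n l

theorem eq_neg_add_of_coef {n : ℕ} (hn : 3 ≤ n) {a : ℕ} {x y : E n} {l : List ℤ}
    (hl : ∀ k : ℕ, 1 ≤ k → k ≤ n → coef (rootSum n l) k = if a ≤ k then -coef x k else 0)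
    (h : ∀ k : ℕ, 1 ≤ k → k < a → coef x k = -coef y k)
    (h' : ∀ k : ℕ, a ≤ k → k ≤ n → coef y k = 0) : -x = y + rootSum n l := by
  refine eq_of_coef (by omega) fun k h1 h2 => ?_
  rw [coef_neg, coef_add, hl k h1 h2]
  split_ifs with h3
  · rw [h' k h3 h2]
    ring
  · rw [h k h1 (by omega)]
    ring

theorem coef_endC {n : ℕ} (hn : 3 ≤ n) {k : ℕ} (hk : 1 ≤ k) :
    coef (endC n) k = if k ≤ 2 then 1 / 2 else 0 := by
  rw [endC, coef_add, coef_smul, coef_smul, coef_simpleRoot_int (by omega) hk le_rfl (by omega),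
    coef_simpleRoot_int (by omega) hk (by omega) (by omega)]
  split_ifs <;> first | omega | norm_num

theorem coef_endD1 {n : ℕ} (hn : 3 ≤ n) {k : ℕ} (hk : 1 ≤ k) :
    coef (endD1 n) k = if k = 1 then 3 / 2 else if k = 2 then 1 / 2 else
      if k = 3 then 1 else 0 := by
  rw [endD1, coef_add, coef_add, coef_smul, coef_smul,
    coef_simpleRoot_int (by omega) hk le_rfl (by omega),
    coef_simpleRoot_int (by omega) hk (by omega) (by omega),
    coef_simpleRoot_int (by omega) hk (by omega) (by omega)]
  split_ifs <;> first | omega | norm_num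

theorem coef_endD2 {n : ℕ} (hn : 3 ≤ n) {k : ℕ} (hk : 1 ≤ k) :
    coef (endD2 n) k = if k = 1 then 1 / 2 else if k = 2 then 3 / 2 else
      if k = 3 then 1 else 0 := by
  rw [endD2, coef_add, coef_add, coef_smul, coef_smul,
    coef_simpleRoot_int (by omega) hk le_rfl (by omega),
    coef_simpleRoot_int (by omega) hk (by omega) (by omega),
    coef_simpleRoot_int (by omega) hk (by omega) (by omega)]
  split_ifs <;> first | omega | norm_num

/-- Every $\alpha_{i_k}$ contributes 2 to the squared length. An ending with integral coefficients
contributes 0 or 2, one with half-integral coefficients 1 or 3. The tuple starts at 3, 4 or 5, just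
after the last node at which the ending fixes a coefficient. -/
theorem IsTop.classify {n : ℕ} (hn : 3 ≤ n) {x : E n} (hx : IsTop x) :
    (∃ m : ℕ, x ⬝ᵥ x = 2 * m ∧ EvenWeight n m (-x)) ∨
      (∃ m : ℕ, x ⬝ᵥ x = 2 * m + 1 ∧ OddWeight n m (-x)) := by
  have hn2 : 2 ≤ n := by omega
  have hgood := fun k (hk : 3 ≤ k) => hx.coef_of_three_le hn hk
  have hnorm : x ⬝ᵥ x = (-x) ⬝ᵥ (-x) := by rw [neg_dotProduct, dotProduct_neg, neg_neg]
  have hlow : ∀ k : ℕ, 1 ≤ k → k < 4 → k = 1 ∨ k = 2 ∨ k = 3 := by omega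
  have hlow' : ∀ k : ℕ, 1 ≤ k → k < 5 → k = 1 ∨ k = 2 ∨ k = 3 ∨ k = 4 := by omega
  rcases hx.end_cases hn with ⟨h1, h2⟩ | ⟨h1, h2, h3⟩ | ⟨h1, h2, h3⟩ | ⟨h1, h2, h3⟩ |
    ⟨h1, h2, h3, h4⟩ | ⟨h1, h2, h3, h4⟩
  · left
    obtain ⟨p, l, hl, hc⟩ := exists_list_of_coef hn2 (a := 3) (by omega) hgood
    have h : -x = 0 + rootSum n l := by
      refine eq_neg_add_of_coef hn hc ?_ fun k _ _ => coef_zero k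
      intro k hk hk'
      rw [coef_zero, neg_zero]
      obtain rfl | rfl : k = 1 ∨ k = 2 := by omega
      · exact h1
      · exact h2
    rw [zero_add] at h
    exact ⟨p, by rw [hnorm, h, rootSum_dotProduct_self hn2 (by omega) hl], Or.inl ⟨l, hl, h⟩⟩
  · left
    obtain ⟨p, l, hl, hc⟩ := exists_list_of_coef hn2 (a := 4) (by omega)
      fun k hk => hgood k (by omega)
    have hcr := fun {k : ℕ} (hk : 1 ≤ k) => coef_simpleRoot_int hn2 hk le_rfl
      (show (1 : ℤ) ≤ n by omega)
    have h : -x = simpleRoot n 1 + rootSum n l := by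
      refine eq_neg_add_of_coef hn hc ?_ ?_
      · intro k hk hk'
        rw [hcr hk]
        obtain rfl | rfl | rfl := hlow k hk hk' <;> simp [h1, h2, h3]
      · intro k hk _
        rw [hcr (by omega), if_neg (by omega)]
    refine ⟨p + 1, ?_, Or.inr ⟨p, rfl, l, hl, Or.inl h⟩⟩
    rw [hnorm, h, add_rootSum_dotProduct_self hn2 (by omega) hl,
      simpleRoot_dotProduct_self hn2 le_rfl (by omega)]
    · push_cast
      ring
    · intro k hk hk'
      rw [simpleRoot_one, coord_add, coord_e_eq_zero, coord_e_eq_zero] <;> first | omega | norm_num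
  · left
    obtain ⟨p, l, hl, hc⟩ := exists_list_of_coef hn2 (a := 4) (by omega)
      fun k hk => hgood k (by omega)
    have hcr := fun {k : ℕ} (hk : 1 ≤ k) => coef_simpleRoot_int hn2 hk
      (show (1 : ℤ) ≤ 2 by omega) (show (2 : ℤ) ≤ n by omega)
    have h : -x = simpleRoot n 2 + rootSum n l := by
      refine eq_neg_add_of_coef hn hc ?_ ?_
      · intro k hk hk'
        rw [hcr hk]
        obtain rfl | rfl | rfl := hlow k hk hk' <;> simp [h1, h2, h3]
      · intro k hk _
        rw [hcr (by omega), if_neg (by omega)]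
    refine ⟨p + 1, ?_, Or.inr ⟨p, rfl, l, hl, Or.inr h⟩⟩
    rw [hnorm, h, add_rootSum_dotProduct_self hn2 (by omega) hl,
      simpleRoot_dotProduct_self hn2 (by omega) (by omega)]
    · push_cast
      ring
    · intro k hk hk'
      rw [simpleRoot_two, coord_sub, coord_e_eq_zero, coord_e_eq_zero] <;> first | omega | norm_num
  · right
    obtain ⟨p, l, hl, hc⟩ := exists_list_of_coef hn2 (a := 4) (by omega)
      fun k hk => hgood k (by omega)
    have h : -x = endC n + rootSum n l := by
      refine eq_neg_add_of_coef hn hc ?_ ?_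
      · intro k hk hk'
        rw [coef_endC hn hk]
        obtain rfl | rfl | rfl := hlow k hk hk' <;> norm_num [h1, h2, h3]
      · intro k hk _
        rw [coef_endC hn (by omega), if_neg (by omega)]
    refine ⟨p, ?_, Or.inl ⟨l, hl, h⟩⟩
    rw [hnorm, h, add_rootSum_dotProduct_self hn2 (by omega) hl, endC_self hn]
    · ring
    · intro k hk hk'
      rw [endC_eq, coord_e_eq_zero] <;> omega
  · right
    obtain ⟨p, l, hl, hc⟩ := exists_list_of_coef hn2 (a := 5) (by omega)
      fun k hk => hgood k (by omega)
    have h : -x = endD1 n + rootSum n l := by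
      refine eq_neg_add_of_coef hn hc ?_ ?_
      · intro k hk hk'
        rw [coef_endD1 hn hk]
        obtain rfl | rfl | rfl | rfl := hlow' k hk hk' <;> norm_num [h1, h2, h3, h4]
      · intro k hk _
        rw [coef_endD1 hn (by omega), if_neg (by omega), if_neg (by omega), if_neg (by omega)]
    refine ⟨p + 1, ?_, Or.inr ⟨p, rfl, l, hl, Or.inl h⟩⟩
    rw [hnorm, h, add_rootSum_dotProduct_self hn2 (by omega) hl, endD1_self hn]
    · push_cast
      ring
    · intro k hk hk'
      rw [endD1_eq, coord_add, coord_add, coord_e_eq_zero, coord_e_eq_zero, coord_e_eq_zero] <;>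
        first | omega | norm_num
  · right
    obtain ⟨p, l, hl, hc⟩ := exists_list_of_coef hn2 (a := 5) (by omega)
      fun k hk => hgood k (by omega)
    have h : -x = endD2 n + rootSum n l := by
      refine eq_neg_add_of_coef hn hc ?_ ?_
      · intro k hk hk'
        rw [coef_endD2 hn hk]
        obtain rfl | rfl | rfl | rfl := hlow' k hk hk' <;> norm_num [h1, h2, h3, h4]
      · intro k hk _
        rw [coef_endD2 hn (by omega), if_neg (by omega), if_neg (by omega), if_neg (by omega)]
    refine ⟨p + 1, ?_, Or.inr ⟨p, rfl, l, hl, Or.inr h⟩⟩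
    rw [hnorm, h, add_rootSum_dotProduct_self hn2 (by omega) hl, endD2_self hn]
    · push_cast
      ring
    · intro k hk hk'
      rw [endD2_eq, coord_add, coord_add, coord_neg, coord_e_eq_zero, coord_e_eq_zero,
        coord_e_eq_zero] <;> first | omega | norm_num

theorem IsTop.evenWeight {n m : ℕ} (hn : 3 ≤ n) {x : E n} (hx : IsTop x)
    (h : x ⬝ᵥ x = (2 * m : ℕ)) : EvenWeight n m (-x) := by
  rcases hx.classify hn with ⟨q, h1, h2⟩ | ⟨q, h1, h2⟩
  · rw [h] at h1
    have : 2 * m = 2 * q := by exact_mod_cast h1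
    rwa [show m = q by omega]
  · rw [h] at h1
    have : 2 * m = 2 * q + 1 := by exact_mod_cast h1
    omega

theorem IsTop.oddWeight {n m : ℕ} (hn : 3 ≤ n) {x : E n} (hx : IsTop x)
    (h : x ⬝ᵥ x = (2 * m + 1 : ℕ)) : OddWeight n m (-x) := by
  rcases hx.classify hn with ⟨q, h1, h2⟩ | ⟨q, h1, h2⟩
  · rw [h] at h1
    have : 2 * m + 1 = 2 * q := by exact_mod_cast h1
    omega
  · rw [h] at h1
    have : 2 * m + 1 = 2 * q + 1 := by exact_mod_cast h1
    rwa [show m = q by omega]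

/-! ### Heights, and incomparability within a family. -/

/-- The sum of the coefficients of `α_a, …, α_n`. -/
noncomputable def height {n : ℕ} (a : ℕ) (x : E n) : ℝ := ∑ k ∈ Finset.Icc a n, coef x k

theorem height_add {n : ℕ} (a : ℕ) (x y : E n) : height a (x + y) = height a x + height a y := by
  simp only [height, coef_add, Finset.sum_add_distrib]

theorem height_sub {n : ℕ} (a : ℕ) (x y : E n) : height a (x - y) = height a x - height a y := by
  simp only [height, coef_sub, Finset.sum_sub_distrib]

theorem height_smul {n : ℕ} (a : ℕ) (t : ℝ) (x : E n) : height a (t • x) = t * height a x := by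
  simp only [height, coef_smul, Finset.mul_sum]

theorem height_simpleRoot {n : ℕ} (hn : 2 ≤ n) {a : ℕ} (ha : 1 ≤ a) {i : ℤ} (hi : 1 ≤ i)
    (hi' : i ≤ n) : height a (simpleRoot n i) = if (a : ℤ) ≤ i then 1 else 0 := by
  lift i to ℕ using by omega
  have : ∀ k ∈ Finset.Icc a n, coef (simpleRoot n (i : ℤ)) k = if k = i then 1 else 0 := by
    intro k hk
    rw [Finset.mem_Icc] at hk
    exact coef_simpleRoot hn (by omega) (by omega) (by omega)
  rw [height, Finset.sum_congr rfl this, Finset.sum_ite_eq']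
  simp only [Finset.mem_Icc]
  split_ifs <;> first | rfl | omega

theorem height_rootSum {n : ℕ} (hn : 2 ≤ n) {a : ℕ} (ha : 1 ≤ a) {p : ℕ} {b : ℤ} (hb : a ≤ b)
    {l : List ℤ} (hl : l ∈ J p b n) : height a (rootSum n l) = p := by
  obtain ⟨h1, h2, -⟩ := hl
  subst h1
  induction l with
  | nil => simp [rootSum_nil, height, coef_zero]
  | cons i l ih =>
    have hi := h2 i List.mem_cons_self
    rw [rootSum_cons, height_add, height_simpleRoot hn ha (by omega) hi.2, if_pos (by omega),
      ih fun x hx => h2 x (List.mem_cons_of_mem _ hx), List.length_cons]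
    push_cast
    ring

theorem height_nonneg {n : ℕ} (hn : 2 ≤ n) {a : ℕ} (ha : 1 ≤ a) {x : E n} (hx : RootNonneg n x) :
    0 ≤ height a x := by
  rw [rootNonneg_iff hn] at hx
  refine Finset.sum_nonneg fun k hk => ?_
  rw [Finset.mem_Icc] at hk
  exact hx k (by omega) hk.2

theorem eq_of_height_eq {n : ℕ} (hn : 2 ≤ n) {x y : E n} (hx : RootNonneg n (x - y))
    (h : height 1 x = height 1 y) : x = y := by
  rw [rootNonneg_iff hn] at hx
  have h1 : ∑ k ∈ Finset.Icc 1 n, coef (x - y) k = 0 := by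
    have := height_sub 1 x y
    rw [h, sub_self] at this
    exact this
  rw [Finset.sum_eq_zero_iff_of_nonneg] at h1
  · refine eq_of_coef hn fun k hk hk' => ?_
    have := h1 k (Finset.mem_Icc.2 ⟨hk, hk'⟩)
    rw [coef_sub] at this
    linarith
  · intro k hk
    rw [Finset.mem_Icc] at hk
    exact hx k hk.1 hk.2

theorem EvenWeight.height_eq {n m : ℕ} (hn : 3 ≤ n) {y : E n} (hy : EvenWeight n m y) :
    height 1 y = m := by
  have hn2 : 2 ≤ n := by omega
  rcases hy with ⟨l, hl, rfl⟩ | ⟨q, rfl, l, hl, rfl | rfl⟩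
  · exact height_rootSum hn2 le_rfl (by norm_num) hl
  · rw [height_add, height_rootSum hn2 le_rfl (by norm_num) hl,
      height_simpleRoot hn2 le_rfl (by norm_num) (by omega)]
    push_cast
    ring
  · rw [height_add, height_rootSum hn2 le_rfl (by norm_num) hl,
      height_simpleRoot hn2 le_rfl (by norm_num) (by omega)]
    push_cast
    ring

theorem EvenWeight.antichain {n m : ℕ} (hn : 3 ≤ n) {x y : E n} (hx : EvenWeight n m x)
    (hy : EvenWeight n m y) (h : RootNonneg n (x - y)) : x = y :=
  eq_of_height_eq (by omega) h ((hx.height_eq hn).trans (hy.height_eq hn).symm)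

theorem OddWeight.height_eq {n m : ℕ} (hn : 3 ≤ n) {y : E n} (hy : OddWeight n m y) :
    (height 1 y = m + 1 ∧ height 4 y = m) ∨ (height 1 y = m + 2 ∧ height 4 y = m - 1) := by
  have hn2 : 2 ≤ n := by omega
  have h1 : ∀ i : ℤ, 1 ≤ i → i ≤ 3 → height 1 (simpleRoot n i) = 1 := by
    intro i hi hi'
    rw [height_simpleRoot hn2 le_rfl hi (by omega), if_pos (by exact_mod_cast hi)]
  have h4 : ∀ i : ℤ, 1 ≤ i → i ≤ 3 → height 4 (simpleRoot n i) = 0 := by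
    intro i hi hi'
    rw [height_simpleRoot hn2 (by norm_num) hi (by omega), if_neg (by push_cast; omega)]
  rcases hy with ⟨l, hl, rfl⟩ | ⟨q, rfl, l, hl, rfl | rfl⟩
  · left
    simp only [endC, height_add, height_smul, height_rootSum hn2 le_rfl (by norm_num) hl,
      height_rootSum hn2 (a := 4) (by norm_num) (by norm_num) hl, h1 1 le_rfl (by norm_num),
      h1 2 (by norm_num) (by norm_num), h4 1 le_rfl (by norm_num),
      h4 2 (by norm_num) (by norm_num)]
    constructor <;> ring
  · right
    simp only [endD1, height_add, height_smul, height_rootSum hn2 le_rfl (by norm_num) hl,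
      height_rootSum hn2 (a := 4) (by norm_num) (by norm_num) hl, h1 1 le_rfl (by norm_num),
      h1 2 (by norm_num) (by norm_num), h1 3 (by norm_num) le_rfl, h4 1 le_rfl (by norm_num),
      h4 2 (by norm_num) (by norm_num), h4 3 (by norm_num) le_rfl]
    push_cast
    constructor <;> ring
  · right
    simp only [endD2, height_add, height_smul, height_rootSum hn2 le_rfl (by norm_num) hl,
      height_rootSum hn2 (a := 4) (by norm_num) (by norm_num) hl, h1 1 le_rfl (by norm_num),
      h1 2 (by norm_num) (by norm_num), h1 3 (by norm_num) le_rfl, h4 1 le_rfl (by norm_num),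
      h4 2 (by norm_num) (by norm_num), h4 3 (by norm_num) le_rfl]
    push_cast
    constructor <;> ring

/-- Within one kind the total heights agree. Across the two kinds the total height and the height
from node 4 on are ordered in opposite ways, so neither vector dominates the other. -/
theorem OddWeight.antichain {n m : ℕ} (hn : 3 ≤ n) {x y : E n} (hx : OddWeight n m x)
    (hy : OddWeight n m y) (h : RootNonneg n (x - y)) : x = y := by
  have h1 := height_nonneg (by omega) (a := 1) le_rfl h
  have h4 := height_nonneg (by omega) (a := 4) (by norm_num) h
  rw [height_sub] at h1 h4
  rcases hx.height_eq hn with ⟨h5, h6⟩ | ⟨h5, h6⟩ <;>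
    rcases hy.height_eq hn with ⟨h7, h8⟩ | ⟨h7, h8⟩
  · exact eq_of_height_eq (by omega) h (by rw [h5, h7])
  · linarith
  · linarith
  · exact eq_of_height_eq (by omega) h (by rw [h5, h7])

/-! ### Group elements from one-line notation. -/

theorem oneLine_eq (n : ℕ) (w : Equiv.Perm ℤ) :
    oneLine n w = (List.range n).map fun j : ℕ => w ((j : ℤ) + 1) := by
  rw [oneLine, bind_cast, List.map_map]
  rfl

theorem length_oneLine (n : ℕ) (w : Equiv.Perm ℤ) : (oneLine n w).length = n := by
  simp [oneLine_eq]

theorem oneLine_mul (n : ℕ) (g w : Equiv.Perm ℤ) :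
    oneLine n (g * w) = (oneLine n w).map g := by
  rw [oneLine_eq, oneLine_eq, List.map_map]
  rfl

theorem oneLine_getElem {n : ℕ} {w : Equiv.Perm ℤ} {L : List ℤ} (h : oneLine n w = L) {j : ℕ}
    (hj : j < L.length) : L[j] = w ((j : ℤ) + 1) := by
  subst h
  simp [oneLine_eq]

theorem prod_Icc_eq_list {M : Type*} [CommMonoid M] (n : ℕ) (f : ℤ → M) :
    ∏ k ∈ Finset.Icc (1 : ℤ) n, f k = ((List.range n).map fun j : ℕ => f ((j : ℤ) + 1)).prod := by
  induction n with
  | zero => simp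
  | succ n ih =>
    have : Finset.Icc (1 : ℤ) ((n + 1 : ℕ) : ℤ) = insert ((n : ℤ) + 1) (Finset.Icc (1 : ℤ) n) := by
      ext k
      simp only [Finset.mem_Icc, Finset.mem_insert]
      omega
    rw [this, Finset.prod_insert (by simp), ih, List.range_succ, List.map_append, List.prod_append,
      mul_comm]
    simp

theorem sum_range_eq_list {M : Type*} [AddCommMonoid M] (n : ℕ) (f : ℕ → M) :
    ∑ j ∈ Finset.range n, f j = ((List.range n).map f).sum := by
  induction n with
  | zero => simp
  | succ n ih => rw [Finset.sum_range_succ, ih, List.range_succ, List.map_append]; simp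

/-- One-line notations of the elements of the Weyl group. -/
theorem exists_oneLine {n : ℕ} (hn : 2 ≤ n) {L : List ℤ}
    (hL : (L.map fun x => |x|).Perm (interval 1 n)) (hs : (L.map Int.sign).prod = 1) :
    ∃ w ∈ weylGroup n, oneLine n w = L := by
  have hlen : L.length = n := by
    have := hL.length_eq
    rw [List.length_map, length_interval] at this
    omega
  -- The list is indexed from 0 and the permutation from 1; the default 0 is never reached for $1\le
  -- k\le n$.
  let g : ℤ → ℤ := fun k => L.getD (k - 1).toNat 0
  have hg : ∀ k : ℤ, 1 ≤ k → k ≤ n → 1 ≤ |g k| ∧ |g k| ≤ n := by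
    intro k h1 h2
    have h3 : (k - 1).toNat < L.length := by omega
    have h4 : g k = L[(k - 1).toNat] := List.getD_eq_getElem _ _ h3
    have : |g k| ∈ L.map fun x => |x| := List.mem_map.2 ⟨g k, h4 ▸ List.getElem_mem h3, rfl⟩
    simpa [mem_interval] using hL.mem_iff.1 this
  have hginj : ∀ k k' : ℤ, 1 ≤ k → k ≤ n → 1 ≤ k' → k' ≤ n → |g k| = |g k'| → k = k' := by
    intro k k' h1 h2 h1' h2' h
    have h3 : (k - 1).toNat < L.length := by omega
    have h3' : (k' - 1).toNat < L.length := by omega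
    have h4 : g k = L[(k - 1).toNat] := List.getD_eq_getElem _ _ h3
    have h4' : g k' = L[(k' - 1).toNat] := List.getD_eq_getElem _ _ h3'
    have hnd : (L.map fun x => |x|).Nodup :=
      hL.nodup_iff.2 ((interval_pairwise 1 n).imp fun h => h.ne)
    have h5 : (L.map fun x => |x|)[(k - 1).toNat]'(by simpa using h3)
        = (L.map fun x => |x|)[(k' - 1).toNat]'(by simpa using h3') := by
      simp only [List.getElem_map, ← h4, ← h4', h]
    have := (hnd.getElem_inj_iff).1 h5
    omega
  let f : ℤ → ℤ := fun k => if 1 ≤ k ∧ k ≤ n then g k else if -(n : ℤ) ≤ k ∧ k ≤ -1 then -g (-k)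
    else k
  have hf1 : ∀ k : ℤ, 1 ≤ k → k ≤ n → f k = g k := fun k h1 h2 => if_pos ⟨h1, h2⟩
  have hf2 : ∀ k : ℤ, 1 ≤ k → k ≤ n → f (-k) = -g k := by
    intro k h1 h2
    simp only [f]
    rw [if_neg (by omega), if_pos (by omega), neg_neg]
  have hf0 : f 0 = 0 := by
    simp only [f]
    rw [if_neg (by omega), if_neg (by omega)]
  have hf3 : ∀ k : ℤ, k < -n ∨ (n : ℤ) < k → f k = k := by
    intro k h
    simp only [f]
    rw [if_neg (by omega), if_neg (by omega)]
  have hcases : ∀ k : ℤ, k = 0 ∨ (k < -n ∨ (n : ℤ) < k) ∨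
      ∃ j : ℤ, (1 ≤ j ∧ j ≤ n) ∧ (k = j ∨ k = -j) := by
    intro k
    by_cases h0 : k = 0
    · exact Or.inl h0
    · by_cases h1 : k < -n ∨ (n : ℤ) < k
      · exact Or.inr (Or.inl h1)
      · rcases lt_or_gt_of_ne h0 with h | h
        · exact Or.inr (Or.inr ⟨-k, by omega, by omega⟩)
        · exact Or.inr (Or.inr ⟨k, by omega, by omega⟩)
  have habs : ∀ j k : ℤ, 1 ≤ j → j ≤ n → (k = j ∨ k = -j) → |f k| = |g j| := by
    rintro j k h1 h2 (rfl | rfl)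
    · rw [hf1 k h1 h2]
    · rw [hf2 j h1 h2, abs_neg]
  have hfneg : ∀ k, f (-k) = -f k := by
    intro k
    rcases hcases k with rfl | h | ⟨j, ⟨h1, h2⟩, rfl | rfl⟩
    · simp [hf0]
    · rw [hf3 k h, hf3 (-k) (by omega)]
    · rw [hf2 _ h1 h2, hf1 _ h1 h2]
    · rw [hf2 _ h1 h2, neg_neg, neg_neg, hf1 _ h1 h2]
  have habs' : ∀ j k : ℤ, 1 ≤ j → j ≤ n → (k = j ∨ k = -j) → f k ≠ 0 ∧ -(n : ℤ) ≤ f k ∧ f k ≤ n := by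
    intro j k h1 h2 h3
    have h4 := habs j k h1 h2 h3
    obtain ⟨h5, h6⟩ := hg j h1 h2
    rw [← h4] at h5 h6
    refine ⟨?_, (abs_le.1 h6).1, (abs_le.1 h6).2⟩
    intro h
    rw [h] at h5
    norm_num at h5
  have hinj : Function.Injective f := by
    intro k k' h
    rcases hcases k with rfl | hk | ⟨j, ⟨h1, h2⟩, hj⟩ <;>
      rcases hcases k' with rfl | hk' | ⟨j', ⟨h1', h2'⟩, hj'⟩
    · rfl
    · rw [hf0, hf3 k' hk'] at h
      exact h
    · exact absurd (h.symm.trans hf0) (habs' j' k' h1' h2' hj').1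
    · rw [hf0, hf3 k hk] at h
      exact h
    · rwa [hf3 k hk, hf3 k' hk'] at h
    · have := habs' j' k' h1' h2' hj'
      rw [← h, hf3 k hk] at this
      omega
    · exact absurd (h.trans hf0) (habs' j k h1 h2 hj).1
    · have := habs' j k h1 h2 hj
      rw [h, hf3 k' hk'] at this
      omega
    · have h3 : j = j' := hginj j j' h1 h2 h1' h2' (by
        rw [← habs j k h1 h2 hj, ← habs j' k' h1' h2' hj', h])
      subst h3
      have h4 := (habs' j k h1 h2 hj).1
      rcases hj with rfl | rfl <;> rcases hj' with rfl | rfl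
      · rfl
      · rw [hfneg] at h
        omega
      · rw [hfneg] at h
        rw [hfneg] at h4
        omega
      · rfl
  have hsurj : Function.Surjective f := by
    intro y
    by_cases hy : y < -n ∨ (n : ℤ) < y
    · exact ⟨y, hf3 y hy⟩
    -- An injective self-map of the finite set $[-n,n]$ is onto; outside it $f$ is the identity.
    · have hmaps : ∀ k ∈ Finset.Icc (-(n : ℤ)) n, f k ∈ Finset.Icc (-(n : ℤ)) n := by
        intro k hk
        rw [Finset.mem_Icc] at hk ⊢
        rcases hcases k with rfl | h | ⟨j, ⟨h1, h2⟩, hj⟩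
        · rw [hf0]
          omega
        · omega
        · exact (habs' j k h1 h2 hj).2
      obtain ⟨k, -, hk⟩ := Finset.surjOn_of_injOn_of_card_le f hmaps hinj.injOn le_rfl
        (Finset.mem_coe.2 (Finset.mem_Icc.2 ⟨by omega, by omega⟩) : y ∈ _)
      exact ⟨k, hk⟩
  let w : Equiv.Perm ℤ := Equiv.ofBijective f ⟨hinj, hsurj⟩
  have hw : ∀ k, w k = f k := fun k => rfl
  have hline : oneLine n w = L := by
    rw [oneLine_eq]
    refine List.ext_getElem (by simp [hlen]) fun j h1 h2 => ?_
    rw [List.getElem_map, List.getElem_range, hw, hf1 _ (by omega) (by omega)]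
    simp only [g, add_sub_cancel_right, Int.toNat_natCast]
    exact List.getD_eq_getElem _ _ h2
  refine ⟨w, mem_weylGroup hn ⟨hfneg, hf3⟩ ?_, hline⟩
  refine Eq.trans ?_ hs
  rw [prod_Icc_eq_list n fun k => (w k).sign, ← hline, oneLine_eq, List.map_map]
  rfl

/-- Membership in `W^{I_r}`, `r ≥ 3`, read off from the one-line notation. -/
theorem mem_minReps_of_oneLine {n r : ℕ} (hn : 2 ≤ n) (hr : 3 ≤ r) {w : Equiv.Perm ℤ}
    (hw : w ∈ weylGroup n) {A B : List ℤ} (hline : oneLine n w = A ++ B) (hA : A.length + 1 = r)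
    (hA' : A.Pairwise fun x y => |x| < y) (hB : B.Pairwise (· < ·)) : w ∈ minReps n r := by
  have hlen : A.length + B.length = n := by
    rw [← List.length_append, ← hline, length_oneLine]
  have hget : ∀ j (h : j < (A ++ B).length), (A ++ B)[j] = w ((j : ℤ) + 1) :=
    fun j h => oneLine_getElem hline h
  have hgetA : ∀ j (h : j < A.length), A[j] = w ((j : ℤ) + 1) := by
    intro j h
    rw [← hget j (by simp; omega), List.getElem_append_left h]
  have hgetB : ∀ j (h : j < B.length), B[j] = w ((A.length : ℤ) + j + 1) := by
    intro j h
    have := hget (A.length + j) (by simp; omega)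
    rw [List.getElem_append_right (by omega)] at this
    push_cast at this
    rw [← this]
    congr 1
    omega
  rw [List.pairwise_iff_getElem] at hA' hB
  rw [mem_minReps_iff hn]
  refine ⟨hw, fun i hi hi' hir => ?_⟩
  rcases lo_cases hi with ⟨h1, h2⟩ | ⟨h1, h2⟩
  -- Since $r\ge3$, the first two entries lie in `A`, and $|w(1)|<w(2)$ is what the special node
  -- requires.
  · rw [h1, show lo 1 = -2 from rfl, (isSigned_of_mem hn hw).1]
    have := hA' 0 1 (by omega) (by omega) (by norm_num)
    rw [hgetA, hgetA] at this
    norm_num at this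
    have h3 := neg_abs_le (w 1)
    omega
  · rw [h2]
    rcases lt_or_gt_of_ne hir with h3 | h3
    · have := hA' (i - 2).toNat (i - 1).toNat (by omega) (by omega) (by omega)
      rw [hgetA, hgetA, show ((i - 2).toNat : ℤ) + 1 = i - 1 by omega,
        show ((i - 1).toNat : ℤ) + 1 = i by omega] at this
      exact (le_abs_self _).trans_lt this
    · have := hB (i - 1 - r).toNat (i - r).toNat (by omega) (by omega) (by omega)
      rw [hgetB, hgetB, show (A.length : ℤ) + ((i - 1 - r).toNat : ℤ) + 1 = i - 1 by omega,
        show (A.length : ℤ) + ((i - r).toNat : ℤ) + 1 = i by omega] at this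
      exact this

theorem act_fundWeight_of_oneLine {n r : ℕ} (hr : 3 ≤ r) {w : Equiv.Perm ℤ} {A B : List ℤ}
    (hline : oneLine n w = A ++ B) (hA : A.length + 1 = r) :
    act n w (fundWeight n r) = (B.map (e n)).sum := by
  have hlen : A.length + B.length = n := by
    rw [← List.length_append, ← hline, length_oneLine]
  have hB : B = (List.range B.length).map fun j : ℕ => w ((A.length + j : ℕ) + 1) := by
    refine List.ext_getElem (by simp) fun j h1 h2 => ?_
    have := oneLine_getElem hline (j := A.length + j) (by simp; omega)
    rw [List.getElem_append_right (by omega)] at this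
    rw [List.getElem_map, List.getElem_range, ← this]
    congr 1
    omega
  have hsum : act n w (fundWeight n r)
      = ∑ j ∈ Finset.range n, (if r ≤ j + 1 then (1 : ℝ) else 0) • e n (w ((j : ℤ) + 1)) := by
    rw [act, ← Fin.sum_univ_eq_sum_range
      (fun j : ℕ => (if r ≤ j + 1 then (1 : ℝ) else 0) • e n (w ((j : ℤ) + 1)))]
    refine Finset.sum_congr rfl fun j _ => ?_
    simp only [fundWeight, if_neg (show r ≠ 1 by omega), if_neg (show r ≠ 2 by omega)]
  rw [hsum, ← hlen, Finset.sum_range_add, Finset.sum_eq_zero, zero_add, hB, List.map_map,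
    List.length_map, List.length_range, sum_range_eq_list]
  · congr 1
    refine List.map_congr_left fun j hj => ?_
    rw [if_pos (by omega), one_smul]
    rfl
  · intro j hj
    rw [Finset.mem_range] at hj
    rw [if_neg (by omega), zero_smul]

theorem word_mem {n p : ℕ} {a : ℤ} (ha : 1 ≤ a) {l : List ℤ} (hl : l ∈ J p a n) :
    word l ∈ weylGroup n := by
  refine Subgroup.list_prod_mem _ fun t ht => ?_
  obtain ⟨j, hj, rfl⟩ := List.mem_map.1 ht
  have := hl.2.1 j hj
  exact s_mem (by omega) this.2

theorem mem_pred {l : List ℤ} {y : ℤ} : y ∈ pred l ↔ y + 1 ∈ l := by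
  simp only [pred, List.mem_map]
  constructor
  · rintro ⟨x, hx, rfl⟩
    simpa using hx
  · intro h
    exact ⟨y + 1, h, by ring⟩

theorem mem_neg {l : List ℤ} {y : ℤ} : y ∈ neg l ↔ -y ∈ l := by
  simp only [neg, List.mem_reverse, List.mem_map]
  constructor
  · rintro ⟨x, hx, rfl⟩
    simpa using hx
  · intro h
    exact ⟨-y, h, by ring⟩

/-- The transpositions in the word have disjoint supports because of the gaps, so they act
independently. -/
theorem word_apply {l : List ℤ} (hl : ∀ x ∈ l, 2 ≤ x) (hp : l.Pairwise fun x y => x + 2 ≤ y) :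
    (∀ y ∈ l, word l y = y - 1 ∧ word l (y - 1) = y) ∧
      ∀ y, y ∉ l → y ∉ pred l → -y ∉ l → -y ∉ pred l → word l y = y := by
  induction l with
  | nil => exact ⟨by simp, fun y _ _ _ _ => rfl⟩
  | cons i l ih =>
    rw [List.pairwise_cons] at hp
    have hi := hl i List.mem_cons_self
    have hl' : ∀ x ∈ l, 2 ≤ x := fun x hx => hl x (List.mem_cons_of_mem _ hx)
    obtain ⟨ih1, ih2⟩ := ih hl' hp.2
    have hw : ∀ y, word (i :: l) y = s i (word l y) := fun y => rfl
    have hlo : lo i = i - 1 := by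
      rcases lo_cases (show 1 ≤ i by omega) with ⟨h1, h2⟩ | ⟨h1, h2⟩ <;> omega
    have hfix : ∀ y, y ≠ i → y ≠ i - 1 → y ≠ -i → y ≠ -(i - 1) → s i y = y := by
      intro y h1 h2 h3 h4
      rw [s_apply (by omega), hlo, if_neg h1, if_neg h2, if_neg h3, if_neg h4]
    have hi1 : word l i = i := by
      refine ih2 i ?_ ?_ ?_ ?_
      · intro h; have := hp.1 _ h; omega
      · intro h; have := hp.1 _ (mem_pred.1 h); omega
      · intro h; have := hp.1 _ h; omega
      · intro h; have := hp.1 _ (mem_pred.1 h); omega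
    have hi2 : word l (i - 1) = i - 1 := by
      refine ih2 (i - 1) ?_ ?_ ?_ ?_
      · intro h; have := hp.1 _ h; omega
      · intro h; have := hp.1 _ (mem_pred.1 h); omega
      · intro h; have := hp.1 _ h; omega
      · intro h; have := hp.1 _ (mem_pred.1 h); omega
    constructor
    · intro y hy
      rw [hw, hw]
      rcases List.mem_cons.1 hy with rfl | hy
      · rw [hi1, hi2, s_self_apply (by omega), hlo]
        refine ⟨rfl, ?_⟩
        have := s_lo_apply (i := y) (by omega)
        rwa [hlo] at this
      · have h1 := hp.1 y hy
        obtain ⟨h2, h3⟩ := ih1 y hy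
        rw [h2, h3]
        exact ⟨hfix _ (by omega) (by omega) (by omega) (by omega),
          hfix _ (by omega) (by omega) (by omega) (by omega)⟩
    · intro y h1 h2 h3 h4
      rw [mem_pred] at h2 h4
      simp only [List.mem_cons, not_or] at h1 h2 h3 h4
      rw [hw, ih2 y h1.2 (by rw [mem_pred]; exact h2.2) h3.2 (by rw [mem_pred]; exact h4.2)]
      exact hfix y h1.1 (by omega) (by omega) (by omega)

theorem mem_rest {a n : ℕ} {l : List ℤ} {y : ℤ} :
    y ∈ rest a n l ↔ ((a : ℤ) ≤ y ∧ y ≤ n) ∧ y ∉ l ∧ y ∉ pred l := by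
  simp only [rest, List.mem_filter, mem_interval, decide_eq_true_eq]

theorem rest_pairwise (a n : ℕ) (l : List ℤ) : (rest a n l).Pairwise (· < ·) :=
  (interval_pairwise a n).filter _

/-- `{a, …, n}` is the disjoint union of `[i]`, `[i']` and the remaining numbers. -/
theorem rest_perm {n p a : ℕ} {l : List ℤ} (hl : l ∈ J p ((a : ℤ) + 1) n) :
    (rest a n l ++ (pred l ++ l)).Perm (interval a n) := by
  have hp := J_pairwise hl
  have hlp : l.Pairwise (· < ·) := hp.imp fun h => by omega
  have hpp : (pred l).Pairwise (· < ·) := by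
    rw [pred, List.pairwise_map]
    exact hlp.imp fun h => by omega
  have hdis : ∀ x ∈ l, x + 1 ∉ l := by
    intro x hx hx'
    obtain ⟨i, hi, h1⟩ := List.getElem_of_mem hx
    obtain ⟨j, hj, h2⟩ := List.getElem_of_mem hx'
    rw [List.pairwise_iff_getElem] at hp
    rcases lt_trichotomy i j with h | rfl | h
    · have := hp i j hi hj h
      omega
    · omega
    · have := hp j i hj hi h
      omega
  have hnd : (rest a n l ++ (pred l ++ l)).Nodup := by
    rw [List.nodup_append', List.nodup_append']
    refine ⟨(rest_pairwise a n l).imp fun h => h.ne, ⟨hpp.imp fun h => h.ne,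
      hlp.imp fun h => h.ne, ?_⟩, ?_⟩
    · intro x h1 h2
      exact hdis x h2 (mem_pred.1 h1)
    · intro x h1 h2
      rw [mem_rest] at h1
      rcases List.mem_append.1 h2 with h2 | h2
      · exact h1.2.2 h2
      · exact h1.2.1 h2
  rw [List.perm_ext_iff_of_nodup hnd ((interval_pairwise a n).imp fun h => h.ne)]
  intro x
  simp only [List.mem_append, mem_rest, mem_interval]
  constructor
  · rintro (h | h | h)
    · exact h.1
    · have := hl.2.1 _ (mem_pred.1 h)
      omega
    · have := hl.2.1 _ h
      omega
  · intro h
    by_cases h1 : x ∈ l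
    · exact Or.inr (Or.inr h1)
    · by_cases h2 : x ∈ pred l
      · exact Or.inr (Or.inl h2)
      · exact Or.inl ⟨h, h1, h2⟩

theorem map_abs_of_nonneg {l : List ℤ} (h : ∀ x ∈ l, 0 ≤ x) : (l.map fun x => |x|) = l := by
  conv_rhs => rw [← List.map_id l]
  exact List.map_congr_left fun x hx => abs_of_nonneg (h x hx)

theorem prod_sign_of_pos {l : List ℤ} (h : ∀ x ∈ l, 0 < x) : (l.map Int.sign).prod = 1 := by
  refine List.prod_eq_one fun x hx => ?_
  obtain ⟨y, hy, rfl⟩ := List.mem_map.1 hx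
  exact Int.sign_eq_one_of_pos (h y hy)

theorem prod_sign_neg {l : List ℤ} (h : ∀ x ∈ l, 0 < x) :
    ((neg l).map Int.sign).prod = (-1) ^ l.length := by
  rw [neg, List.map_reverse, List.prod_reverse, List.map_map]
  induction l with
  | nil => rfl
  | cons i l ih =>
    rw [List.map_cons, List.prod_cons, ih fun x hx => h x (List.mem_cons_of_mem _ hx),
      List.length_cons, pow_succ']
    congr 1
    exact Int.sign_eq_neg_one_of_neg (by simpa using h i List.mem_cons_self)

theorem map_abs_neg (l : List ℤ) (h : ∀ x ∈ l, 0 ≤ x) :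
    ((neg l).map fun x => |x|) = l.reverse := by
  rw [neg, List.map_reverse, List.map_map]
  congr 1
  conv_rhs => rw [← List.map_id l]
  refine List.map_congr_left fun x hx => ?_
  simp [abs_of_nonneg (h x hx)]

theorem neg_pairwise {l : List ℤ} (h : l.Pairwise (· < ·)) : (neg l).Pairwise (· < ·) := by
  rw [neg, List.pairwise_reverse, List.pairwise_map]
  exact h.imp fun h => by omega

theorem sum_e_neg_pred {n : ℕ} {l : List ℤ} (hl : ∀ x ∈ l, 2 ≤ x) :
    ((neg (pred l)).map (e n)).sum + (l.map (e n)).sum = rootSum n l := by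
  rw [neg, List.map_reverse, List.sum_reverse, pred, List.map_map, List.map_map]
  induction l with
  | nil => simp [rootSum_nil]
  | cons i l ih =>
    have h1 : simpleRoot n i = e n i - e n (i - 1) := by
      have := hl i List.mem_cons_self
      rw [simpleRoot, if_neg (by omega)]
    rw [rootSum_cons, ← ih fun x hx => hl x (List.mem_cons_of_mem _ hx), h1]
    simp only [List.map_cons, List.sum_cons, Function.comp_apply, e_neg]
    abel

theorem sum_e_neg_add_pred {n : ℕ} {l : List ℤ} (hl : ∀ x ∈ l, 2 ≤ x) :
    ((neg l).map (e n)).sum + ((pred l).map (e n)).sum = -rootSum n l := by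
  rw [neg, List.map_reverse, List.sum_reverse, pred, List.map_map, List.map_map]
  induction l with
  | nil => simp [rootSum_nil]
  | cons i l ih =>
    have h1 : simpleRoot n i = e n i - e n (i - 1) := by
      have := hl i List.mem_cons_self
      rw [simpleRoot, if_neg (by omega)]
    rw [rootSum_cons, neg_add, ← ih fun x hx => hl x (List.mem_cons_of_mem _ hx), h1]
    simp only [List.map_cons, List.sum_cons, Function.comp_apply, e_neg]
    abel

theorem block_pairwise {a : ℤ} {L M U : List ℤ} (hL : L.Pairwise (· < ·)) (hM : M.Pairwise (· < ·))
    (hU : U.Pairwise (· < ·)) (hL' : ∀ x ∈ L, x ≤ -a) (hM' : ∀ x ∈ M, |x| < a)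
    (hU' : ∀ x ∈ U, a ≤ x) (ha : 0 < a) : (L ++ M ++ U).Pairwise (· < ·) := by
  rw [List.pairwise_append, List.pairwise_append]
  refine ⟨⟨hL, hM, fun x hx y hy => ?_⟩, hU, fun x hx y hy => ?_⟩
  · have := abs_lt.1 (hM' y hy)
    have := hL' x hx
    omega
  · have h1 := hU' y hy
    rcases List.mem_append.1 hx with hx | hx
    · have := hL' x hx
      omega
    · have := abs_lt.1 (hM' x hx)
      omega

/-! ### Construction of the elements $v$ and $w$ from blocks. -/

/-- The elements `v = (A, -i', M, i)`. -/
theorem exists_upper {n r p a : ℕ} (hn : 2 ≤ n) (hr : 3 ≤ r) (ha : 1 ≤ a) {l A H M : List ℤ}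
    (hl : l ∈ J p ((a : ℤ) + 1) n) (hrn : n + 1 = r + M.length + 2 * p)
    (hA : (A.map fun x => |x|) = H ++ rest a n l)
    (hH : (H ++ M.map fun x => |x|).Perm (interval 1 (a - 1))) (han : a ≤ n + 1)
    (hA' : A.Pairwise fun x y => |x| < y) (hM : M.Pairwise (· < ·))
    (hs : (A.map Int.sign).prod * (M.map Int.sign).prod = (-1) ^ p) :
    ∃ v ∈ minReps n r, oneLine n v = A ++ (neg (pred l) ++ M ++ l) ∧ A.length + 1 = r ∧
      act n v (fundWeight n r) = (M.map (e n)).sum + rootSum n l := by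
  have hl1 : ∀ x ∈ l, (a : ℤ) + 1 ≤ x := fun x hx => (hl.2.1 x hx).1
  have hl2 : ∀ x ∈ pred l, (a : ℤ) ≤ x := by
    intro x hx
    have := hl1 _ (mem_pred.1 hx)
    omega
  have hlp : l.Pairwise (· < ·) := (J_pairwise hl).imp fun h => by omega
  have hpp : (pred l).Pairwise (· < ·) := by
    rw [pred, List.pairwise_map]
    exact hlp.imp fun h => by omega
  have hplen : (pred l).length = p := by rw [pred, List.length_map, hl.1]
  -- `H` collects the absolute values below $a$ that occur in `A`; with those of the middle block
  -- `M` they exhaust $1,\dots,a-1$. The numbers from $a$ on are shared by the tuple, its shift and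
  -- the rest.
  have hM' : ∀ x ∈ M, |x| < a := by
    intro x hx
    have : |x| ∈ H ++ M.map fun x => |x| :=
      List.mem_append_right _ (List.mem_map.2 ⟨x, hx, rfl⟩)
    have := mem_interval.1 (hH.mem_iff.1 this)
    omega
  have hint : (interval 1 (a - 1) ++ interval a n).Perm (interval 1 n) := by
    refine List.Perm.of_eq ?_
    rw [interval_eq, interval_eq, interval_eq]
    refine List.ext_getElem (by simp; omega) fun j h1 h2 => ?_
    rw [List.getElem_append]
    split_ifs with h3
    · simp
    · simp at h3 ⊢
      omega
  have hperm : ((A ++ (neg (pred l) ++ M ++ l)).map fun x => |x|).Perm (interval 1 n) := by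
    refine List.Perm.trans ?_ hint
    refine List.Perm.trans ?_ (hH.append (rest_perm hl))
    simp only [List.map_append, hA]
    rw [map_abs_neg _ (fun x hx => by have := hl2 x hx; omega),
      map_abs_of_nonneg (l := l) (fun x hx => by have := hl1 x hx; omega)]
    have h1 : ((pred l).reverse ++ M.map fun x => |x|).Perm ((M.map fun x => |x|) ++ pred l) :=
      List.perm_append_comm.trans (List.Perm.append_left _ (List.reverse_perm _))
    rw [List.append_assoc H, List.append_assoc H]
    refine List.Perm.append_left _ ?_
    refine (List.Perm.append_left _ (h1.append_right l)).trans ?_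
    rw [List.append_assoc, ← List.append_assoc (rest a n l), ← List.append_assoc _ (rest a n l)]
    exact List.Perm.append_right _ List.perm_append_comm
  -- The negated block contributes $(-1)^p$, which the signs of `A` and `M` have to cancel.
  have hsign : ((A ++ (neg (pred l) ++ M ++ l)).map Int.sign).prod = 1 := by
    simp only [List.map_append, List.prod_append]
    rw [prod_sign_neg (fun x hx => by have := hl2 x hx; omega),
      prod_sign_of_pos (l := l) (fun x hx => by have := hl1 x hx; omega), hplen, mul_one,
      mul_left_comm, hs, ← mul_pow]
    norm_num
  obtain ⟨v, hv, hline⟩ := exists_oneLine hn hperm hsign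
  have hAlen : A.length + 1 = r := by
    have h1 := congrArg List.length hline
    rw [length_oneLine] at h1
    simp only [List.length_append, neg, List.length_reverse, List.length_map, hplen, hl.1] at h1
    omega
  refine ⟨v, ?_, hline, hAlen, ?_⟩
  · refine mem_minReps_of_oneLine hn hr hv hline hAlen hA' ?_
    refine block_pairwise (a := a) (neg_pairwise hpp) hM hlp ?_ hM' ?_ (by omega)
    · intro x hx
      have := hl2 _ (mem_neg.1 hx)
      omega
    · intro x hx
      have := hl1 x hx
      omega
  · rw [act_fundWeight_of_oneLine hr hline hAlen]
    simp only [List.map_append, List.sum_append]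
    rw [← sum_e_neg_pred (fun x hx => by have := hl1 x hx; omega)]
    abel

/-- The elements `w = c s_i v = (A', -i, M', i')`. -/
theorem lower_of_upper {n r p a : ℕ} (hn : 2 ≤ n) (hr : 3 ≤ r) (ha : 1 ≤ a)
    {l A H M A' M' : List ℤ} (hl : l ∈ J p ((a : ℤ) + 1) n)
    (hA : (A.map fun x => |x|) = H ++ rest a n l)
    (hH : (H ++ M.map fun x => |x|).Perm (interval 1 (a - 1)))
    {v c : Equiv.Perm ℤ} (hv : v ∈ weylGroup n)
    (hline : oneLine n v = A ++ (neg (pred l) ++ M ++ l)) (hAr : A.length + 1 = r)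
    (hc : c ∈ weylGroup n) (hc' : ∀ y : ℤ, (a : ℤ) ≤ y → c y = y) (hcA : A.map c = A')
    (hA' : A'.Pairwise fun x y => |x| < y) (hcM : M.map c = M') (hM' : M'.Pairwise (· < ·))
    (hMa : ∀ x ∈ M', |x| < a) :
    c * word l * v ∈ minReps n r ∧ oneLine n (c * word l * v) = A' ++ (neg l ++ M' ++ pred l) ∧
      act n (c * word l * v) (fundWeight n r) = (M'.map (e n)).sum - rootSum n l := by
  have hl1 : ∀ x ∈ l, (a : ℤ) + 1 ≤ x := fun x hx => (hl.2.1 x hx).1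
  have hl2 : ∀ x ∈ pred l, (a : ℤ) ≤ x := by
    intro x hx
    have := hl1 _ (mem_pred.1 hx)
    omega
  have hlp : l.Pairwise (· < ·) := (J_pairwise hl).imp fun h => by omega
  have hpp : (pred l).Pairwise (· < ·) := by
    rw [pred, List.pairwise_map]
    exact hlp.imp fun h => by omega
  have hwmem := word_mem (by omega) hl
  have hws := isSigned_of_mem hn hwmem
  have hcs := isSigned_of_mem hn hc
  obtain ⟨hw1, hw2⟩ := word_apply (fun x hx => by have := hl1 x hx; omega) (J_pairwise hl)
  have hfix : ∀ y : ℤ, |y| ∉ l → |y| ∉ pred l → word l y = y := by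
    intro y h1 h2
    have h3 : ∀ y : ℤ, 0 ≤ y → y ∉ l → y ∉ pred l → word l y = y := by
      intro y hy h1 h2
      refine hw2 y h1 h2 ?_ ?_
      · intro h
        have := hl1 _ h
        omega
      · intro h
        have := hl2 _ h
        omega
    rcases le_or_gt 0 y with h | h
    · rw [abs_of_nonneg h] at h1 h2
      exact h3 y h h1 h2
    · rw [abs_of_neg h] at h1 h2
      have := h3 (-y) (by omega) h1 h2
      rw [hws.1] at this
      omega
  have hsmall : ∀ y : ℤ, |y| < a → word l y = y := by
    intro y hy
    refine hfix y ?_ ?_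
    · intro h
      have := hl1 _ h
      omega
    · intro h
      have := hl2 _ h
      omega
  have hHint : ∀ x ∈ H ++ M.map fun x => |x|, x < a := by
    intro x hx
    have := mem_interval.1 (hH.mem_iff.1 hx)
    omega
  -- The two factors act on separate blocks: `word l` moves only the tuple and its shift, up to
  -- sign, and `c` moves only numbers of absolute value below $a$.
  have e1 : A.map (c * word l) = A' := by
    rw [← hcA]
    refine List.map_congr_left fun y hy => ?_
    rw [Equiv.Perm.mul_apply]
    congr 1
    have h1 : |y| ∈ H ++ rest a n l := by
      rw [← hA]
      exact List.mem_map.2 ⟨y, hy, rfl⟩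
    rcases List.mem_append.1 h1 with h1 | h1
    · exact hsmall y (hHint _ (List.mem_append_left _ h1))
    · rw [mem_rest] at h1
      exact hfix y h1.2.1 h1.2.2
  have e2 : (neg (pred l)).map (c * word l) = neg l := by
    rw [neg, neg, List.map_reverse, pred, List.map_map, List.map_map]
    congr 1
    refine List.map_congr_left fun y hy => ?_
    simp only [Function.comp_apply, Equiv.Perm.mul_apply]
    rw [hws.1, (hw1 y hy).2, hcs.1, hc' y (by have := hl1 y hy; omega)]
  have e3 : M.map (c * word l) = M' := by
    rw [← hcM]
    refine List.map_congr_left fun y hy => ?_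
    rw [Equiv.Perm.mul_apply]
    congr 1
    exact hsmall y (hHint _ (List.mem_append_right _ (List.mem_map.2 ⟨y, hy, rfl⟩)))
  have e4 : l.map (c * word l) = pred l := by
    rw [pred]
    refine List.map_congr_left fun y hy => ?_
    rw [Equiv.Perm.mul_apply, (hw1 y hy).1, hc' _ (by have := hl1 y hy; omega)]
  have hline' : oneLine n (c * word l * v) = A' ++ (neg l ++ M' ++ pred l) := by
    rw [oneLine_mul, hline]
    simp only [List.map_append, e1, e2, e3, e4]
  have hAr' : A'.length + 1 = r := by rw [← hcA, List.length_map, hAr]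
  refine ⟨mem_minReps_of_oneLine hn hr (mul_mem (mul_mem hc hwmem) hv) hline' hAr' hA' ?_, hline',
    ?_⟩
  · refine block_pairwise (a := a) (neg_pairwise hlp) hM' hpp ?_ hMa hl2 (by omega)
    intro x hx
    have := hl1 _ (mem_neg.1 hx)
    omega
  · rw [act_fundWeight_of_oneLine hr hline' hAr']
    simp only [List.map_append, List.sum_append]
    have := sum_e_neg_add_pred (n := n) (l := l) (fun x hx => by have := hl1 x hx; omega)
    rw [sub_eq_add_neg, ← this]
    abel

theorem IsSmall.signed {n : ℕ} {x : E n} (hx : IsSmall x) {a : ℤ} (ha : InRange n a) :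
    coord x a = -1 ∨ coord x a = 0 ∨ coord x a = 1 := by
  obtain ⟨h1, h2, h3⟩ := ha
  rcases lt_or_gt_of_ne h1 with h | h
  · have := hx (-a).toNat (by omega) (by omega)
    rw [show ((-a).toNat : ℤ) = -a by omega, coord_neg_right] at this
    rcases this with h | h | h
    · exact Or.inr (Or.inr (by linarith))
    · exact Or.inr (Or.inl (by linarith))
    · exact Or.inl (by linarith)
  · have := hx a.toNat (by omega) (by omega)
    rwa [show (a.toNat : ℤ) = a by omega] at this

/-! ### The case $r\ge3$: the orbit replaced by vectors of given length, and antichains of top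
vectors. -/

/-- The vectors with coordinates `-1`, `0`, `1` and given squared length. -/
def smallVectors (n : ℕ) (q : ℝ) : Set (E n) := {x | IsSmall x ∧ x ⬝ᵥ x = q}

theorem isStable_smallVectors {n : ℕ} (hn : 2 ≤ n) (q : ℝ) : IsStable (smallVectors n q) := by
  refine ⟨fun x hx => hx.1, fun x hx i hi hi' => ⟨fun k h1 h2 => ?_, ?_⟩⟩
  · have hs := isSigned_s hn hi hi'
    have hk := inRange_of_pos (n := n) (k := k) (by omega) (by omega)
    rw [coord_act' hs x hk]
    exact hx.1.signed (hs.inv.inRange hk)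
  · rw [dotProduct_act hn (s_mem hi hi'), hx.2]

theorem coord_fundWeight {n r k : ℕ} (hr : 3 ≤ r) (hk : 1 ≤ k) (hk' : k ≤ n) :
    coord (fundWeight n r) k = if r ≤ k then 1 else 0 := by
  have := coord_nat (fundWeight n r) (k := k - 1) (by omega)
  rw [show ((k - 1 : ℕ) : ℤ) + 1 = k by omega] at this
  rw [this]
  simp only [fundWeight, if_neg (show r ≠ 1 by omega), if_neg (show r ≠ 2 by omega)]
  rw [show k - 1 + 1 = k by omega]

theorem fundWeight_dotProduct_self {n r : ℕ} (hr : 3 ≤ r) (hr' : r ≤ n) :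
    fundWeight n r ⬝ᵥ fundWeight n r = (n : ℝ) + 1 - r := by
  have key : ∀ d k : ℕ, r ≤ k → k + d = n + 1 → coef (fundWeight n r) k = d := by
    intro d
    induction d with
    | zero =>
      intro k hk hd
      rw [coef_of_gt _ (by omega) (by omega)]
      simp
    | succ d ih =>
      intro k hk hd
      rw [coef_succ _ (by omega), coord_fundWeight hr (by omega) (by omega), if_pos hk,
        ih (k + 1) (by omega) (by omega)]
      push_cast
      ring
  have := key (n + 1 - r) r le_rfl (by omega)
  rw [coef] at this
  rw [this, Nat.cast_sub (by omega)]
  push_cast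
  ring

theorem fundWeight_mem {n r : ℕ} (hr : 3 ≤ r) (hr' : r ≤ n) :
    fundWeight n r ∈ smallVectors n ((n : ℝ) + 1 - r) := by
  refine ⟨fun k h1 h2 => ?_, fundWeight_dotProduct_self hr hr'⟩
  rw [coord_fundWeight hr h1 h2]
  split_ifs <;> simp

theorem neg_fundWeight_mem {n r : ℕ} (hr : 3 ≤ r) (hr' : r ≤ n) :
    -fundWeight n r ∈ smallVectors n ((n : ℝ) + 1 - r) := by
  refine ⟨fun k h1 h2 => ?_, ?_⟩
  · rw [coord_neg, coord_fundWeight hr h1 h2]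
    split_ifs <;> simp
  · rw [neg_dotProduct, dotProduct_neg, neg_neg, fundWeight_dotProduct_self hr hr']

/-- `P` describes the negatives of the top vectors in the orbit of `ω_r`, and these are pairwise
incomparable. -/
structure IsTopFamily (n r : ℕ) (P : E n → Prop) : Prop where
  top : ∀ z : E n, IsTop z → z ⬝ᵥ z = (n : ℝ) + 1 - r → P (-z)
  antichain : ∀ x y, P x → P y → RootNonneg n (x - y) → x = y
  nonneg : ∀ y, P y → RootNonneg n y

theorem rootNonneg_rootSum {n p : ℕ} (hn : 2 ≤ n) {a : ℤ} (ha : 1 ≤ a) {l : List ℤ}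
    (hl : l ∈ J p a n) : RootNonneg n (rootSum n l) := by
  rw [rootNonneg_iff hn]
  intro k h1 _
  rw [coef_rootSum hn h1 fun x hx => ⟨ha.trans (hl.2.1 x hx).1, (hl.2.1 x hx).2⟩]
  positivity

theorem isTopFamily_even {n r m : ℕ} (hn : 3 ≤ n) (h : n + 1 = r + 2 * m) :
    IsTopFamily n r (EvenWeight n m) := by
  refine ⟨fun z hz hz' => hz.evenWeight hn ?_, fun x y hx hy => hx.antichain hn hy, ?_⟩
  · have : (n : ℝ) + 1 = r + 2 * m := by exact_mod_cast h
    rw [hz', this]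
    push_cast
    ring
  · rintro y (⟨l, hl, rfl⟩ | ⟨q, -, l, hl, rfl | rfl⟩)
    · exact rootNonneg_rootSum (by omega) (by norm_num) hl
    · exact (rootNonneg_simpleRoot (by omega) le_rfl (by omega)).add (by omega)
        (rootNonneg_rootSum (by omega) (by norm_num) hl)
    · exact (rootNonneg_simpleRoot (by omega) (by norm_num) (by omega)).add (by omega)
        (rootNonneg_rootSum (by omega) (by norm_num) hl)

theorem isTopFamily_odd {n r m : ℕ} (hn : 3 ≤ n) (h : n + 1 = r + (2 * m + 1)) :
    IsTopFamily n r (OddWeight n m) := by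
  refine ⟨fun z hz hz' => hz.oddWeight hn ?_, fun x y hx hy => hx.antichain hn hy, ?_⟩
  · have : (n : ℝ) + 1 = r + (2 * m + 1) := by exact_mod_cast h
    rw [hz', this]
    push_cast
    ring
  · have hC : RootNonneg n (endC n) := by
      rw [rootNonneg_iff (by omega)]
      intro k hk _
      rw [coef_endC hn hk]
      split_ifs <;> norm_num
    have hD1 : RootNonneg n (endD1 n) := by
      rw [rootNonneg_iff (by omega)]
      intro k hk _
      rw [coef_endD1 hn hk]
      split_ifs <;> norm_num
    have hD2 : RootNonneg n (endD2 n) := by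
      rw [rootNonneg_iff (by omega)]
      intro k hk _
      rw [coef_endD2 hn hk]
      split_ifs <;> norm_num
    rintro y (⟨l, hl, rfl⟩ | ⟨q, -, l, hl, rfl | rfl⟩)
    · exact hC.add (by omega) (rootNonneg_rootSum (by omega) (by norm_num) hl)
    · exact hD1.add (by omega) (rootNonneg_rootSum (by omega) (by norm_num) hl)
    · exact hD2.add (by omega) (rootNonneg_rootSum (by omega) (by norm_num) hl)

section Family

variable {n r : ℕ} {P : E n → Prop}

/-- A top vector above $-y$ is the negative of a member of the family, and the antichain property
leaves only $-y$. It is not necessary to check that $-y$ itself is top. -/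
theorem IsTopFamily.isMinimal (hP : IsTopFamily n r P) (hn : 2 ≤ n) (hr : 3 ≤ r) (hr' : r ≤ n)
    {w : Equiv.Perm ℤ} (hw : w ∈ minReps n r) {y : E n} (hy : P y)
    (hwy : act n w (fundWeight n r) = -y) : IsMinimalNonpos n r w := by
  refine isMinimalNonpos_of_weight hn (by omega) (isStable_smallVectors hn ((n : ℝ) + 1 - r))
    one_pos (by rw [one_smul]; exact fundWeight_mem hr hr') hw ?_ ?_
  · rw [one_smul, hwy, isNonpos_iff hn, neg_neg]
    exact hP.nonneg y hy
  · intro z hz hz' h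
    rw [one_smul, hwy] at h ⊢
    rw [hP.antichain y (-z) hy (hP.top z hz' hz.2) (by rwa [sub_neg_eq_add, add_comm,
      ← sub_neg_eq_add]), neg_neg]

theorem IsTopFamily.isMaximal (hP : IsTopFamily n r P) (hn : 2 ≤ n) (hr : 3 ≤ r) (hr' : r ≤ n)
    {v : Equiv.Perm ℤ} (hv : v ∈ minReps n r) {y : E n} (hy : P y)
    (hvy : act n v (fundWeight n r) = y) : IsMaximalNonneg n r v := by
  refine isMaximalNonneg_of_weight hn (by omega) (isStable_smallVectors hn ((n : ℝ) + 1 - r))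
    (neg_fundWeight_mem hr hr') hv ?_ ?_
  · rw [hvy, isNonpos_iff hn, neg_neg]
    exact hP.nonneg y hy
  · intro z hz hz' h
    rw [hvy] at h ⊢
    rw [hP.antichain y (-z) hy (hP.top z hz' hz.2) (by rwa [sub_neg_eq_add, add_comm,
      ← sub_neg_eq_add]), neg_neg]

theorem IsTopFamily.exists_weight (hP : IsTopFamily n r P) (hn : 2 ≤ n) (hr : 3 ≤ r) (hr' : r ≤ n)
    {u : Equiv.Perm ℤ} (hu : IsMinimalNonpos n r u) :
    ∃ y, P y ∧ act n u (fundWeight n r) = -y := by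
  have hmem := act_mem_of_isStable hn (isStable_smallVectors hn ((n : ℝ) + 1 - r)) hu.1.1.1
    (fundWeight_mem hr hr')
  have := hu.isTop hn (by omega) one_pos (by rw [one_smul]; exact hmem.1)
  rw [one_smul] at this
  exact ⟨_, hP.top _ this hmem.2, (neg_neg _).symm⟩

end Family

/-! ### The listed pairs $(v,w)$ for $r\ge3$. -/

/-- There are `v` and `w = x v` in `W^{I_r}` with the given one-line notations and weights. -/
def HasPair (n r : ℕ) (vLine : List ℤ) (χ : E n) (x : Equiv.Perm ℤ) (wLine : List ℤ) (ψ : E n) :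
    Prop :=
  ∃ v ∈ minReps n r, oneLine n v = vLine ∧ act n v (fundWeight n r) = χ ∧
    x * v ∈ minReps n r ∧ oneLine n (x * v) = wLine ∧ act n (x * v) (fundWeight n r) = -ψ

theorem HasPair.matched {n r : ℕ} {P : E n → Prop} (hP : IsTopFamily n r P) (hn : 2 ≤ n)
    (hr : 3 ≤ r) (hr' : r ≤ n) {vLine wLine : List ℤ} {χ : E n} {x : Equiv.Perm ℤ}
    (h : HasPair n r vLine χ x wLine χ) (hχ : P χ) : Matched n r vLine χ x wLine := by
  obtain ⟨v, h1, h2, h3, h4, h5, h6⟩ := h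
  exact ⟨v, x * v, ⟨h2, hP.isMaximal hn hr hr' h1 hχ h3, h3⟩,
    ⟨h5, hP.isMinimal hn hr hr' h4 hχ h6⟩, rfl, by rw [h6, h3]⟩

theorem HasPair.oneLine_eq {n r : ℕ} (hn : 2 ≤ n) (hr : 1 ≤ r) {vLine wLine : List ℤ} {χ ψ : E n}
    {x : Equiv.Perm ℤ} (h : HasPair n r vLine χ x wLine ψ) {u : Equiv.Perm ℤ}
    (hu : u ∈ minReps n r) (hψ : act n u (fundWeight n r) = -ψ) : oneLine n u = wLine := by
  obtain ⟨v, -, -, -, h4, h5, h6⟩ := h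
  rw [eq_of_act_eq hn hr hu h4 (hψ.trans h6.symm), h5]

theorem hasPair {n r p a : ℕ} (hn : 2 ≤ n) (hr : 3 ≤ r) (ha : 1 ≤ a) {l A H M A' M' : List ℤ}
    (hl : l ∈ J p ((a : ℤ) + 1) n) (hrn : n + 1 = r + M.length + 2 * p)
    (hA : (A.map fun x => |x|) = H ++ rest a n l)
    (hH : (H ++ M.map fun x => |x|).Perm (interval 1 (a - 1))) (han : a ≤ n + 1)
    (hAp : A.Pairwise fun x y => |x| < y) (hM : M.Pairwise (· < ·))
    (hs : (A.map Int.sign).prod * (M.map Int.sign).prod = (-1) ^ p)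
    {c : Equiv.Perm ℤ} (hc : c ∈ weylGroup n) (hc' : ∀ y : ℤ, (a : ℤ) ≤ y → c y = y)
    (hcA : A.map c = A') (hA' : A'.Pairwise fun x y => |x| < y) (hcM : M.map c = M')
    (hM' : M'.Pairwise (· < ·)) (hMa : ∀ x ∈ M', |x| < a) {χ ψ : E n}
    (hχ : (M.map (e n)).sum = χ) (hψ : (M'.map (e n)).sum = -ψ) :
    HasPair n r (A ++ (neg (pred l) ++ M ++ l)) (χ + rootSum n l) (c * word l)
      (A' ++ (neg l ++ M' ++ pred l)) (ψ + rootSum n l) := by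
  obtain ⟨v, h1, h2, h3, h4⟩ := exists_upper hn hr ha hl hrn hA hH han hAp hM hs
  obtain ⟨h5, h6, h7⟩ := lower_of_upper hn hr ha hl hA hH h1.1 h2 h3 hc hc' hcA hA' hcM hM' hMa
  refine ⟨v, h1, h2, by rw [h4, hχ], h5, h6, ?_⟩
  rw [h7, hψ]
  abel

theorem s_apply_of_lt {i y : ℤ} (hi : 1 ≤ i) (h : i < y) (hy : 3 ≤ y) : s i y = y := by
  rw [s_apply hi]
  rcases lo_cases hi with ⟨h1, h2⟩ | ⟨h1, h2⟩ <;> rw [h2] <;> split_ifs <;> omega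

theorem map_abs_negHead {l : List ℤ} (h : ∀ x ∈ l, 0 ≤ x) :
    ((negHead l).map fun x => |x|) = l := by
  rw [← map_abs_of_nonneg h]
  cases l with
  | nil => rfl
  | cons t l =>
    rw [map_abs_of_nonneg h]
    rw [negHead, List.map_cons, abs_neg, ← List.map_cons, map_abs_of_nonneg h]

theorem pairwise_abs_lt {l : List ℤ} (h : ∀ x ∈ l, 0 ≤ x) (hp : l.Pairwise (· < ·)) :
    l.Pairwise fun x y => |x| < y :=
  hp.imp_of_mem fun hx _ hxy => by rwa [abs_of_nonneg (h _ hx)]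

theorem pairwise_abs_lt_negHead {l : List ℤ} (h : ∀ x ∈ l, 0 ≤ x) (hp : l.Pairwise (· < ·)) :
    (negHead l).Pairwise fun x y => |x| < y := by
  have := pairwise_abs_lt h hp
  cases l with
  | nil => exact List.Pairwise.nil
  | cons t l =>
    rw [List.pairwise_cons] at this
    rw [negHead, List.pairwise_cons]
    exact ⟨fun y hy => by rw [abs_neg]; exact this.1 y hy, this.2⟩

theorem prod_sign_negHead {l : List ℤ} (h : ∀ x ∈ l, 0 < x) (hne : l ≠ []) :
    ((negHead l).map Int.sign).prod = -1 := by
  cases l with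
  | nil => exact absurd rfl hne
  | cons t l =>
    rw [negHead, List.map_cons, List.prod_cons,
      prod_sign_of_pos fun x hx => h x (List.mem_cons_of_mem _ hx), mul_one]
    exact Int.sign_eq_neg_one_of_neg (by simpa using h t List.mem_cons_self)

theorem map_eq_self_of_abs {n a : ℕ} {A l : List ℤ} (hA : (A.map fun x => |x|) = rest a n l)
    {c : Equiv.Perm ℤ} (hc : ∀ k, c (-k) = -c k) (hc' : ∀ y : ℤ, (a : ℤ) ≤ y → c y = y) :
    A.map c = A := by
  conv_rhs => rw [← List.map_id A]
  refine List.map_congr_left fun y hy => ?_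
  have h1 : |y| ∈ rest a n l := hA ▸ List.mem_map.2 ⟨y, hy, rfl⟩
  have h2 := hc' _ (mem_rest.1 h1).1.1
  rcases abs_choice y with h | h <;> rw [h] at h2
  · exact h2
  · rw [hc] at h2
    simp only [id_eq]
    omega

/-- The elements `(A, -i', M, i)` where `A` is the list of remaining numbers, possibly with its
first entry negated. -/
theorem hasPair_signed_rest {n r p a : ℕ} (hn : 2 ≤ n) (hr : 3 ≤ r) (ha : 1 ≤ a)
    {l M M' : List ℤ} (hl : l ∈ J p ((a : ℤ) + 1) n) (hrn : n + 1 = r + M.length + 2 * p)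
    (hH : (M.map fun x => |x|).Perm (interval 1 (a - 1))) (han : a ≤ n + 1)
    (b : Prop) [Decidable b] (hM : M.Pairwise (· < ·))
    (hs : (if b then 1 else -1) * (M.map Int.sign).prod = (-1) ^ p)
    {c : Equiv.Perm ℤ} (hc : c ∈ weylGroup n) (hc' : ∀ y : ℤ, (a : ℤ) ≤ y → c y = y)
    (hcM : M.map c = M') (hM' : M'.Pairwise (· < ·)) (hMa : ∀ x ∈ M', |x| < a) {χ ψ : E n}
    (hχ : (M.map (e n)).sum = χ) (hψ : (M'.map (e n)).sum = -ψ) :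
    HasPair n r ((if b then rest a n l else negHead (rest a n l)) ++ (neg (pred l) ++ M ++ l))
      (χ + rootSum n l) (c * word l)
      ((if b then rest a n l else negHead (rest a n l)) ++ (neg l ++ M' ++ pred l))
      (ψ + rootSum n l) := by
  have hpos : ∀ x ∈ rest a n l, 0 < x := by
    intro x hx
    have := mem_rest.1 hx
    omega
  have hnn : ∀ x ∈ rest a n l, 0 ≤ x := fun x hx => (hpos x hx).le
  -- If nothing remained, counting entries would give $r=1$. Nonemptiness ensures that `negHead`
  -- really changes a sign.
  have hne : rest a n l ≠ [] := by
    intro h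
    have h1 := (rest_perm hl).length_eq
    have h2 := hH.length_eq
    rw [h] at h1
    simp only [List.nil_append, List.length_append, pred, List.length_map, hl.1,
      length_interval] at h1 h2
    omega
  set A := if b then rest a n l else negHead (rest a n l) with hA
  have h1 : (A.map fun x => |x|) = rest a n l := by
    rw [hA]
    split_ifs
    · exact map_abs_of_nonneg hnn
    · exact map_abs_negHead hnn
  have h2 : A.Pairwise fun x y => |x| < y := by
    rw [hA]
    split_ifs
    · exact pairwise_abs_lt hnn (rest_pairwise _ _ _)
    · exact pairwise_abs_lt_negHead hnn (rest_pairwise _ _ _)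
  have h3 : (A.map Int.sign).prod = if b then 1 else -1 := by
    rw [hA]
    split_ifs
    · exact prod_sign_of_pos hpos
    · exact prod_sign_negHead hpos hne
  exact hasPair hn hr ha (H := []) hl hrn h1 hH han h2 hM (by rw [h3, hs]) hc hc'
    (map_eq_self_of_abs h1 (isSigned_of_mem hn hc).1 hc') h2 hcM hM' hMa hχ hψ

/-- The elements `(ε, A, -i', M, i)` with `ε = ±1`. -/
theorem hasPair_cons_rest {n r p a : ℕ} (hn : 2 ≤ n) (hr : 3 ≤ r) (ha : 2 ≤ a)
    {l M M' : List ℤ} (hl : l ∈ J p ((a : ℤ) + 1) n) (hrn : n + 1 = r + M.length + 2 * p)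
    (hH : (1 :: M.map fun x => |x|).Perm (interval 1 (a - 1))) (han : a ≤ n + 1)
    {ε ε' : ℤ} (hε : ε = 1 ∨ ε = -1) (hε' : ε' = 1 ∨ ε' = -1) (hM : M.Pairwise (· < ·))
    (hs : ε * (M.map Int.sign).prod = (-1) ^ p)
    {c : Equiv.Perm ℤ} (hc : c ∈ weylGroup n) (hc' : ∀ y : ℤ, (a : ℤ) ≤ y → c y = y)
    (hcε : c ε = ε') (hcM : M.map c = M') (hM' : M'.Pairwise (· < ·))
    (hMa : ∀ x ∈ M', |x| < a) {χ ψ : E n}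
    (hχ : (M.map (e n)).sum = χ) (hψ : (M'.map (e n)).sum = -ψ) :
    HasPair n r (([ε] ++ rest a n l) ++ (neg (pred l) ++ M ++ l)) (χ + rootSum n l) (c * word l)
      (([ε'] ++ rest a n l) ++ (neg l ++ M' ++ pred l)) (ψ + rootSum n l) := by
  have hpos : ∀ x ∈ rest a n l, 2 ≤ x := by
    intro x hx
    have := mem_rest.1 hx
    omega
  have hnn : ∀ x ∈ rest a n l, 0 ≤ x := fun x hx => by have := hpos x hx; omega
  have habs : ∀ ε : ℤ, ε = 1 ∨ ε = -1 → |ε| = 1 := by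
    rintro ε (rfl | rfl) <;> rfl
  have hpair : ∀ ε : ℤ, ε = 1 ∨ ε = -1 → ([ε] ++ rest a n l).Pairwise fun x y => |x| < y := by
    intro ε hε
    rw [List.singleton_append, List.pairwise_cons]
    refine ⟨fun y hy => ?_, pairwise_abs_lt hnn (rest_pairwise _ _ _)⟩
    rw [habs ε hε]
    have := hpos y hy
    omega
  refine hasPair hn hr (by omega) (H := [1]) hl hrn ?_ hH han (hpair ε hε) hM ?_ hc hc' ?_
    (hpair ε' hε') hcM hM' hMa hχ hψ
  · rw [List.map_append, map_abs_of_nonneg hnn, List.map_singleton, habs ε hε]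
  · rw [List.map_append, List.prod_append,
      prod_sign_of_pos (l := rest a n l) (fun x hx => by have := hpos x hx; omega), mul_one, ← hs]
    rcases hε with rfl | rfl <;> simp
  · rw [List.map_append, map_eq_self_of_abs (map_abs_of_nonneg hnn) (isSigned_of_mem hn hc).1 hc',
      List.map_singleton, hcε]

theorem sign_pow {m : ℕ} : ((if Odd m then -1 else 1 : ℤ)) = (-1) ^ m := by
  split_ifs with h
  · rw [h.neg_one_pow]
  · rw [(Nat.not_odd_iff_even.1 h).neg_one_pow]

theorem sign_pow' {q : ℕ} : ((if Odd (q + 1) then 1 else -1 : ℤ)) = (-1) ^ q := by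
  rw [← neg_neg ((-1 : ℤ) ^ q), ← neg_one_mul ((-1 : ℤ) ^ q), ← pow_succ', ← sign_pow]
  split_ifs <;> norm_num

theorem sign_pow'' {q : ℕ} : ((if ¬Odd (q + 1) then 1 else -1 : ℤ)) = -(-1) ^ q := by
  rw [← sign_pow']
  split_ifs <;> norm_num

theorem hasPair_vE {n r m : ℕ} (hr : 3 ≤ r) (hr' : r ≤ n) (h : n + 1 = r + 2 * m) {l : List ℤ}
    (hl : l ∈ J m 3 n) :
    HasPair n r (vE n m l) (rootSum n l) (word l) (wE n m l) (rootSum n l) := by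
  have hε : (if Odd m then -1 else 1 : ℤ) = 1 ∨ (if Odd m then -1 else 1 : ℤ) = -1 := by
    split_ifs <;> simp
  have := hasPair_cons_rest (n := n) (r := r) (p := m) (a := 2) (l := l) (M := []) (M' := [])
    (by omega) hr le_rfl (by norm_num; exact hl) (by simpa using h) (by decide) (by omega) hε hε
    List.Pairwise.nil (by simpa using sign_pow) (one_mem _) (fun _ _ => rfl) rfl rfl
    List.Pairwise.nil (by simp) (χ := 0) (ψ := 0) rfl (by simp)
  convert this using 1 <;> by_cases hm : Odd m <;> simp [vE, wE, hm]

theorem hasPair_vE1 {n r q : ℕ} (hr : 3 ≤ r) (hr' : r ≤ n) (h : n + 1 = r + 2 * (q + 1))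
    {l : List ℤ} (hl : l ∈ J q 4 n) :
    HasPair n r (vE1 n (q + 1) l) (simpleRoot n 1 + rootSum n l) (s 1 * word l) (wE1 n (q + 1) l)
      (simpleRoot n 1 + rootSum n l) := by
  have := hasPair_signed_rest (n := n) (r := r) (p := q) (a := 3) (l := l) (M := [1, 2])
    (M' := [-2, -1]) (c := s 1)
    (by omega) hr (by norm_num) (by norm_num; exact hl) (by simp; omega) (by decide) (by omega)
    (Odd (q + 1)) (by decide) (by rw [sign_pow', show (([1, 2] : List ℤ).map Int.sign).prod = 1 from rfl, mul_one]) (s_mem le_rfl (by omega))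
    (fun y hy => s_apply_of_lt le_rfl (by omega) (by omega)) (by simp [s_apply, lo]) (by decide)
    (by decide) (χ := simpleRoot n 1) (ψ := simpleRoot n 1) (by simp [simpleRoot_one])
    (by simp [simpleRoot_one, e_neg])
  convert this using 1 <;> simp [vE1, wE1]

theorem hasPair_vE2 {n r q : ℕ} (hr : 3 ≤ r) (hr' : r ≤ n) (h : n + 1 = r + 2 * (q + 1))
    {l : List ℤ} (hl : l ∈ J q 4 n) :
    HasPair n r (vE2 n (q + 1) l) (simpleRoot n 2 + rootSum n l) (s 2 * word l) (wE2 n (q + 1) l)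
      (simpleRoot n 2 + rootSum n l) := by
  have := hasPair_signed_rest (n := n) (r := r) (p := q) (a := 3) (l := l) (M := [-1, 2])
    (M' := [-2, 1]) (c := s 2)
    (by omega) hr (by norm_num) (by norm_num; exact hl) (by simp; omega) (by decide) (by omega)
    (¬Odd (q + 1)) (by decide) (by rw [sign_pow'', show (([-1, 2] : List ℤ).map Int.sign).prod = -1 from rfl]; ring) (s_mem (by norm_num) (by omega))
    (fun y hy => s_apply_of_lt (by norm_num) (by omega) (by omega)) (by simp [s_apply, lo])
    (by decide) (by decide) (χ := simpleRoot n 2) (ψ := simpleRoot n 2)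
    (by simp [simpleRoot_two, e_neg]; abel) (by simp [simpleRoot_two, e_neg]; abel)
  convert this using 1 <;> simp only [vE2, wE2, ite_not, List.append_assoc]

/-- The factor $s_1s_2$ negates the first two coordinates: the sign change at 2 has to be paid for
by one at the entry $\pm1$, which does not affect the weight. -/
theorem hasPair_vO {n r m : ℕ} (hr : 3 ≤ r) (hr' : r ≤ n) (h : n + 1 = r + (2 * m + 1))
    {l : List ℤ} (hl : l ∈ J m 4 n) :
    HasPair n r (vO n m l) (endC n + rootSum n l) (s 1 * s 2 * word l) (wO n m l)
      (endC n + rootSum n l) := by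
  have hε : (if Odd m then -1 else 1 : ℤ) = 1 ∨ (if Odd m then -1 else 1 : ℤ) = -1 := by
    split_ifs <;> simp
  have hε' : (if Odd m then 1 else -1 : ℤ) = 1 ∨ (if Odd m then 1 else -1 : ℤ) = -1 := by
    split_ifs <;> simp
  have := hasPair_cons_rest (n := n) (r := r) (p := m) (a := 3) (l := l) (M := [2]) (M' := [-2])
    (c := s 1 * s 2)
    (by omega) hr (by norm_num) (by norm_num; exact hl) (by simp; omega) (by decide) (by omega)
    hε hε' (by decide) (by rw [sign_pow, show (([2] : List ℤ).map Int.sign).prod = 1 from rfl, mul_one])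
    (mul_mem (s_mem le_rfl (by omega)) (s_mem (by norm_num) (by omega)))
    (fun y hy => by
      rw [Equiv.Perm.mul_apply, s_apply_of_lt (i := 2) (by norm_num) (by omega) (by omega),
        s_apply_of_lt (i := 1) (by norm_num) (by omega) (by omega)])
    (by split_ifs <;> simp [s_apply, lo]) (by simp [s_apply, lo])
    (by decide) (by decide) (χ := endC n) (ψ := endC n) (by simp [endC_eq])
    (by simp [endC_eq, e_neg])
  convert this using 1 <;> by_cases hm : Odd m <;> simp [vO, wO, hm]

/-- Negating all of $\varepsilon_1,\varepsilon_2,\varepsilon_3$ is an odd number of sign changes, so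
no group element supported there sends this ending to its negative. With two sign changes it goes to
the negative of the other ending; hence two different weights appear. -/
theorem hasPair_vO1 {n r q : ℕ} (hr : 3 ≤ r) (h : n + 1 = r + (2 * (q + 1) + 1))
    {l : List ℤ} (hl : l ∈ J q 5 n) :
    HasPair n r (vO1 n (q + 1) l) (endD1 n + rootSum n l) (s 2 * s 3 * s 1 * word l)
      (wO2 n (q + 1) l) (endD2 n + rootSum n l) := by
  have := hasPair_signed_rest (n := n) (r := r) (p := q) (a := 4) (l := l) (M := [1, 2, 3])
    (M' := [-3, -2, 1]) (c := s 2 * s 3 * s 1)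
    (by omega) hr (by norm_num) (by norm_num; exact hl) (by simp; omega) (by decide) (by omega)
    (Odd (q + 1)) (by decide) (by rw [sign_pow', show (([1, 2, 3] : List ℤ).map Int.sign).prod = 1 from rfl, mul_one])
    (mul_mem (mul_mem (s_mem (by norm_num) (by omega)) (s_mem (by norm_num) (by omega)))
      (s_mem (by norm_num) (by omega)))
    (fun y hy => by
      rw [Equiv.Perm.mul_apply, Equiv.Perm.mul_apply,
        s_apply_of_lt (i := 1) (by norm_num) (by omega) (by omega),
        s_apply_of_lt (i := 3) (by norm_num) (by omega) (by omega),
        s_apply_of_lt (i := 2) (by norm_num) (by omega) (by omega)])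
    (by simp [s_apply, lo]) (by decide) (by decide) (χ := endD1 n) (ψ := endD2 n)
    (by simp [endD1_eq, add_assoc]) (by simp [endD2_eq, e_neg])
  convert this using 1 <;> simp [vO1, wO2]

theorem hasPair_vO2 {n r q : ℕ} (hr : 3 ≤ r) (h : n + 1 = r + (2 * (q + 1) + 1))
    {l : List ℤ} (hl : l ∈ J q 5 n) :
    HasPair n r (vO2 n (q + 1) l) (endD2 n + rootSum n l) (s 1 * s 3 * s 2 * word l)
      (wO1 n (q + 1) l) (endD1 n + rootSum n l) := by
  have := hasPair_signed_rest (n := n) (r := r) (p := q) (a := 4) (l := l) (M := [-1, 2, 3])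
    (M' := [-3, -2, -1]) (c := s 1 * s 3 * s 2)
    (by omega) hr (by norm_num) (by norm_num; exact hl) (by simp; omega) (by decide) (by omega)
    (¬Odd (q + 1)) (by decide) (by rw [sign_pow'', show (([-1, 2, 3] : List ℤ).map Int.sign).prod = -1 from rfl]; ring)
    (mul_mem (mul_mem (s_mem (by norm_num) (by omega)) (s_mem (by norm_num) (by omega)))
      (s_mem (by norm_num) (by omega)))
    (fun y hy => by
      rw [Equiv.Perm.mul_apply, Equiv.Perm.mul_apply,
        s_apply_of_lt (i := 2) (by norm_num) (by omega) (by omega),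
        s_apply_of_lt (i := 3) (by norm_num) (by omega) (by omega),
        s_apply_of_lt (i := 1) (by norm_num) (by omega) (by omega)])
    (by simp [s_apply, lo]) (by decide) (by decide) (χ := endD2 n) (ψ := endD1 n)
    (by simp [endD2_eq, e_neg]; abel) (by simp [endD1_eq, e_neg])
  convert this using 1 <;> simp only [vO2, wO1, ite_not, List.append_assoc]

/-! ### The half-spin weights: $r=1$ and $r=2$. -/

theorem lam_half {n r : ℕ} (hr : r = 1 ∨ r = 2) {k : ℕ} (hk : 1 ≤ k) (hk' : k ≤ n) :
    lam n r k = if k = 1 ∧ r = 2 then -1 / 2 else 1 / 2 := by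
  have := coord_nat (fundWeight n r) (k := k - 1) (by omega)
  rw [show ((k - 1 : ℕ) : ℤ) + 1 = k by omega] at this
  rw [lam, this]
  simp only [fundWeight]
  split_ifs <;> first | rfl | omega

theorem lam_half_abs {n r : ℕ} (hr : r = 1 ∨ r = 2) {a : ℤ} (ha : InRange n a) :
    lam n r a = -1 / 2 ∨ lam n r a = 1 / 2 := by
  obtain ⟨h1, h2, h3⟩ := ha
  rcases lt_or_gt_of_ne h1 with h | h
  · have := lam_half (n := n) hr (k := (-a).toNat) (by omega) (by omega)
    rw [show ((-a).toNat : ℤ) = -a by omega, lam_neg] at this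
    split_ifs at this
    · exact Or.inr (by linarith)
    · exact Or.inl (by linarith)
  · have := lam_half (n := n) hr (k := a.toNat) (by omega) (by omega)
    rw [show (a.toNat : ℤ) = a by omega] at this
    split_ifs at this
    · exact Or.inl this
    · exact Or.inr this

/-- The orbit of `2 ω_r`. -/
def orbit (n r : ℕ) : Set (E n) := {x | ∃ u ∈ weylGroup n, x = (2 : ℝ) • act n u (fundWeight n r)}

theorem coord_orbit {n r : ℕ} (hn : 2 ≤ n) (hr : r = 1 ∨ r = 2) {x : E n} (hx : x ∈ orbit n r)
    {k : ℤ} (hk : 1 ≤ k) (hk' : k ≤ n) : coord x k = -1 ∨ coord x k = 1 := by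
  obtain ⟨u, hu, rfl⟩ := hx
  have hs := isSigned_of_mem hn hu
  have hr' := inRange_of_pos hk hk'
  rw [coord_smul, coord_act' hs _ hr']
  rcases lam_half_abs hr (hs.inv.inRange hr') with h | h <;> rw [lam] at h <;> rw [h] <;> norm_num

theorem isStable_orbit {n r : ℕ} (hn : 2 ≤ n) (hr : r = 1 ∨ r = 2) : IsStable (orbit n r) := by
  refine ⟨fun x hx k h1 h2 => ?_, ?_⟩
  · rcases coord_orbit hn hr hx (k := k) (by omega) (by omega) with h | h
    · exact Or.inl h
    · exact Or.inr (Or.inr h)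
  · rintro x ⟨u, hu, rfl⟩ i hi hi'
    refine ⟨s i * u, mul_mem (s_mem hi hi') hu, ?_⟩
    rw [act_smul, act_mul (isSigned_s hn hi hi') (isSigned_of_mem hn hu)]

theorem prod_coord_orbit {n r : ℕ} (hn : 2 ≤ n) {x : E n} (hx : x ∈ orbit n r) :
    ∏ k ∈ Finset.Icc (1 : ℤ) n, coord x k = ∏ k ∈ Finset.Icc (1 : ℤ) n, 2 * lam n r k := by
  obtain ⟨u, hu, rfl⟩ := hx
  have hs := isSigned_of_mem hn hu
  rw [← prod_apply hn (inv_mem hu) (fun k => 2 * lam n r k)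
    (fun k => by rw [lam_neg, mul_neg])]
  refine Finset.prod_congr rfl fun k hk => ?_
  rw [Finset.mem_Icc] at hk
  rw [coord_smul, coord_act' hs _ (inRange_of_pos hk.1 hk.2), lam]

/-- The product of all coordinates is constant on the orbit and the coordinates are $\pm1$, so the
first one is determined by the others. -/
theorem eq_of_coord_orbit {n r : ℕ} (hn : 2 ≤ n) (hr : r = 1 ∨ r = 2) {x y : E n}
    (hx : x ∈ orbit n r) (hy : y ∈ orbit n r)
    (h : ∀ k : ℤ, 2 ≤ k → k ≤ n → coord x k = coord y k) : x = y := by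
  have h1 : (1 : ℤ) ∈ Finset.Icc (1 : ℤ) n := Finset.mem_Icc.2 ⟨le_rfl, by omega⟩
  have h2 := (prod_coord_orbit hn hx).trans (prod_coord_orbit hn hy).symm
  rw [← Finset.mul_prod_erase _ _ h1, ← Finset.mul_prod_erase _ _ h1] at h2
  have h3 : ∏ k ∈ (Finset.Icc (1 : ℤ) n).erase 1, coord x k
      = ∏ k ∈ (Finset.Icc (1 : ℤ) n).erase 1, coord y k := by
    refine Finset.prod_congr rfl fun k hk => ?_
    simp only [Finset.mem_erase, Finset.mem_Icc] at hk
    exact h k (by omega) hk.2.2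
  have h4 : ∏ k ∈ (Finset.Icc (1 : ℤ) n).erase 1, coord y k ≠ 0 := by
    refine Finset.prod_ne_zero_iff.2 fun k hk => ?_
    simp only [Finset.mem_erase, Finset.mem_Icc] at hk
    rcases coord_orbit hn hr hy hk.2.1 hk.2.2 with h | h <;> rw [h] <;> norm_num
  rw [h3] at h2
  have h5 := mul_right_cancel₀ h4 h2
  refine ext_coord fun k hk hk' => ?_
  rcases eq_or_lt_of_le hk with rfl | hk
  · exact h5
  · exact h k (by omega) hk'

/-- The signs of the coordinates of the top vectors in the orbits of `2 ω_1` and `2 ω_2`. -/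
def HasTopSigns {n : ℕ} (x : E n) : Prop :=
  ∀ k : ℕ, 2 ≤ k → k ≤ n → coord x k = if k = 2 ∨ Even (n - k) then -1 else 1

/-- The tail sums from 3 on are $0$ or $-1$ and change at every step, so they alternate, starting
with $-1$ at $n$. If $x_2$ were $1$, one of the first two coefficients would be positive. -/
theorem IsTop.hasTopSigns {n r : ℕ} (hn : 3 ≤ n) (hr : r = 1 ∨ r = 2) {x : E n}
    (hx : x ∈ orbit n r) (ht : IsTop x) : HasTopSigns x := by
  have hn2 : 2 ≤ n := by omega
  have hc := fun (k : ℕ) (h1 : 1 ≤ k) (h2 : k ≤ n) =>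
    coord_orbit hn2 hr hx (k := k) (by omega) (by omega)
  have key : ∀ d k : ℕ, 3 ≤ k → k + d = n →
      coef x k = (if Even d then -1 else 0) ∧ coord x k = if Even d then -1 else 1 := by
    intro d
    induction d with
    | zero =>
      intro k hk hd
      have h1 := coef_succ x hk
      rw [coef_of_gt x (k := k + 1) (by omega) (by omega)] at h1
      have h2 := ht.nonpos k (by omega) (by omega)
      rw [if_pos (by simp), if_pos (by simp)]
      rcases hc k (by omega) (by omega) with h | h
      · exact ⟨by linarith, h⟩
      · linarith
    | succ d ih =>
      intro k hk hd
      obtain ⟨h1, -⟩ := ih (k + 1) (by omega) (by omega)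
      have h2 := coef_succ x hk
      have h3 := ht.coef_of_three_le hn hk
      have h4 := hc k (by omega) (by omega)
      by_cases hd' : Even d
      · rw [if_pos hd'] at h1
        rw [if_neg (by rw [Nat.even_add_one]; simpa using hd'),
          if_neg (by rw [Nat.even_add_one]; simpa using hd')]
        rcases h3 with h3 | ⟨h3, -⟩ <;> rcases h4 with h4 | h4 <;>
          exact ⟨by linarith, by linarith⟩
      · rw [if_neg hd'] at h1
        rw [if_pos (by rw [Nat.even_add_one]; exact hd'),
          if_pos (by rw [Nat.even_add_one]; exact hd')]
        rcases h3 with h3 | ⟨h3, -⟩ <;> rcases h4 with h4 | h4 <;>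
          exact ⟨by linarith, by linarith⟩
  intro k hk hk'
  rcases eq_or_lt_of_le hk with rfl | hk
  · rw [if_pos (Or.inl rfl)]
    have h1 := coef_one_add x
    have h2 := coef_one_sub x
    have h3 := ht.nonpos 1 le_rfl (by omega)
    have h4 := ht.nonpos 2 (by omega) (by omega)
    have h5 := hc 1 le_rfl (by omega)
    have h6 := hc 2 (by omega) (by omega)
    have h7 := ht.coef_of_three_le hn (k := 3) le_rfl
    push_cast at h5 h6 ⊢
    rcases h6 with h6 | h6
    · exact h6
    · exfalso
      rcases h5 with h5 | h5 <;> rcases h7 with h7 | ⟨h7, -⟩ <;> linarith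
  · rw [(key (n - k) k (by omega) (by omega)).2]
    simp [show k ≠ 2 by omega]

theorem HasTopSigns.isNonpos {n r : ℕ} (hn : 3 ≤ n) (hr : r = 1 ∨ r = 2) {x : E n}
    (hx : x ∈ orbit n r) (ht : HasTopSigns x) : IsNonpos x := by
  have key : ∀ d k : ℕ, 3 ≤ k → k + d = n → coef x k = if Even d then -1 else 0 := by
    intro d
    induction d with
    | zero =>
      intro k hk hd
      rw [coef_succ x hk, coef_of_gt x (k := k + 1) (by omega) (by omega),
        ht k (by omega) (by omega), if_pos (Or.inr (by simp [show n - k = 0 by omega])),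
        if_pos (by simp), add_zero]
    | succ d ih =>
      intro k hk hd
      rw [coef_succ x hk, ih (k + 1) (by omega) (by omega), ht k (by omega) (by omega),
        show n - k = d + 1 by omega]
      by_cases hd' : Even d
      · have : ¬Even (d + 1) := by rw [Nat.even_add_one]; simpa using hd'
        rw [if_neg (by simp [this]; omega), if_pos hd', if_neg this]
        norm_num
      · have : Even (d + 1) := by rw [Nat.even_add_one]; exact hd'
        rw [if_pos (Or.inr this), if_neg hd', if_pos this]
        norm_num
  have h3 : ∀ k : ℕ, 3 ≤ k → k ≤ n → coef x k ≤ 0 := by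
    intro k h1 h2
    rw [key (n - k) k h1 (by omega)]
    split_ifs <;> norm_num
  have h1 := coef_one_add x
  have h2 := coef_one_sub x
  have h4 := ht 2 le_rfl (by omega)
  have h5 := h3 3 le_rfl hn
  have h6 := coord_orbit (by omega) hr hx (k := 1) le_rfl (by omega)
  rw [if_pos (Or.inl rfl)] at h4
  push_cast at h4
  intro k hk hk'
  obtain rfl | rfl | hk : k = 1 ∨ k = 2 ∨ 3 ≤ k := by omega
  · rcases h6 with h6 | h6 <;> linarith
  · rcases h6 with h6 | h6 <;> linarith
  · exact h3 k hk hk'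

/-- The signs leave only one candidate for a top vector in the orbit, so any minimal $u$ has the
weight of $w$. For the converse, $w$ is minimal because no other top vector exists. -/
theorem isMinimal_iff_of_hasTopSigns {n r : ℕ} (hn : 3 ≤ n) (hr : r = 1 ∨ r = 2)
    {w : Equiv.Perm ℤ} (hw : w ∈ minReps n r)
    (ht : HasTopSigns ((2 : ℝ) • act n w (fundWeight n r))) (u : Equiv.Perm ℤ) :
    IsMinimalNonpos n r u ↔ u = w := by
  have hn2 : 2 ≤ n := by omega
  have hmem : ∀ {u}, u ∈ minReps n r → (2 : ℝ) • act n u (fundWeight n r) ∈ orbit n r :=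
    fun hu => ⟨_, hu.1, rfl⟩
  have huniq : ∀ z ∈ orbit n r, IsTop z → z = (2 : ℝ) • act n w (fundWeight n r) := by
    intro z hz hz'
    refine eq_of_coord_orbit hn2 hr hz (hmem hw) fun k h1 h2 => ?_
    lift k to ℕ using by omega
    rw [hz'.hasTopSigns hn hr hz k (by omega) (by omega), ht k (by omega) (by omega)]
  constructor
  · intro hu
    have h1 := hu.isTop hn2 (by omega) two_pos ((isStable_orbit hn2 hr).small _ (hmem hu.1.1))
    have h2 := huniq _ (hmem hu.1.1) h1
    exact eq_of_act_eq hn2 (by omega) hu.1.1 hw (smul_right_injective (E n) two_ne_zero h2)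
  · rintro rfl
    refine isMinimalNonpos_of_weight hn2 (by omega) (isStable_orbit hn2 hr) two_pos ?_ hw
      (ht.isNonpos hn hr (hmem hw)) fun z hz hz' _ => huniq z hz hz'
    exact ⟨1, one_mem _, by rw [act_one]⟩

theorem negHead_getElem {K : List ℤ} {j : ℕ} (h : j < (negHead K).length)
    (h' : j < K.length) : (negHead K)[j] = if j = 0 then -K[j] else K[j] := by
  cases K with
  | nil => simp at h'
  | cons t K => cases j <;> simp [negHead]

theorem map_abs_negHead' (K : List ℤ) :
    ((negHead K).map fun x => |x|) = K.map fun x => |x| := by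
  cases K <;> simp [negHead]

theorem prod_sign_negHead' {K : List ℤ} (h : K ≠ []) :
    ((negHead K).map Int.sign).prod = -(K.map Int.sign).prod := by
  cases K with
  | nil => exact absurd rfl h
  | cons t K => simp [negHead]

/-- The minimal elements for `r = 1, 2` from the increasing list of signed numbers in which the
top vector is positive. -/
theorem exists_isMinimal_half {n r : ℕ} (hn : 3 ≤ n) (hr : r = 1 ∨ r = 2) {K : List ℤ}
    (hlen : K.length = n) (hK : K.Pairwise (· < ·)) (hone : 1 ∈ K ∨ -1 ∈ K)
    (hmem : ∀ k : ℕ, 2 ≤ k → k ≤ n → (if k = 2 ∨ Even (n - k) then -(k : ℤ) else k) ∈ K)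
    (hs : (K.map Int.sign).prod = if r = 1 then 1 else -1) :
    ∃ w, oneLine n w = (if r = 1 then K else negHead K) ∧
      ∀ u, IsMinimalNonpos n r u ↔ u = w := by
  have hn2 : 2 ≤ n := by omega
  have hne : K ≠ [] := by
    rintro rfl
    simp at hlen
    omega
  have hperm : (K.map fun x => |x|).Perm (interval 1 n) := by
    have hsub : interval 1 n ⊆ K.map fun x => |x| := by
      intro k hk
      rw [mem_interval] at hk
      lift k to ℕ using by omega
      rw [List.mem_map]
      obtain rfl | hk2 : k = 1 ∨ 2 ≤ k := by omega
      · rcases hone with h | h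
        · exact ⟨1, h, rfl⟩
        · exact ⟨-1, h, rfl⟩
      · refine ⟨_, hmem k hk2 (by omega), ?_⟩
        split_ifs <;> simp
    refine (((List.subperm_of_subset ((interval_pairwise 1 n).imp fun h => h.ne) hsub)
      ).perm_of_length_le ?_).symm
    rw [List.length_map, hlen, length_interval]
    omega
  obtain ⟨w, hw, hline⟩ := exists_oneLine hn2 (L := if r = 1 then K else negHead K)
    (by
      split_ifs
      · exact hperm
      · rwa [map_abs_negHead'])
    (by
      split_ifs at hs ⊢
      · exact hs
      · rw [prod_sign_negHead' hne, hs, neg_neg])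
  have hws := isSigned_of_mem hn2 hw
  -- The weight $\omega_2$ is $\omega_1$ with its first sign changed. With $-w(1)$ in place of
  -- $w(1)$ for $r=2$, the conditions at the nodes other than $r$ say in both cases that `K`
  -- increases.
  have hget : ∀ j (h : j < K.length), K[j] = if j = 0 ∧ r = 2 then -w 1 else w ((j : ℤ) + 1) := by
    intro j h
    have hj : j < (if r = 1 then K else negHead K).length := by
      rw [← hline, length_oneLine, ← hlen]
      exact h
    have h1 := oneLine_getElem hline hj
    rcases hr with rfl | rfl
    · simp only [if_true] at h1
      rw [h1, if_neg (by omega)]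
    · simp only [show (2 : ℕ) ≠ 1 by norm_num, if_false] at h1
      rw [negHead_getElem _ h] at h1
      by_cases hj0 : j = 0
      · subst hj0
        rw [if_pos rfl] at h1
        rw [if_pos ⟨rfl, rfl⟩]
        norm_num at h1
        omega
      · rw [if_neg hj0] at h1
        rw [h1, if_neg (by omega)]
  rw [List.pairwise_iff_getElem] at hK
  have hmr : w ∈ minReps n r := by
    rw [mem_minReps_iff hn2]
    refine ⟨hw, fun i hi hi' hir => ?_⟩
    rcases lo_cases hi with ⟨h1, h2⟩ | ⟨h1, h2⟩
    · have := hK 0 1 (by omega) (by omega) (by norm_num)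
      rw [hget, hget, if_pos ⟨rfl, by omega⟩, if_neg (by omega)] at this
      rw [h1, show lo 1 = -2 from rfl, hws.1]
      norm_num at this
      omega
    · have := hK (i - 2).toNat (i - 1).toNat (by omega) (by omega) (by omega)
      rw [hget, hget, if_neg (by omega), if_neg (by omega),
        show ((i - 2).toNat : ℤ) + 1 = i - 1 by omega,
        show ((i - 1).toNat : ℤ) + 1 = i by omega] at this
      rwa [h2]
  -- The two sign changes at the first entry cancel when $r=2$, so every entry of `K` is a signed
  -- index at which the doubled weight is $+1$.
  have hcoord : ∀ x ∈ K, coord ((2 : ℝ) • act n w (fundWeight n r)) x = 1 := by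
    intro x hx
    obtain ⟨j, hj, rfl⟩ := List.getElem_of_mem hx
    have h1 : coord (act n w (fundWeight n r)) (w ((j : ℤ) + 1)) = lam n r ((j + 1 : ℕ) : ℤ) := by
      have := coord_act hws (fundWeight n r) (a := (j : ℤ) + 1)
        (inRange_of_pos (by omega) (by omega))
      rw [this, lam]
      push_cast
      rfl
    rw [lam_half hr (by omega) (by omega)] at h1
    rw [hget j hj, coord_smul]
    by_cases hc : j = 0 ∧ r = 2
    · obtain ⟨rfl, h2⟩ := hc
      rw [if_pos ⟨by omega, h2⟩] at h1
      rw [if_pos ⟨rfl, h2⟩, coord_neg_right]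
      norm_num at h1
      rw [h1]
      norm_num
    · rw [if_neg (by omega)] at h1
      rw [if_neg hc, h1]
      norm_num
  refine ⟨w, hline, isMinimal_iff_of_hasTopSigns hn hr hmr fun k hk hk' => ?_⟩
  have := hcoord _ (hmem k hk hk')
  split_ifs at this ⊢
  · rw [coord_neg_right] at this
    linarith
  · exact this

theorem down_eq (n : ℕ) : down n = (List.range (n / 2)).map fun j : ℕ => -((n : ℤ) - 2 * j) := by
  rw [down, bind_cast, List.map_map]
  rfl

theorem up_eq (n : ℕ) : up n
    = (List.range (n / 2 - 1)).map fun j : ℕ => (if Even n then 3 else 4) + 2 * (j : ℤ) := by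
  rw [up, bind_cast, List.map_map]
  rfl

theorem mem_down {n : ℕ} {x : ℤ} : x ∈ down n ↔ ∃ j : ℕ, j < n / 2 ∧ x = -((n : ℤ) - 2 * j) := by
  simp only [down_eq, List.mem_map, List.mem_range, eq_comm]

theorem mem_up {n : ℕ} {x : ℤ} :
    x ∈ up n ↔ ∃ j : ℕ, j < n / 2 - 1 ∧ x = (if Even n then 3 else 4) + 2 * (j : ℤ) := by
  simp only [up_eq, List.mem_map, List.mem_range, eq_comm]

/-- `(-n, …, δ, …, n - 1)` with `δ` in place of `±1`. -/
def halfLine (n : ℕ) (δ : ℤ) : List ℤ :=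
  down n ++ (if Even n then [δ] else [-2, δ]) ++ up n

theorem halfLine_pairwise {n : ℕ} {δ : ℤ} (hδ : δ = 1 ∨ δ = -1) :
    (halfLine n δ).Pairwise (· < ·) := by
  have hd : (down n).Pairwise (· < ·) := by
    rw [down_eq, List.pairwise_map]
    exact List.pairwise_lt_range.imp fun h => by omega
  have hu : (up n).Pairwise (· < ·) := by
    rw [up_eq, List.pairwise_map]
    exact List.pairwise_lt_range.imp fun h => by omega
  have hu' : ∀ x ∈ up n, 3 ≤ x := by
    intro x hx
    obtain ⟨j, -, rfl⟩ := mem_up.1 hx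
    split_ifs <;> omega
  unfold halfLine
  rw [List.pairwise_append, List.pairwise_append]
  by_cases hn : Even n
  · rw [if_pos hn]
    rw [Nat.even_iff] at hn
    refine ⟨⟨hd, List.pairwise_singleton _ _, fun x hx y hy => ?_⟩, hu, fun x hx y hy => ?_⟩
    · obtain ⟨j, hj, rfl⟩ := mem_down.1 hx
      rw [List.mem_singleton] at hy
      omega
    · have := hu' y hy
      rcases List.mem_append.1 hx with hx | hx
      · obtain ⟨j, hj, rfl⟩ := mem_down.1 hx
        omega
      · rw [List.mem_singleton] at hx
        omega
  · rw [if_neg hn]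
    rw [Nat.even_iff] at hn
    refine ⟨⟨hd, ?_, fun x hx y hy => ?_⟩, hu, fun x hx y hy => ?_⟩
    · rw [List.pairwise_pair]
      omega
    · obtain ⟨j, hj, rfl⟩ := mem_down.1 hx
      simp only [List.mem_cons, List.not_mem_nil, or_false] at hy
      omega
    · have := hu' y hy
      rcases List.mem_append.1 hx with hx | hx
      · obtain ⟨j, hj, rfl⟩ := mem_down.1 hx
        omega
      · simp only [List.mem_cons, List.not_mem_nil, or_false] at hx
        omega

theorem length_halfLine {n : ℕ} (hn : 2 ≤ n) (δ : ℤ) : (halfLine n δ).length = n := by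
  rw [halfLine, List.length_append, List.length_append, down_eq, up_eq, List.length_map,
    List.length_map, List.length_range, List.length_range]
  by_cases h : Even n
  · rw [if_pos h, List.length_singleton]
    rw [Nat.even_iff] at h
    omega
  · rw [if_neg h, List.length_cons, List.length_singleton]
    rw [Nat.even_iff] at h
    omega

theorem mem_halfLine {n : ℕ} (δ : ℤ) {k : ℕ} (hk : 2 ≤ k) (hk' : k ≤ n) :
    (if k = 2 ∨ Even (n - k) then -(k : ℤ) else k) ∈ halfLine n δ := by
  rw [halfLine, List.mem_append, List.mem_append, mem_down, mem_up]
  by_cases hn : Even n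
  · rw [if_pos hn, if_pos hn]
    rw [Nat.even_iff] at hn
    split_ifs with h
    · rw [Nat.even_iff] at h
      exact Or.inl (Or.inl ⟨(n - k) / 2, by omega, by omega⟩)
    · rw [Nat.even_iff] at h
      exact Or.inr ⟨(k - 3) / 2, by omega, by omega⟩
  · rw [if_neg hn, if_neg hn]
    rw [Nat.even_iff] at hn
    split_ifs with h
    · rw [Nat.even_iff] at h
      by_cases h2 : k = 2
      · subst h2
        exact Or.inl (Or.inr (by simp))
      · exact Or.inl (Or.inl ⟨(n - k) / 2, by omega, by omega⟩)
    · rw [Nat.even_iff] at h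
      exact Or.inr ⟨(k - 4) / 2, by omega, by omega⟩

theorem prod_sign_halfLine {n : ℕ} (δ : ℤ) :
    ((halfLine n δ).map Int.sign).prod = (-1) ^ (n / 2) * (if Even n then δ.sign else -δ.sign) := by
  have hd : ((down n).map Int.sign).prod = (-1) ^ (n / 2) := by
    rw [List.prod_eq_pow_card _ (-1), List.length_map, down_eq, List.length_map, List.length_range]
    intro x hx
    obtain ⟨y, hy, rfl⟩ := List.mem_map.1 hx
    obtain ⟨j, hj, rfl⟩ := mem_down.1 hy
    exact Int.sign_eq_neg_one_of_neg (by omega)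
  have hu : ((up n).map Int.sign).prod = 1 := by
    refine prod_sign_of_pos fun x hx => ?_
    obtain ⟨j, -, rfl⟩ := mem_up.1 hx
    split_ifs <;> omega
  rw [halfLine, List.map_append, List.map_append, List.prod_append, List.prod_append, hd, hu,
    mul_one]
  split_ifs <;> simp [show Int.sign 2 = 1 from rfl]

/-- The hypothesis on signs is membership in the Weyl group; it fixes $\delta$ in terms of $n$
modulo 4 and $r$. -/
theorem exists_isMinimal_halfLine {n r : ℕ} (hn : 3 ≤ n) (hr : r = 1 ∨ r = 2) {δ : ℤ}
    (hδ : δ = 1 ∨ δ = -1)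
    (hs : (-1) ^ (n / 2) * (if Even n then δ.sign else -δ.sign) = if r = 1 then 1 else (-1 : ℤ)) :
    ∃ w, oneLine n w = (if r = 1 then halfLine n δ else negHead (halfLine n δ)) ∧
      ∀ u, IsMinimalNonpos n r u ↔ u = w := by
  refine exists_isMinimal_half hn hr (length_halfLine (by omega) δ) (halfLine_pairwise hδ) ?_
    (fun k => mem_halfLine δ) ((prod_sign_halfLine δ).trans hs)
  rcases hδ with rfl | rfl
  · left
    unfold halfLine
    split_ifs <;> simp
  · right
    unfold halfLine
    split_ifs <;> simp

theorem negHead_append {K L : List ℤ} (h : K ≠ []) : negHead (K ++ L) = negHead K ++ L := by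
  cases K with
  | nil => exact absurd rfl h
  | cons t K => rfl

theorem down_ne_nil {n : ℕ} (hn : 2 ≤ n) : down n ≠ [] := by
  intro h
  have := congrArg List.length h
  rw [down_eq, List.length_map, List.length_range, List.length_nil] at this
  omega

theorem exists_isMinimal_one {n : ℕ} (hn : 3 ≤ n) :
    ∃ w, oneLine n w = wOne n ∧ ∀ u, IsMinimalNonpos n 1 u ↔ u = w := by
  have key := fun (δ : ℤ) => exists_isMinimal_halfLine (r := 1) (δ := δ) hn (Or.inl rfl)
  simp only [if_true, halfLine] at key
  unfold wOne
  obtain h | h | h | h : n % 4 = 0 ∨ n % 4 = 2 ∨ n % 4 = 1 ∨ n % 4 = 3 := by omega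
  all_goals simp only [h, if_true, show (2 : ℕ) ≠ 0 by norm_num, show (1 : ℕ) ≠ 0 by norm_num,
    show (1 : ℕ) ≠ 2 by norm_num, show (3 : ℕ) ≠ 0 by norm_num, show (3 : ℕ) ≠ 2 by norm_num,
    show (3 : ℕ) ≠ 1 by norm_num, if_false]
  · have he : Even n := Nat.even_iff.2 (by omega)
    have hh : Even (n / 2) := Nat.even_iff.2 (by omega)
    simpa [he, hh.neg_one_pow] using key 1
  · have he : Even n := Nat.even_iff.2 (by omega)
    have hh : Odd (n / 2) := Nat.odd_iff.2 (by omega)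
    simpa [he, hh.neg_one_pow] using key (-1)
  · have he : ¬Even n := by rw [Nat.even_iff]; omega
    have hh : Even (n / 2) := Nat.even_iff.2 (by omega)
    simpa [he, hh.neg_one_pow] using key (-1)
  · have he : ¬Even n := by rw [Nat.even_iff]; omega
    have hh : Odd (n / 2) := Nat.odd_iff.2 (by omega)
    simpa [he, hh.neg_one_pow] using key 1

theorem exists_isMinimal_two {n : ℕ} (hn : 3 ≤ n) :
    ∃ w, oneLine n w = wTwo n ∧ ∀ u, IsMinimalNonpos n 2 u ↔ u = w := by
  have key := fun (δ : ℤ) => exists_isMinimal_halfLine (r := 2) (δ := δ) hn (Or.inr rfl)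
  simp only [show (2 : ℕ) ≠ 1 by norm_num, if_false, halfLine, List.append_assoc,
    negHead_append (down_ne_nil (show 2 ≤ n by omega))] at key
  unfold wTwo
  obtain h | h | h | h : n % 4 = 0 ∨ n % 4 = 2 ∨ n % 4 = 1 ∨ n % 4 = 3 := by omega
  all_goals simp only [h, if_true, show (2 : ℕ) ≠ 0 by norm_num, show (1 : ℕ) ≠ 0 by norm_num,
    show (1 : ℕ) ≠ 2 by norm_num, show (3 : ℕ) ≠ 0 by norm_num, show (3 : ℕ) ≠ 2 by norm_num,
    show (3 : ℕ) ≠ 1 by norm_num, if_false]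
  · have he : Even n := Nat.even_iff.2 (by omega)
    have hh : Even (n / 2) := Nat.even_iff.2 (by omega)
    simpa [he, hh.neg_one_pow] using key (-1)
  · have he : Even n := Nat.even_iff.2 (by omega)
    have hh : Odd (n / 2) := Nat.odd_iff.2 (by omega)
    simpa [he, hh.neg_one_pow] using key 1
  · have he : ¬Even n := by rw [Nat.even_iff]; omega
    have hh : Even (n / 2) := Nat.even_iff.2 (by omega)
    simpa [he, hh.neg_one_pow] using key 1
  · have he : ¬Even n := by rw [Nat.even_iff]; omega
    have hh : Odd (n / 2) := Nat.odd_iff.2 (by omega)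
    simpa [he, hh.neg_one_pow] using key (-1)

/-! ### Completeness of the lists, the case $r=n$, and the final statement. -/

theorem minimal_even {n r q : ℕ} (hn : 3 ≤ n) (hr : 3 ≤ r) (hr' : r ≤ n)
    (h : n + 1 = r + 2 * (q + 1)) {u : Equiv.Perm ℤ} (hu : IsMinimalNonpos n r u) :
    (∃ i ∈ J (q + 1) 3 n, oneLine n u = wE n (q + 1) i) ∨
      ∃ i ∈ J q 4 n, oneLine n u = wE1 n (q + 1) i ∨ oneLine n u = wE2 n (q + 1) i := by
  have hn2 : 2 ≤ n := by omega
  obtain ⟨y, hy, huy⟩ := (isTopFamily_even hn h).exists_weight hn2 hr hr' hu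
  rcases hy with ⟨l, hl, rfl⟩ | ⟨q', hq', l, hl, hy⟩
  · exact Or.inl ⟨l, hl, (hasPair_vE hr hr' h hl).oneLine_eq hn2 (by omega) hu.1.1 huy⟩
  · obtain rfl : q' = q := by omega
    rcases hy with rfl | rfl
    · exact Or.inr ⟨l, hl, Or.inl
        ((hasPair_vE1 hr hr' h hl).oneLine_eq hn2 (by omega) hu.1.1 huy)⟩
    · exact Or.inr ⟨l, hl, Or.inr
        ((hasPair_vE2 hr hr' h hl).oneLine_eq hn2 (by omega) hu.1.1 huy)⟩

theorem minimal_odd {n r m : ℕ} (hn : 3 ≤ n) (hr : 3 ≤ r) (hr' : r ≤ n)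
    (h : n + 1 = r + (2 * m + 1)) {u : Equiv.Perm ℤ} (hu : IsMinimalNonpos n r u) :
    (∃ i ∈ J m 4 n, oneLine n u = wO n m i) ∨
      ∃ q, q + 1 = m ∧ ∃ i ∈ J q 5 n, oneLine n u = wO1 n m i ∨ oneLine n u = wO2 n m i := by
  have hn2 : 2 ≤ n := by omega
  obtain ⟨y, hy, huy⟩ := (isTopFamily_odd hn h).exists_weight hn2 hr hr' hu
  rcases hy with ⟨l, hl, rfl⟩ | ⟨q, rfl, l, hl, hy⟩
  · exact Or.inl ⟨l, hl, (hasPair_vO hr hr' h hl).oneLine_eq hn2 (by omega) hu.1.1 huy⟩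
  · rcases hy with rfl | rfl
    · exact Or.inr ⟨q, rfl, l, hl, Or.inl
        ((hasPair_vO2 hr h hl).oneLine_eq hn2 (by omega) hu.1.1 huy)⟩
    · exact Or.inr ⟨q, rfl, l, hl, Or.inr
        ((hasPair_vO1 hr h hl).oneLine_eq hn2 (by omega) hu.1.1 huy)⟩

theorem matched_vO {n r m : ℕ} (hn : 3 ≤ n) (hr : 3 ≤ r) (hr' : r ≤ n)
    (h : n + 1 = r + (2 * m + 1)) {i : List ℤ} (hi : i ∈ J m 4 n) :
    Matched n r (vO n m i) (endC n + rootSum n i) (s 1 * s 2 * word i) (wO n m i) :=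
  (hasPair_vO hr hr' h hi).matched (isTopFamily_odd hn h) (by omega) hr hr' (Or.inl ⟨i, hi, rfl⟩)

theorem nil_mem_J (a b : ℤ) : [] ∈ J 0 a b := ⟨rfl, by simp, List.isChain_nil⟩

theorem eq_nil_of_mem_J {a b : ℤ} {i : List ℤ} (h : i ∈ J 0 a b) : i = [] :=
  List.eq_nil_of_length_eq_zero h.1

theorem rest_nil (a n : ℕ) : rest a n [] = interval a n := by
  simp [rest, pred]

theorem vO_zero (n : ℕ) : vO n 0 [] = vLast n := by
  simp [vO, vLast, rest_nil, pred, neg]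

theorem wO_zero (n : ℕ) : wO n 0 [] = wLast n := by
  simp [wO, wLast, rest_nil, pred, neg]

theorem matched_vLast {n : ℕ} (hn : 3 ≤ n) :
    Matched n n (vLast n) (endC n) (s 1 * s 2) (wLast n) := by
  have := matched_vO hn hn le_rfl (m := 0) (by omega) (nil_mem_J 4 n)
  rwa [vO_zero, wO_zero, rootSum_nil, add_zero, show word [] = 1 from rfl, mul_one] at this

end TypeD

open TypeD
theorem proposition5p3 (n : ℕ) (hn : 3 ≤ n) :
    -- (i) `r = 1`
    (∃ w, oneLine n w = wOne n ∧ ∀ u, IsMinimalNonpos n 1 u ↔ u = w) ∧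
    -- (ii) `r = 2`
    (∃ w, oneLine n w = wTwo n ∧ ∀ u, IsMinimalNonpos n 2 u ↔ u = w) ∧
    -- (iii) `3 ≤ r ≤ n - 1` and `n + 1 - r = 2 m`
    (∀ r m : ℕ, 3 ≤ r → r + 1 ≤ n → n + 1 = r + 2 * m →
      (∀ i ∈ J m 3 n,
        Matched n r (vE n m i) (rootSum n i) (word i) (wE n m i)) ∧
      (∀ i ∈ J (m - 1) 4 n,
        Matched n r (vE1 n m i) (simpleRoot n 1 + rootSum n i) (s 1 * word i) (wE1 n m i)) ∧
      (∀ i ∈ J (m - 1) 4 n,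
        Matched n r (vE2 n m i) (simpleRoot n 2 + rootSum n i) (s 2 * word i) (wE2 n m i)) ∧
      ∀ u, IsMinimalNonpos n r u →
        (∃ i ∈ J m 3 n, oneLine n u = wE n m i) ∨
        (∃ i ∈ J (m - 1) 4 n, oneLine n u = wE1 n m i ∨ oneLine n u = wE2 n m i)) ∧
    -- (iv) `3 ≤ r ≤ n - 1` and `n + 1 - r = 2 m + 1`
    (∀ r m : ℕ, 3 ≤ r → r + 1 ≤ n → n + 1 = r + (2 * m + 1) →
      (∀ i ∈ J m 4 n,
        Matched n r (vO n m i)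
          ((1 / 2 : ℝ) • simpleRoot n 1 + (1 / 2 : ℝ) • simpleRoot n 2 + rootSum n i)
          (s 1 * s 2 * word i) (wO n m i)) ∧
      (∀ i ∈ J (m - 1) 5 n, ∃ v₁ v₂ w₁ w₂ : Equiv.Perm ℤ,
        ListedMax n r (vO1 n m i)
          ((3 / 2 : ℝ) • simpleRoot n 1 + (1 / 2 : ℝ) • simpleRoot n 2 + simpleRoot n 3
            + rootSum n i) v₁ ∧
        ListedMax n r (vO2 n m i)
          ((1 / 2 : ℝ) • simpleRoot n 1 + (3 / 2 : ℝ) • simpleRoot n 2 + simpleRoot n 3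
            + rootSum n i) v₂ ∧
        ListedMin n r (wO1 n m i) w₁ ∧
        ListedMin n r (wO2 n m i) w₂ ∧
        w₂ = s 2 * s 3 * s 1 * word i * v₁ ∧
        w₁ = s 1 * s 3 * s 2 * word i * v₂ ∧
        act n w₁ (fundWeight n r) = -act n v₁ (fundWeight n r) ∧
        act n w₂ (fundWeight n r) = -act n v₂ (fundWeight n r)) ∧
      ∀ u, IsMinimalNonpos n r u →
        (∃ i ∈ J m 4 n, oneLine n u = wO n m i) ∨
        (∃ i ∈ J (m - 1) 5 n, oneLine n u = wO1 n m i ∨ oneLine n u = wO2 n m i)) ∧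
    -- (v) `r = n`
    (Matched n n (vLast n) ((1 / 2 : ℝ) • simpleRoot n 1 + (1 / 2 : ℝ) • simpleRoot n 2)
        (s 1 * s 2) (wLast n) ∧
      ∀ u, IsMinimalNonpos n n u → oneLine n u = wLast n) := by
  have hn2 : 2 ≤ n := by omega
  refine ⟨exists_isMinimal_one hn, exists_isMinimal_two hn, ?_, ?_, matched_vLast hn, ?_⟩
  · intro r m hr hr' h
    -- As $r<n$, one has $m\ge1$, so the subtraction $m-1$ is not truncated.
    obtain ⟨q, rfl⟩ : ∃ q, m = q + 1 := ⟨m - 1, by omega⟩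
    have hP := isTopFamily_even hn h
    rw [Nat.add_sub_cancel]
    refine ⟨fun i hi => ?_, fun i hi => ?_, fun i hi => ?_, fun u hu => ?_⟩
    · exact (hasPair_vE hr (by omega) h hi).matched hP hn2 hr (by omega) (Or.inl ⟨i, hi, rfl⟩)
    · exact (hasPair_vE1 hr (by omega) h hi).matched hP hn2 hr (by omega)
        (Or.inr ⟨q, rfl, i, hi, Or.inl rfl⟩)
    · exact (hasPair_vE2 hr (by omega) h hi).matched hP hn2 hr (by omega)
        (Or.inr ⟨q, rfl, i, hi, Or.inr rfl⟩)
    · exact minimal_even hn hr (by omega) h hu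
  · intro r m hr hr' h
    obtain ⟨q, rfl⟩ : ∃ q, m = q + 1 := ⟨m - 1, by omega⟩
    have hP := isTopFamily_odd hn h
    rw [Nat.add_sub_cancel]
    refine ⟨fun i hi => matched_vO hn hr (by omega) h hi, fun i hi => ?_, fun u hu => ?_⟩
    · obtain ⟨v₁, a1, a2, a3, a4, a5, a6⟩ := hasPair_vO1 hr h hi
      obtain ⟨v₂, b1, b2, b3, b4, b5, b6⟩ := hasPair_vO2 hr h hi
      have hD1 : OddWeight n (q + 1) (endD1 n + rootSum n i) :=
        Or.inr ⟨q, rfl, i, hi, Or.inl rfl⟩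
      have hD2 : OddWeight n (q + 1) (endD2 n + rootSum n i) :=
        Or.inr ⟨q, rfl, i, hi, Or.inr rfl⟩
      have hrn : r ≤ n := by omega
      exact ⟨v₁, v₂, _, _, ⟨a2, hP.isMaximal hn2 hr hrn a1 hD1 a3, a3⟩,
        ⟨b2, hP.isMaximal hn2 hr hrn b1 hD2 b3, b3⟩,
        ⟨b5, hP.isMinimal hn2 hr hrn b4 hD1 b6⟩,
        ⟨a5, hP.isMinimal hn2 hr hrn a4 hD2 a6⟩, rfl, rfl, by rw [b6, a3], by rw [a6, b3]⟩
    · rcases minimal_odd hn hr (by omega) h hu with h1 | ⟨q', hq', h1⟩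
      · exact Or.inl h1
      · obtain rfl : q' = q := by omega
        exact Or.inr h1
  · intro u hu
    -- The case $r=n$ is the odd family with $m=0$: only the empty tuple occurs, and the larger
    -- endings would need $m\ge1$.
    rcases minimal_odd hn hn le_rfl (m := 0) (by omega) hu with ⟨i, hi, h1⟩ | ⟨q, hq, -⟩
    · rw [h1, eq_nil_of_mem_J hi, wO_zero]
    · omega
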